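/- **Conventions.** Graphs $G=(V,E,l)$ are finite multigraphs with edge lengths $l$; $n=|V|$, and the weight of an edge is $w(e)=1/l(e)$. $H$ is a *subgraph of $G$ in the weighted sense* if it is a subgraph and $l_H\ge l_G$ on its edges. $H$ is *embeddable* into $G$ if there are a map $\pi:V_H\to V_G$, for every edge $f=xy$ of $H$ a simple path $\mathrm{Path}(f)$ of $G$ with at least one edge from $\pi(x)$ to $\pi(y)$, and weights $W(f,e)$, positive for $e\in\mathrm{Path}(f)$ and zero otherwise, such that $\sum_f W(f,e)\le w_G(e)$ for every $e\in E_G$ and $\sum_{e\in \mathrm{Path}(f)}1/W(f,e)\le l_H(f)$ for every $f\in E_H$. A *Bartal decomposition* of a connected $G$ is a sequence of forests $\mathcal B=(B_0,\dots,B_t)$ on $V$, each a subgraph of $G$ in the weighted sense, with $B_0$ a spanning tree, $B_t$ without edges, and such that vertices connected in $B_{i+1}$ are connected in $B_i$. It is *embeddable* if the union of the $B_i$ (with one copy of an edge per level) is embeddable into $G$. Positive numbers $\mathbf d=(d_0,\dots,d_t)$ with $d_{i+1}\le c\,d_i$ *bound the diameter* of $\mathcal B$ (with ratio $c$) if for every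 $i$ each component of $B_i$ has diameter at most $d_i$ and each edge $e\in B_i$ has $l(e)\le d_i/\log n$. If the ends of $e$ are connected in $B_i$ but not in $B_{i+1}$, then $e$ is first cut at level $i$ and $\mathrm{str}^p_{\mathcal B,\mathbf d}(e)=(d_i/l(e))^p$. For a tree $T$ containing $V$, $\mathrm{str}^p_T(uv)=(l_T(u,v)/l(uv))^p$. A *partition routine with constant $K$* takes a graph $H$ with $n_H$ vertices and a number $d>0$, and returns a random partition of $V_H$, together with a shortest path tree, of diameter at most $d$, of the subgraph induced by each part, such that every edge $e$ of $H$ is cut with probability at most $K\,l(e)\log n_H/d$. *DecomposeSimple* (Bartal's algorithm), for bounds $\mathbf d'=(d'_0,\dots,d'_t)$: $B'_0$ is a shortest path tree from an arbitrary vertex; for $i=1,\dots,t$, remove all edges of length at least $d_i'/\log n$, run the partition routine independently with parameter $d_i'$ on the subgraph induced by each component of $B'_{i-1}$, and let $B'_i$ be the union of the returned trees. *EmbeddableDecompose* (exponents $p<q$, constant $c_{geo}$): run DecomposeSimple on $G$ with lengths $l(e)^{p/q}$, and multiply the lengths in $B'_i$ and the bound $d'_i$ by $\frac{c_{geo}}{q-p}\left(\frac{d_i'}{\log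 n}\right)^{(q-p)/p}$, giving $\mathcal B$ and $\mathbf d$. A *tree reduction* replaces a tree $T$ and a set $S$ of $k\ge1$ of its vertices by a tree with at most $2k-1$ vertices, including $S$, with the same distances between vertices of $S$, embeddable into $T$ with each of its vertices being a copy of a vertex of $T$ (itself). *BuildTree*, for $\mathcal B$: choose one center in each component of each $B_i$, so that centers of level $i$ are centers of level $i+1$; for each $i<t$ and each component of $B_i$, connect the centers of level $i+1$ in it by a tree reduction of that component's tree, the further vertices of which are new (Steiner) vertices; return the union $T$ of these trees. **Lemma.** There are absolute constants $K,c_{geo},C>0$ and $c\in(0,1)$ such that partition routines with constant $K$, and tree reductions, exist, and for any of these the following holds. Let $G=(V,E,l)$ be a connected multigraph without self-loops, with $n\ge2$ vertices and edge lengths in $[1,\Delta]$. Let $0<p<1$, $q=\frac{1+p}2$, and $d'_i=2n\Delta/4^i$ for $0\le i\le t$, where $d'_t<1$. Then a shortest path tree as needed for $B_0'$ exists, and for every choice of it the random $\mathcal B$ returned by EmbeddableDecompose on $G$ is always an embeddable Bartal decomposition of $G$ whose diameter is bounded by $\mathbf d$ (with ratio $c$), and for every edge $e$ $$\mathbb E_{\mathcal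 B}\left[\mathrm{str}^p_{\mathcal B,\mathbf d}(e)\right]\le C\left(\frac1{1-p}\right)^2\log^p n .$$ Moreover, centers for $\mathcal B$ exist, and for every choice of them (depending on $\mathcal B$) the graph $T$ returned by BuildTree on $\mathcal B$ is always a tree that contains $V$ and is embeddable into $G$, and for every edge $e$ $$\mathbb E_{\mathcal B}\left[\mathrm{str}^p_{T}(e)\right]\le C\left(\frac1{1-p}\right)^2\log^p n .$$ -/

import Mathlib

open scoped ENNReal

universe u v w

namespace LowStretch

/-! ### Multigraphs with edge lengths -/

/-- A multigraph `(V, E, l)`: Mathlib's multigraphs together with a length for every edge. -/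
structure LGraph (α : Type u) (β : Type v) extends Graph α β where
  /-- The length of an edge (only meaningful on the edge set). -/
  len : β → ℝ

variable {α : Type u} {β : Type v} {α' : Type w} {β' : Type*}

/-- All edge lengths are positive. -/
def LGraph.PosLen (G : LGraph α β) : Prop := ∀ e ∈ G.edgeSet, 0 < G.len e

/-- The spanning subgraph with edge set `E(G) ∩ F`. -/
def LGraph.restrictEdges (G : LGraph α β) (F : Set β) : LGraph α β where
  toGraph := G.toGraph.restrict F
  len := G.len

/-- The subgraph induced by a set of vertices. -/
def LGraph.inducedOn (G : LGraph α β) (U : Set α) : LGraph α β where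
  toGraph := G.toGraph.induce U
  len := G.len

/-- The same graph with all lengths raised to the power `s`. -/
noncomputable def LGraph.powLen (G : LGraph α β) (s : ℝ) : LGraph α β where
  toGraph := G.toGraph
  len := fun e => G.len e ^ s

/-- The same graph with all lengths multiplied by `s`. -/
def LGraph.scaleLen (G : LGraph α β) (s : ℝ) : LGraph α β where
  toGraph := G.toGraph
  len := fun e => s * G.len e

/-- The same graph with every vertex renamed by `f`. -/
def LGraph.mapVert (f : α → α') (G : LGraph α β) : LGraph α' β where
  toGraph := G.toGraph.map f
  len := G.len

/-- The union of a family of graphs on a common vertex type, keeping a separate copy of every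
edge of every member of the family. -/
def LGraph.edgeUnion {ι : Type*} (Γ : ι → LGraph α β) : LGraph α (ι × β) where
  vertexSet := ⋃ i, (Γ i).vertexSet
  IsLink f x y := (Γ f.1).IsLink f.2 x y
  isLink_symm := fun _ _ => ⟨fun _ _ h => Graph.IsLink.symm h⟩
  eq_or_eq_of_isLink_of_isLink := fun _ _ _ _ _ h h' => Graph.IsLink.left_eq_or_eq h h'
  left_mem_of_isLink := fun _ _ _ h => Set.mem_iUnion.2 ⟨_, Graph.IsLink.left_mem h⟩
  len f := (Γ f.1).len f.2

/-- `IsWalk G u w v`: the list `w` of (edge, next vertex) steps is a walk of `G` from `u` to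
`v`. -/
inductive IsWalk (G : Graph α β) : α → List (β × α) → α → Prop
  | nil {u : α} (hu : u ∈ G.vertexSet) : IsWalk G u [] u
  | cons {u x v : α} {e : β} {w : List (β × α)} (h : G.IsLink e u x) (hw : IsWalk G x w v) :
      IsWalk G u ((e, x) :: w) v

/-- A path: a walk that repeats no vertex. -/
def IsPath (G : Graph α β) (u : α) (w : List (β × α)) (v : α) : Prop :=
  IsWalk G u w v ∧ (u :: w.map Prod.snd).Nodup

/-- `u` and `v` are in the same connected component of `G`. -/
def Connects (G : Graph α β) (u v : α) : Prop := ∃ w, IsWalk G u w v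

/-- The vertex set of the connected component of `u`. -/
def component (G : Graph α β) (u : α) : Set α := {v | Connects G u v}

/-- The set of (vertex sets of) connected components of `G`. -/
def components (G : Graph α β) : Set (Set α) := component G '' G.vertexSet

/-- Nonempty and connected. -/
def IsConnected (G : Graph α β) : Prop :=
  G.vertexSet.Nonempty ∧ ∀ u ∈ G.vertexSet, ∀ v ∈ G.vertexSet, Connects G u v

/-- A forest: every edge is a bridge, that is, there is no cycle. -/
def IsForest (G : Graph α β) : Prop :=
  ∀ e x y, G.IsLink e x y → ¬ Connects (G.deleteEdges {e}) x y

/-- A tree is a connected forest. -/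
def IsTree (G : Graph α β) : Prop := IsConnected G ∧ IsForest G

/-- The length of a walk. -/
def LGraph.walkLen (G : LGraph α β) (w : List (β × α)) : ℝ := (w.map fun s => G.len s.1).sum

/-- The shortest-path distance, `∞` between different components.  In a tree this is the length
of the unique path. -/
noncomputable def LGraph.dist (G : LGraph α β) (u v : α) : ℝ≥0∞ :=
  ⨅ (w : List (β × α)) (_ : IsWalk G.toGraph u w v), ENNReal.ofReal (G.walkLen w)

/-- Subgraph in the weighted sense: a subgraph whose edge weights (the reciprocals of the
lengths) are at most the original ones. -/
def LGraph.WSubgraph (H G : LGraph α β) : Prop :=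
  H.toGraph ≤ G.toGraph ∧ ∀ e ∈ H.edgeSet, G.len e ≤ H.len e

/-- `T` is a shortest path tree of `H` with root `r`. -/
def IsShortestPathTree (T H : LGraph α β) (r : α) : Prop :=
  T.toGraph ≤ H.toGraph ∧ T.len = H.len ∧ T.vertexSet = H.vertexSet ∧ r ∈ H.vertexSet ∧
    IsTree T.toGraph ∧ ∀ v ∈ H.vertexSet, T.dist r v = H.dist r v

/-! ### Path embeddings -/

/-- A path embedding of `H` into `G` with congestion and dilation at most one.
Edge weights are reciprocals of lengths. -/
structure PathEmbedding {α : Type*} {β : Type*} {α' : Type*} {β' : Type*} [Finite β']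
    (H : LGraph α' β') (G : LGraph α β) where
  /-- The map on vertices. -/
  π : α' → α
  /-- The path of `G` assigned to an edge of `H`. -/
  path : β' → List (β × α)
  /-- The weight of an edge of `G` on the path of an edge of `H`. -/
  W : β' → β → ℝ
  π_mem : ∀ x ∈ H.vertexSet, π x ∈ G.vertexSet
  path_isPath : ∀ f ∈ H.edgeSet,
    ∃ x y, H.IsLink f x y ∧ IsPath G.toGraph (π x) (path f) (π y) ∧ path f ≠ []
  W_pos : ∀ f ∈ H.edgeSet, ∀ e ∈ (path f).map Prod.fst, 0 < W f e
  W_zero : ∀ f ∈ H.edgeSet, ∀ e ∉ (path f).map Prod.fst, W f e = 0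
  congestion : ∀ e ∈ G.edgeSet, ∑ᶠ f ∈ H.edgeSet, W f e ≤ 1 / G.len e
  dilation : ∀ f ∈ H.edgeSet, ((path f).map fun s => 1 / W f s.1).sum ≤ H.len f

/-- `H` is (path) embeddable into `G`. -/
def Embeddable {α : Type*} {β : Type*} {α' : Type*} {β' : Type*} [Finite β']
    (H : LGraph α' β') (G : LGraph α β) : Prop := Nonempty (PathEmbedding H G)

/-! ### Bartal decompositions -/

/-- `(B 0, …, B t)` is a Bartal decomposition of `G` (the values of `B` beyond `t` play no
role). -/
structure IsBartalDecomposition (G : LGraph α β) (t : ℕ) (B : ℕ → LGraph α β) : Prop where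
  forest : ∀ i ≤ t, IsForest (B i).toGraph
  vertexSet_eq : ∀ i ≤ t, (B i).vertexSet = G.vertexSet
  spanning : IsTree (B 0).toGraph
  last_empty : (B t).edgeSet = ∅
  subgraph : ∀ i ≤ t, (B i).WSubgraph G
  laminar : ∀ i < t, ∀ u v, Connects (B (i + 1)).toGraph u v → Connects (B i).toGraph u v

/-- The union of all levels of a decomposition, as a multigraph with one copy of an edge for each
level in which it occurs. -/
def levelUnion (t : ℕ) (B : ℕ → LGraph α β) : LGraph α (Fin (t + 1) × β) :=
  LGraph.edgeUnion fun i : Fin (t + 1) => B i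

/-- A Bartal decomposition such that the union of all its levels embeds into `G`. -/
def IsEmbeddableBartalDecomposition [Finite β] (G : LGraph α β) (t : ℕ)
    (B : ℕ → LGraph α β) : Prop :=
  IsBartalDecomposition G t B ∧ Embeddable (levelUnion t B) G

/-- The number of vertices. -/
noncomputable def LGraph.order (G : LGraph α β) : ℕ := G.vertexSet.ncard

/-- The positive sequence `(d 0, …, d t)` decreases geometrically with ratio `c`, and bounds the
diameter of the decomposition `B` of `G`. -/
structure BoundsDiameter (c : ℝ) (G : LGraph α β) (t : ℕ) (d : ℕ → ℝ) (B : ℕ → LGraph α β) :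
    Prop where
  pos : ∀ i ≤ t, 0 < d i
  geometric : ∀ i < t, d (i + 1) ≤ c * d i
  diam : ∀ i ≤ t, ∀ u v, Connects (B i).toGraph u v → (B i).dist u v ≤ ENNReal.ofReal (d i)
  edge_len : ∀ i ≤ t, ∀ e ∈ (B i).edgeSet, G.len e ≤ d i / Real.log G.order

/-- The edge `e` of `G` is first cut at level `i`: its ends are in the same component of `B i`
and in different components of `B (i + 1)`. -/
def FirstCutAt (G : LGraph α β) (B : ℕ → LGraph α β) (e : β) (i : ℕ) : Prop :=
  ∃ x y, G.IsLink e x y ∧ Connects (B i).toGraph x y ∧ ¬ Connects (B (i + 1)).toGraph x y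

/-- The level at which an edge is first cut. -/
noncomputable def cutLevel (G : LGraph α β) (B : ℕ → LGraph α β) (e : β) : ℕ :=
  sInf {i | FirstCutAt G B e i}

/-- The `ℓ_p`-stretch of an edge with respect to a decomposition and diameter bounds. -/
noncomputable def decompStretch (p : ℝ) (G : LGraph α β) (d : ℕ → ℝ) (B : ℕ → LGraph α β)
    (e : β) : ℝ :=
  (d (cutLevel G B e) / G.len e) ^ p

/-! ### Bartal's algorithm -/

/-- The joint law of independent random variables with laws `p i`. -/
noncomputable def independentLaw {ι : Type*} {γ : Type*} [Fintype ι] [Fintype γ]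
    (p : ι → PMF γ) : PMF (ι → γ) := by
  classical
  exact PMF.ofFintype (fun ω => ∏ i, p i (ω i)) (by
    have h := Finset.prod_univ_sum (fun _ : ι => (Finset.univ : Finset γ)) (fun i x => p i x)
    rw [Fintype.piFinset_univ] at h
    rw [← h]
    refine Finset.prod_eq_one fun i _ => ?_
    rw [← tsum_fintype (L := .unconditional γ)]
    exact (p i).tsum_coe)

/-- Probabilistic low-diameter decomposition with constant `K`.  On a graph `H` and a diameter
parameter `d` the routine returns the (random) edge set of a forest; its components are the
pieces of the partition, each given together with a shortest path tree of the subgraph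
induced by the piece, of diameter at most `d`.  An edge of length `l` is cut with probability at
most `K l log n / d`, where `n` is the number of vertices of `H`. -/
def IsPartitionRoutine (K : ℝ) (P : LGraph α β → ℝ → PMF (Set β)) : Prop :=
  ∀ (H : LGraph α β) (d : ℝ), H.PosLen → 0 < d →
    (∀ F ∈ (P H d).support, F ⊆ H.edgeSet ∧
      ∀ U ∈ components (H.restrictEdges F).toGraph,
        (∃ r, IsShortestPathTree ((H.restrictEdges F).inducedOn U) (H.inducedOn U) r) ∧
        ∀ x ∈ U, ∀ y ∈ U, ((H.restrictEdges F).inducedOn U).dist x y ≤ ENNReal.ofReal d) ∧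
    ∀ e x y, H.IsLink e x y →
      (P H d).toOuterMeasure {F | ¬ Connects (H.restrictEdges F).toGraph x y} ≤
        ENNReal.ofReal (K * H.len e * Real.log H.order / d)

/-- The edge sets of the levels produced by Bartal's algorithm from the initial tree `T₀`, when
`ω (i, U)` is the forest returned by the call of the partition routine on the component with
vertex set `U` of level `i`. -/
def bartalLevels (G : LGraph α β) (t : ℕ) (T₀ : Set β) (ω : Fin t × Set α → Set β) :
    ℕ → Set β
  | 0 => T₀
  | i + 1 => if h : i < t then
      ⋃ U ∈ components (G.restrictEdges (bartalLevels G t T₀ ω i)).toGraph, ω (⟨i, h⟩, U)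
    else ∅

/-- Bartal's algorithm with diameter bounds `d`, partition routine `P` and initial tree `T₀`.
At level `i + 1` all edges of length at least `d (i + 1) / log n` are removed, and the partition
routine is called, independently, on the subgraphs induced by the components of level `i`. -/
noncomputable def decomposeSimple [Fintype α] [Fintype β]
    (P : LGraph α β → ℝ → PMF (Set β)) (T₀ : Set β) (t : ℕ) (d : ℕ → ℝ) (G : LGraph α β) :
    PMF (ℕ → LGraph α β) :=
  (independentLaw fun k : Fin t × Set α =>
    P ((G.restrictEdges {e | G.len e < d (k.1 + 1) / Real.log G.order}).inducedOn k.2)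
      (d (k.1 + 1))).map
    fun ω i => G.restrictEdges (bartalLevels G t T₀ ω i)

/-- The diameter bounds `2 n Δ, 2⁻¹ n Δ, 2⁻³ n Δ, …`. -/
noncomputable def bartalBounds (n : ℕ) (Δ : ℝ) (i : ℕ) : ℝ := 2 * n * Δ / 4 ^ i

/-! ### Switching exponents -/

/-- The factor by which level `i` of a decomposition with bounds `d'` is rescaled. -/
noncomputable def switchFactor (cgeo p q : ℝ) (n : ℕ) (d' : ℕ → ℝ) (i : ℕ) : ℝ :=
  cgeo / (q - p) * (d' i / Real.log n) ^ ((q - p) / p)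

/-- The rescaled diameter bounds. -/
noncomputable def switchBounds (cgeo p q : ℝ) (n : ℕ) (d' : ℕ → ℝ) (i : ℕ) : ℝ :=
  switchFactor cgeo p q n d' i * d' i

/-- Run the routine `D`, whose output has diameter bounds `d'`, on the graph with lengths
`l ^ (p / q)`, and rescale the lengths on every level of the output. -/
noncomputable def embeddableDecompose (cgeo p q : ℝ) (D : LGraph α β → PMF (ℕ → LGraph α β))
    (d' : ℕ → ℝ) (G : LGraph α β) : PMF (ℕ → LGraph α β) :=
  (D (G.powLen (p / q))).map
    fun B' i => (B' i).scaleLen (switchFactor cgeo p q G.order d' i)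

/-! ### From decompositions to trees -/

/-- A routine that replaces a tree `T` with a set `S` of `k ≥ 1` of its vertices by a small tree:
a tree with at most `2 k - 1` vertices, among them those of `S`, with the same distances
between vertices of `S`, and embeddable into `T` (with every vertex a copy of itself). -/
def IsTreeReduction [Finite α] (R : LGraph α β → Set α → LGraph α (Sym2 α)) : Prop :=
  ∀ (T : LGraph α β) (S : Set α), T.PosLen → IsTree T.toGraph → S.Nonempty → S ⊆ T.vertexSet →
    IsTree (R T S).toGraph ∧ S ⊆ (R T S).vertexSet ∧ (R T S).order + 1 ≤ 2 * S.ncard ∧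
    (∀ x ∈ S, ∀ y ∈ S, (R T S).dist x y = T.dist x y) ∧
    ∃ φ : PathEmbedding (R T S) T, ∀ x ∈ (R T S).vertexSet, φ.π x = x

/-- `Z i` is the set of centers of level `i`: one for each connected component, such that a center
of level `i` is also a center of level `i + 1`. -/
structure IsCenterChoice (t : ℕ) (B : ℕ → LGraph α β) (Z : ℕ → Set α) : Prop where
  mem : ∀ i ≤ t, Z i ⊆ (B i).vertexSet
  unique : ∀ i ≤ t, ∀ U ∈ components (B i).toGraph, ∃! z, z ∈ Z i ∧ z ∈ U
  mono : ∀ i < t, Z i ⊆ Z (i + 1)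

open Classical in
/-- The vertex of the Steiner tree that represents the vertex `x` of `G` in the pieces of level
`i`: `x` itself if it is a center of level `i + 1`, and a Steiner copy of it otherwise. -/
noncomputable def steinerVertex (t : ℕ) (Z : ℕ → Set α) (i : Fin t) (x : α) : α ⊕ (Fin t × α) :=
  if x ∈ Z (i + 1) then Sum.inl x else Sum.inr (i, x)

/-- The Steiner tree built from a decomposition: for every component `U` of every level `i < t`,
the centers of level `i + 1` in `U` are connected by the small equivalent of the tree that
`B i` has on `U`.  Vertices of `G` are `Sum.inl x`, Steiner vertices are `Sum.inr _`. -/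
noncomputable def buildTree (R : LGraph α β → Set α → LGraph α (Sym2 α)) (t : ℕ)
    (B : ℕ → LGraph α β) (Z : ℕ → Set α) :
    LGraph (α ⊕ (Fin t × α))
      ({k : Fin t × Set α // k.2 ∈ components (B k.1).toGraph} × Sym2 α) :=
  LGraph.edgeUnion fun k : {k : Fin t × Set α // k.2 ∈ components (B k.1).toGraph} =>
    (R ((B k.1.1).inducedOn k.1.2) (Z (k.1.1 + 1) ∩ k.1.2)).mapVert (steinerVertex t Z k.1.1)

/-- The expectation of a nonnegative random variable. -/
noncomputable def expectation {Ω : Type*} (𝓓 : PMF Ω) (X : Ω → ℝ≥0∞) : ℝ≥0∞ := ∑' a, 𝓓 a * X a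

/-- The `ℓ_p`-stretch of an edge of `G`, with ends `x` and `y`, with respect to a tree `T` that
contains the vertices of `G` as `Sum.inl x`. -/
noncomputable def treeStretch {σ : Type*} (p : ℝ) (G : LGraph α β) (T : LGraph (α ⊕ σ) β')
    (e : β) (x y : α) : ℝ≥0∞ :=
  (T.dist (Sum.inl x) (Sum.inl y) / ENNReal.ofReal (G.len e)) ^ p

end LowStretch

open LowStretch

/-!
A random decomposition whose bounds decrease geometrically is found by ball growing, its stretch is
summed over the levels, and a tree is read off from it by choosing centers.

*Partition routine.* Cut out a ball around a vertex, with a random radius whose law is a truncated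
geometric distribution, and repeat in what is left. The geometric distribution is memoryless:
once the ball has reached one end of an edge, it stops before it reaches the other one with
probability proportional to the length of the edge over the mean radius `d / log n`, whatever
happened before. The error from the truncation is about `1 / n` per ball and hence bounded over all
balls (`LGraph.exists_law_of_geometric`, `exists_isPartitionRoutine`). A ball carries a shortest
path tree of the subgraph induced by it, because shortest paths to its center do not leave it.

*Tree reduction.* Attach the given vertices one by one, each by a path that stops where it meets
what has been built; every step adds at most two vertices to the skeleton. The paths that
represent the edges of the skeleton are edge-disjoint, which makes the skeleton isometric and an
embedding of weight one (`exists_isSkeleton`, `IsSkeleton.dist_eq`).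

*Stretch.* An edge is first cut at level `i` only if the call on its component of level `i` cuts it.
That component is a function of the earlier calls, which are independent of this one, so the bound
of the partition routine applies (`toOuterMeasure_firstCut_le`). Bartal's algorithm runs on the
lengths `m = l ^ (p / q)`. By the choice of the bounds `d`, `(d i / l) ^ p` is
`(log n / (q - p)) ^ p * (d' i / (m log n)) ^ q`, while the probability of a cut is
at most of order `m log n / d' i`. As `q < 1`, the products form a geometric series with sum of
order `1 / (1 - q)`; together with the factor `(1 / (q - p)) ^ p` this gives the factor `(1 / (1 - p)) ^ 2`
(`expectation_decompStretch_le`). Edges that are removed before the call because they are too long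
have bounded ratio `d' i / (m log n)`, and contribute a constant.

*Embedding.* An edge occurs on level `i` only if `m ≤ d' i / log n`, and the weight of its copy
there is `(q - p) / l` times `(m log n / d' i) ^ ((q - p) / p)`. These weights form a geometric
progression with sum at most `1 / l` (`sum_weight_switchedLevels_le`).

*Tree.* In the Steiner tree a vertex reaches the center of its component at level `i` through the
centers of the finer levels, over a distance bounded by a geometric sum of the `d j`
(`dist_center_le`), so the stretch in the tree is bounded by that in the decomposition. There are
no cycles, since the Steiner tree retracts onto each of its pieces (`isForest_buildTree`), and the
pieces of a level embed into disjoint subgraphs of that level (`embeddable_buildTree`).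
-/

namespace LowStretch

variable {α : Type u} {β : Type v} {α' : Type w} {β' : Type*}

/-! ### Walks, paths and connectivity -/

section Walks

variable {G H : Graph α β} {u v x y : α} {e : β} {w w' : List (β × α)}

theorem IsWalk.left_mem (h : IsWalk G u w v) : u ∈ G.vertexSet := by
  cases h with
  | nil hu => exact hu
  | cons h _ => exact h.left_mem

theorem IsWalk.right_mem (h : IsWalk G u w v) : v ∈ G.vertexSet := by
  induction h with
  | nil hu => exact hu
  | cons _ _ ih => exact ih

theorem IsWalk.append (h : IsWalk G u w x) (h' : IsWalk G x w' v) : IsWalk G u (w ++ w') v := by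
  induction h with
  | nil _ => exact h'
  | cons hl _ ih => exact .cons hl (ih h')

theorem IsWalk.single (h : G.IsLink e x y) : IsWalk G x [(e, y)] y := .cons h (.nil h.right_mem)

theorem IsWalk.exists_reverse (h : IsWalk G u w v) :
    ∃ w', IsWalk G v w' u ∧ w'.map Prod.fst = (w.map Prod.fst).reverse := by
  induction h with
  | nil hu => exact ⟨[], .nil hu, rfl⟩
  | @cons u x v e w hl _ ih =>
    obtain ⟨w', h1, h2⟩ := ih
    exact ⟨w' ++ [(e, u)], h1.append (.single hl.symm), by simp [h2]⟩

theorem IsWalk.right_mem_support (h : IsWalk G u w v) : v ∈ u :: w.map Prod.snd := by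
  induction h with
  | nil hu => simp
  | cons _ _ ih => exact List.mem_cons_of_mem _ (by simpa using ih)

/-- A walk can be transported to another graph as long as it stays in a set of vertices whose
incident edges are shared by the two graphs. -/
theorem IsWalk.transfer {K : Graph α β} {U : Set α}
    (hU : ∀ e x y, G.IsLink e x y → x ∈ U → y ∈ U ∧ K.IsLink e x y)
    (hV : U ⊆ K.vertexSet) (h : IsWalk G u w v) (hu : u ∈ U) : IsWalk K u w v ∧ v ∈ U := by
  induction h with
  | nil _ => exact ⟨.nil (hV hu), hu⟩
  | cons hl _ ih =>
    obtain ⟨h1, h2⟩ := hU _ _ _ hl hu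
    exact ⟨.cons h2 (ih h1).1, (ih h1).2⟩

theorem IsWalk.of_edges {K : Graph α β} (h : IsWalk G u w v) (hu : u ∈ K.vertexSet)
    (he : ∀ e ∈ w.map Prod.fst, ∀ x y, G.IsLink e x y → K.IsLink e x y) : IsWalk K u w v := by
  induction h with
  | nil _ => exact .nil hu
  | cons hl _ ih =>
    have := he _ (by simp) _ _ hl
    exact .cons this (ih this.right_mem fun e h => he e (by simp at h ⊢; tauto))

theorem IsWalk.mono (hGH : G ≤ H) (h : IsWalk G u w v) : IsWalk H u w v :=
  h.of_edges (hGH.vertexSet_mono h.left_mem) fun _ _ _ _ hl => hGH.isLink_mono hl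

theorem IsWalk.of_deleteEdges {F : Set β} (h : IsWalk (G.deleteEdges F) u w v) : IsWalk G u w v :=
  h.mono Graph.deleteEdges_le

theorem IsWalk.deleteEdges (h : IsWalk G u w v) (he : e ∉ w.map Prod.fst) :
    IsWalk (G.deleteEdges {e}) u w v :=
  h.of_edges (by simpa using h.left_mem) fun f hf x y hl => by
    simp only [Graph.deleteEdges_isLink]
    exact ⟨hl, fun h => he (by rw [← Set.mem_singleton_iff.1 h]; exact hf)⟩

theorem IsWalk.split_edge (h : IsWalk G u w v) (he : e ∈ w.map Prod.fst) :
    ∃ w₁ x y w₂, w = w₁ ++ (e, y) :: w₂ ∧ IsWalk G u w₁ x ∧ G.IsLink e x y ∧ IsWalk G y w₂ v := by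
  induction h with
  | nil _ => simp at he
  | @cons u x v e' w hl hw ih =>
    by_cases h' : e = e'
    · subst h'
      exact ⟨[], u, x, w, rfl, .nil hl.left_mem, hl, hw⟩
    · obtain ⟨w₁, a, b, w₂, h1, h2, h3, h4⟩ := ih (by simpa [h'] using he)
      exact ⟨(e', x) :: w₁, a, b, w₂, by simp [h1], .cons hl h2, h3, h4⟩

theorem IsWalk.split_vertex (h : IsWalk G u w v) (hx : x ∈ u :: w.map Prod.snd) :
    ∃ w₁ w₂, w = w₁ ++ w₂ ∧ IsWalk G u w₁ x ∧ IsWalk G x w₂ v ∧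
      (x :: w₂.map Prod.snd) <:+ (u :: w.map Prod.snd) := by
  induction h with
  | @nil u hu =>
    obtain rfl : x = u := by simpa using hx
    exact ⟨[], [], rfl, .nil hu, .nil hu, List.suffix_refl _⟩
  | @cons u a v e w hl hw ih =>
    by_cases h' : x = u
    · subst h'
      exact ⟨[], (e, a) :: w, rfl, .nil hl.left_mem, .cons hl hw, List.suffix_refl _⟩
    · obtain ⟨w₁, w₂, h1, h2, h3, h4⟩ := ih (by simpa [h'] using hx)
      exact ⟨(e, a) :: w₁, w₂, by simp [h1], .cons hl h2, h3, h4.trans (List.suffix_cons _ _)⟩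

/-- Every walk contains a path with the same ends. -/
theorem IsWalk.exists_isPath (h : IsWalk G u w v) : ∃ w', IsPath G u w' v ∧ w'.Sublist w := by
  induction h with
  | @nil u hu => exact ⟨[], ⟨.nil hu, by simp⟩, List.Sublist.refl _⟩
  | @cons u a v e w hl hw ih =>
    obtain ⟨w', hp, hs⟩ := ih
    by_cases hu : u ∈ a :: w'.map Prod.snd
    · obtain ⟨w₁, w₂, h1, -, h3, h4⟩ := hp.1.split_vertex hu
      refine ⟨w₂, ⟨h3, hp.2.sublist h4.sublist⟩, ?_⟩
      exact ((h1 ▸ List.sublist_append_right _ _ : w₂.Sublist w').trans hs).trans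
        (List.sublist_cons_self _ _)
    · exact ⟨(e, a) :: w', ⟨.cons hl hp.1, List.nodup_cons.2 ⟨hu, hp.2⟩⟩, hs.cons_cons _⟩

theorem IsWalk.edge_mem (h : IsWalk G u w v) (he : e ∈ w.map Prod.fst) : e ∈ G.edgeSet := by
  obtain ⟨_, _, _, _, _, _, hl, _⟩ := h.split_edge he
  exact hl.edge_mem

theorem IsWalk.ends_mem_support (h : IsWalk G u w v) (he : e ∈ w.map Prod.fst)
    (hl : G.IsLink e x y) : x ∈ u :: w.map Prod.snd ∧ y ∈ u :: w.map Prod.snd := by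
  obtain ⟨w₁, a, b, w₂, rfl, h1, h2, -⟩ := h.split_edge he
  have ha : a ∈ u :: (w₁ ++ (e, b) :: w₂).map Prod.snd := by
    have := h1.right_mem_support
    simp only [List.mem_cons, List.map_append, List.mem_append] at this ⊢
    tauto
  have hb : b ∈ u :: (w₁ ++ (e, b) :: w₂).map Prod.snd := by simp
  rcases hl.eq_and_eq_or_eq_and_eq h2 with ⟨rfl, rfl⟩ | ⟨rfl, rfl⟩
  exacts [⟨ha, hb⟩, ⟨hb, ha⟩]

theorem IsWalk.support_subset (h : IsWalk G u w v) :
    ∀ x ∈ u :: w.map Prod.snd, x ∈ G.vertexSet := by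
  intro x hx
  obtain ⟨_, _, -, h, -⟩ := h.split_vertex hx
  exact h.right_mem

theorem IsPath.nodup_edges (h : IsPath G u w v) : (w.map Prod.fst).Nodup := by
  obtain ⟨h, hn⟩ := h
  induction h with
  | nil _ => simp
  | @cons u a v e w hl hw ih =>
    rw [List.map_cons, List.nodup_cons] at hn ⊢
    exact ⟨fun he => hn.1 (hw.ends_mem_support he hl).1, ih hn.2⟩

theorem IsPath.length_lt [Finite α] (h : IsPath G u w v) : w.length < G.vertexSet.ncard := by
  classical
  have hsub : ((u :: w.map Prod.snd).toFinset : Set α) ⊆ G.vertexSet := by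
    intro x hx
    exact h.1.support_subset x (by simpa using hx)
  have := Set.ncard_le_ncard hsub (Set.toFinite _)
  rw [Set.ncard_coe_finset, List.toFinset_card_of_nodup h.2] at this
  simpa using this

theorem IsPath.mono (hGH : G ≤ H) (h : IsPath G u w v) : IsPath H u w v := ⟨h.1.mono hGH, h.2⟩

theorem isPath_single (h : G.IsLink e x y) (hxy : x ≠ y) : IsPath G x [(e, y)] y :=
  ⟨.single h, by simpa using hxy⟩

/-! ### Components -/

theorem Connects.refl (hu : u ∈ G.vertexSet) : Connects G u u := ⟨[], .nil hu⟩

theorem Connects.symm (h : Connects G u v) : Connects G v u := by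
  obtain ⟨w, hw⟩ := h
  obtain ⟨w', h', -⟩ := hw.exists_reverse
  exact ⟨w', h'⟩

theorem Connects.trans (h : Connects G u v) (h' : Connects G v x) : Connects G u x := by
  obtain ⟨w, hw⟩ := h
  obtain ⟨w', hw'⟩ := h'
  exact ⟨_, hw.append hw'⟩

theorem Connects.left_mem (h : Connects G u v) : u ∈ G.vertexSet := h.choose_spec.left_mem

theorem Connects.right_mem (h : Connects G u v) : v ∈ G.vertexSet := h.choose_spec.right_mem

theorem Connects.mono (hGH : G ≤ H) (h : Connects G u v) : Connects H u v :=
  h.imp fun _ hw => hw.mono hGH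

theorem Connects.of_isLink (h : G.IsLink e x y) : Connects G x y := ⟨_, .single h⟩

/-- A property that is preserved along edges is constant on components. -/
theorem Connects.induct {P : α → Prop} (h : Connects G u v)
    (hP : ∀ e x y, G.IsLink e x y → P x → P y) (hu : P u) : P v := by
  obtain ⟨w, hw⟩ := h
  induction hw with
  | nil _ => exact hu
  | cons hl _ ih => exact ih (hP _ _ _ hl hu)

/-- A map that sends edges to connected pairs sends connected pairs to connected pairs. -/
theorem Connects.map {K : Graph α' β'} {f : α → α'} (h : Connects G u v)
    (hf : ∀ x ∈ G.vertexSet, f x ∈ K.vertexSet)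
    (hP : ∀ e x y, G.IsLink e x y → Connects K (f x) (f y)) : Connects K (f u) (f v) :=
  h.induct (P := fun z => Connects K (f u) (f z)) (fun _ _ _ hl hx => hx.trans (hP _ _ _ hl))
    (.refl (hf _ h.left_mem))

theorem mem_component_self (hu : u ∈ G.vertexSet) : u ∈ component G u := Connects.refl hu

theorem component_mem_components (hu : u ∈ G.vertexSet) : component G u ∈ components G :=
  ⟨u, hu, rfl⟩

theorem component_eq_of_connects (h : Connects G u v) : component G u = component G v :=
  Set.ext fun _ => ⟨fun h' => h.symm.trans h', fun h' => h.trans h'⟩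

theorem components.eq_component {U : Set α} (hU : U ∈ components G) (hu : u ∈ U) :
    U = component G u := by
  obtain ⟨z, -, rfl⟩ := hU
  exact component_eq_of_connects hu

theorem components.eq_of_mem {U U' : Set α} (hU : U ∈ components G) (hU' : U' ∈ components G)
    (hu : u ∈ U) (hu' : u ∈ U') : U = U' := by
  rw [components.eq_component hU hu, components.eq_component hU' hu']

theorem components.connects {U : Set α} (hU : U ∈ components G) (hu : u ∈ U) (hv : v ∈ U) :
    Connects G u v := by
  rw [components.eq_component hU hu] at hv
  exact hv

theorem components.mem_of_connects {U : Set α} (hU : U ∈ components G) (hu : u ∈ U)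
    (h : Connects G u v) : v ∈ U := by
  rw [components.eq_component hU hu]
  exact h

theorem components.subset {U : Set α} (hU : U ∈ components G) : U ⊆ G.vertexSet := by
  obtain ⟨z, -, rfl⟩ := hU
  exact fun _ h => h.right_mem

theorem components.nonempty {U : Set α} (hU : U ∈ components G) : U.Nonempty := by
  obtain ⟨z, hz, rfl⟩ := hU
  exact ⟨z, .refl hz⟩

theorem isConnected_of_forall_connects (hu : u ∈ G.vertexSet)
    (h : ∀ v ∈ G.vertexSet, Connects G u v) : IsConnected G :=
  ⟨⟨u, hu⟩, fun x hx y hy => (h x hx).symm.trans (h y hy)⟩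

end Walks

/-! ### Distances -/

section Dist

variable {G H : LGraph α β} {u v x y : α} {e : β} {w w' : List (β × α)}

@[simp] theorem LGraph.walkLen_nil : G.walkLen [] = 0 := rfl

@[simp] theorem LGraph.walkLen_cons {s : β × α} : G.walkLen (s :: w) = G.len s.1 + G.walkLen w := by
  simp [LGraph.walkLen]

@[simp] theorem LGraph.walkLen_append : G.walkLen (w ++ w') = G.walkLen w + G.walkLen w' := by
  simp [LGraph.walkLen]

theorem LGraph.walkLen_eq_sum_edges (w : List (β × α)) :
    G.walkLen w = ((w.map Prod.fst).map G.len).sum := by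
  simp [LGraph.walkLen, Function.comp_def]

theorem LGraph.PosLen.walkLen_nonneg (hG : G.PosLen) (h : IsWalk G.toGraph u w v) :
    0 ≤ G.walkLen w := by
  rw [LGraph.walkLen_eq_sum_edges]
  refine List.sum_nonneg fun a ha => ?_
  obtain ⟨e, he, rfl⟩ := List.mem_map.1 ha
  exact (hG e (h.edge_mem he)).le

theorem IsWalk.dist_le (h : IsWalk G.toGraph u w v) : G.dist u v ≤ ENNReal.ofReal (G.walkLen w) :=
  iInf₂_le w h

theorem LGraph.le_dist {a : ℝ≥0∞}
    (h : ∀ w, IsWalk G.toGraph u w v → a ≤ ENNReal.ofReal (G.walkLen w)) : a ≤ G.dist u v :=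
  le_iInf₂ h

theorem LGraph.exists_walk_of_dist_lt {a : ℝ≥0∞} (h : G.dist u v < a) :
    ∃ w, IsWalk G.toGraph u w v ∧ ENNReal.ofReal (G.walkLen w) < a := by
  simp only [LGraph.dist, iInf_lt_iff] at h
  obtain ⟨w, hw, h⟩ := h
  exact ⟨w, hw, h⟩

theorem LGraph.dist_self (hu : u ∈ G.vertexSet) : G.dist u u = 0 := by
  simpa using (IsWalk.nil hu : IsWalk G.toGraph u [] u).dist_le

theorem Connects.dist_lt_top (h : Connects G.toGraph u v) : G.dist u v < ∞ := by
  obtain ⟨w, hw⟩ := h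
  exact hw.dist_le.trans_lt ENNReal.ofReal_lt_top

theorem LGraph.connects_of_dist_lt_top (h : G.dist u v < ∞) : Connects G.toGraph u v := by
  obtain ⟨w, hw, -⟩ := LGraph.exists_walk_of_dist_lt h
  exact ⟨w, hw⟩

theorem LGraph.dist_comm (u v : α) : G.dist u v = G.dist v u := by
  have key : ∀ u v, G.dist u v ≤ G.dist v u := fun u v => LGraph.le_dist fun w hw => by
    obtain ⟨w', h', he⟩ := hw.exists_reverse
    refine h'.dist_le.trans_eq ?_
    rw [LGraph.walkLen_eq_sum_edges, he, LGraph.walkLen_eq_sum_edges, List.map_reverse,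
      List.sum_reverse]
  exact (key u v).antisymm (key v u)

theorem LGraph.dist_triangle (u v x : α) : G.dist u x ≤ G.dist u v + G.dist v x := by
  by_contra! h
  obtain ⟨a, b, ha, hb, hab⟩ : ∃ a b, G.dist u v < a ∧ G.dist v x < b ∧ a + b < G.dist u x := by
    have h1 : G.dist u v ≠ ∞ := fun h' => by simp [h'] at h
    have h2 : G.dist v x ≠ ∞ := fun h' => by simp [h'] at h
    obtain ⟨c, hc, hc'⟩ := exists_between h
    have hc0 : (c - (G.dist u v + G.dist v x)) / 2 ≠ 0 := by
      rw [ne_eq, ENNReal.div_eq_zero_iff, not_or]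
      exact ⟨(tsub_pos_of_lt hc).ne', by simp⟩
    refine ⟨G.dist u v + (c - (G.dist u v + G.dist v x)) / 2,
      G.dist v x + (c - (G.dist u v + G.dist v x)) / 2, ENNReal.lt_add_right h1 hc0,
      ENNReal.lt_add_right h2 hc0, ?_⟩
    rw [add_add_add_comm, ENNReal.add_halves, add_tsub_cancel_of_le hc.le]
    exact hc'
  obtain ⟨w, hw, hwa⟩ := LGraph.exists_walk_of_dist_lt ha
  obtain ⟨w', hw', hwb⟩ := LGraph.exists_walk_of_dist_lt hb
  have := (hw.append hw').dist_le
  rw [LGraph.walkLen_append] at this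
  exact (this.trans (ENNReal.ofReal_add_le.trans (add_le_add hwa.le hwb.le))).not_gt hab

theorem LGraph.dist_le_len (h : G.IsLink e x y) : G.dist x y ≤ ENNReal.ofReal (G.len e) := by
  simpa using (IsWalk.single h : IsWalk G.toGraph x [(e, y)] y).dist_le

theorem LGraph.dist_le_add_len (h : G.IsLink e x y) :
    G.dist u y ≤ G.dist u x + ENNReal.ofReal (G.len e) :=
  (LGraph.dist_triangle u x y).trans (by gcongr; exact LGraph.dist_le_len h)

theorem LGraph.dist_anti (hGH : H.toGraph ≤ G.toGraph) (hl : H.len = G.len) :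
    G.dist u v ≤ H.dist u v :=
  LGraph.le_dist fun w hw => (hw.mono hGH).dist_le.trans_eq (by simp [LGraph.walkLen, hl])

theorem LGraph.dist_congr
    (h : ∀ w, IsWalk G.toGraph u w v ↔ IsWalk H.toGraph u w v) (hl : G.len = H.len) :
    G.dist u v = H.dist u v := by
  simp only [LGraph.dist, h, LGraph.walkLen, hl]

theorem LGraph.walkLen_scaleLen {s : ℝ} : (G.scaleLen s).walkLen w = s * G.walkLen w := by
  simp [LGraph.walkLen, LGraph.scaleLen, List.sum_map_mul_left]

theorem LGraph.dist_scaleLen {s : ℝ} (hs : 0 < s) (u v : α) :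
    (G.scaleLen s).dist u v = ENNReal.ofReal s * G.dist u v := by
  have hs0 : ENNReal.ofReal s ≠ 0 := by simpa using hs
  simp only [LGraph.dist, ENNReal.mul_iInf_of_ne hs0 ENNReal.ofReal_ne_top,
    LGraph.walkLen_scaleLen, ENNReal.ofReal_mul hs.le]
  rfl

end Dist

/-! ### Subgraphs -/

section Subgraphs

variable {G : LGraph α β} {x y : α} {e : β} {F : Set β} {U : Set α}

@[simp] theorem LGraph.restrictEdges_isLink :
    (G.restrictEdges F).IsLink e x y ↔ e ∈ F ∧ G.IsLink e x y := Iff.rfl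

@[simp] theorem LGraph.restrictEdges_vertexSet : (G.restrictEdges F).vertexSet = G.vertexSet := rfl

@[simp] theorem LGraph.inducedOn_isLink :
    (G.inducedOn U).IsLink e x y ↔ G.IsLink e x y ∧ x ∈ U ∧ y ∈ U := Iff.rfl

theorem LGraph.inducedOn_edgeSet_subset : (G.inducedOn U).edgeSet ⊆ G.edgeSet := by
  intro e he
  obtain ⟨x, y, h⟩ := Graph.exists_isLink_of_mem_edgeSet he
  exact h.1.edge_mem

theorem LGraph.restrictEdges_le : (G.restrictEdges F).toGraph ≤ G.toGraph := Graph.restrict_le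

theorem LGraph.inducedOn_le (hU : U ⊆ G.vertexSet) : (G.inducedOn U).toGraph ≤ G.toGraph :=
  Graph.induce_le hU

theorem LGraph.PosLen.restrictEdges (h : G.PosLen) : (G.restrictEdges F).PosLen :=
  fun e he => h e he.1

theorem LGraph.PosLen.inducedOn (h : G.PosLen) : (G.inducedOn U).PosLen :=
  fun e he => h e (LGraph.inducedOn_edgeSet_subset he)

theorem LGraph.eq_of_toGraph_eq {G H : LGraph α β} (h : G.toGraph = H.toGraph)
    (h' : G.len = H.len) : G = H := by
  cases G; cases H; simp_all

/-- Walks of the subgraph induced by a union of components are the walks of the graph. -/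
theorem LGraph.isWalk_inducedOn_iff {u v : α} {w : List (β × α)}
    (hU : ∀ e x y, G.IsLink e x y → x ∈ U → y ∈ U) (hV : U ⊆ G.vertexSet) (hu : u ∈ U) :
    IsWalk (G.inducedOn U).toGraph u w v ↔ IsWalk G.toGraph u w v :=
  ⟨fun h => h.mono (LGraph.inducedOn_le hV), fun h =>
    (h.transfer (K := (G.inducedOn U).toGraph) (U := U)
      (fun e x y hl hx => ⟨hU e x y hl hx, hl, hx, hU e x y hl hx⟩) subset_rfl hu).1⟩

theorem components.isLink_mem {G : Graph α β} {U : Set α} (hU : U ∈ components G) {e : β} {x y : α}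
    (h : G.IsLink e x y) (hx : x ∈ U) : y ∈ U :=
  components.mem_of_connects hU hx (.of_isLink h)

theorem components.isWalk_inducedOn_iff {u v : α} {w : List (β × α)}
    (hU : U ∈ components G.toGraph) (hu : u ∈ U) :
    IsWalk (G.inducedOn U).toGraph u w v ↔ IsWalk G.toGraph u w v :=
  LGraph.isWalk_inducedOn_iff (fun _ _ _ h hx => components.isLink_mem hU h hx)
    (components.subset hU) hu

theorem components.dist_inducedOn {u v : α} (hU : U ∈ components G.toGraph) (hu : u ∈ U) :
    (G.inducedOn U).dist u v = G.dist u v :=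
  LGraph.dist_congr (fun _ => components.isWalk_inducedOn_iff hU hu) rfl

theorem components.connects_inducedOn {u v : α} (hU : U ∈ components G.toGraph) (hu : u ∈ U) :
    Connects (G.inducedOn U).toGraph u v ↔ Connects G.toGraph u v :=
  exists_congr fun _ => components.isWalk_inducedOn_iff hU hu

theorem IsForest.mono {G H : Graph α β} (hH : IsForest H) (hGH : G ≤ H) : IsForest G :=
  fun e x y hl hc => hH e x y (hGH.isLink_mono hl) (hc.mono (Graph.deleteEdges_mono_left hGH _))

/-- A component of a forest is a tree. -/
theorem IsForest.isTree_inducedOn (hG : IsForest G.toGraph) (hU : U ∈ components G.toGraph) :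
    IsTree (G.inducedOn U).toGraph := by
  refine ⟨⟨components.nonempty hU, fun x hx y hy => ?_⟩,
    hG.mono (LGraph.inducedOn_le (components.subset hU))⟩
  rw [components.connects_inducedOn hU hx]
  exact components.connects hU hx hy

end Subgraphs

/-! ### Shortest path trees -/

section ShortestPath

variable {H : LGraph α β} {r : α}

/-- Bellman's equation: the distance to `r` is attained through some first edge. -/
theorem LGraph.exists_first_edge [Finite α] [Finite β] (hpos : H.PosLen) {v : α}
    (hv : Connects H.toGraph v r) (hvr : v ≠ r) :
    ∃ s : β × α, H.IsLink s.1 v s.2 ∧ H.dist s.2 r + ENNReal.ofReal (H.len s.1) ≤ H.dist v r := by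
  have hfin : {s : β × α | H.IsLink s.1 v s.2}.Finite := Set.toFinite _
  have hne : {s : β × α | H.IsLink s.1 v s.2}.Nonempty := by
    obtain ⟨w, hw⟩ := hv
    cases hw with
    | nil _ => exact absurd rfl hvr
    | cons hl _ => exact ⟨(_, _), hl⟩
  obtain ⟨s, hs, hmin⟩ := Set.exists_min_image _
    (fun s : β × α => H.dist s.2 r + ENNReal.ofReal (H.len s.1)) hfin hne
  refine ⟨s, hs, LGraph.le_dist fun w hw => ?_⟩
  cases hw with
  | nil _ => exact absurd rfl hvr
  | @cons _ x _ e w hl hw =>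
    refine (hmin (e, x) hl).trans ?_
    rw [LGraph.walkLen_cons, add_comm,
      ENNReal.ofReal_add (hpos e hl.edge_mem).le (hpos.walkLen_nonneg hw)]
    exact add_le_add le_rfl hw.dist_le

theorem LGraph.dist_lt_of_first_edge (hpos : H.PosLen) {v u : α} {e : β} (hl : H.IsLink e v u)
    (hv : Connects H.toGraph v r)
    (h : H.dist u r + ENNReal.ofReal (H.len e) ≤ H.dist v r) : H.dist u r < H.dist v r := by
  refine lt_of_lt_of_le (ENNReal.lt_add_right ?_ ?_) h
  · exact (((Connects.of_isLink hl).symm.trans hv).dist_lt_top).ne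
  · simpa using hpos e hl.edge_mem

/-- Induction along shortest paths to `r`. -/
theorem LGraph.dist_induction [Finite α] [Finite β] (hpos : H.PosLen) {P : α → Prop} (hr : P r)
    (step : ∀ e v u, H.IsLink e v u → H.dist u r + ENNReal.ofReal (H.len e) ≤ H.dist v r →
      P u → P v) (v : α) (hv : Connects H.toGraph v r) : P v := by
  have : IsTrans α fun a b => H.dist a r < H.dist b r := ⟨fun _ _ _ => lt_trans⟩
  have : Std.Irrefl fun a b : α => H.dist a r < H.dist b r := ⟨fun _ => lt_irrefl _⟩
  induction v using (Finite.wellFounded_of_trans_of_irrefl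
    fun a b : α => H.dist a r < H.dist b r).induction with
  | _ v ih =>
    by_cases hvr : v = r
    · exact hvr ▸ hr
    · obtain ⟨⟨e, u⟩, hl, hle⟩ := LGraph.exists_first_edge hpos hv hvr
      exact step e v u hl hle (ih u (LGraph.dist_lt_of_first_edge hpos hl hv hle)
        ((Connects.of_isLink hl).symm.trans hv))

/-- A connected graph has a shortest path tree from every vertex: keep one first edge of a
shortest path for every vertex other than the root. -/
theorem LGraph.exists_shortestPathTree [Finite α] [Finite β] (hpos : H.PosLen)
    (hr : r ∈ H.vertexSet) (hc : ∀ v ∈ H.vertexSet, Connects H.toGraph v r) :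
    ∃ F ⊆ H.edgeSet, IsShortestPathTree (H.restrictEdges F) H r := by
  choose s hs hle using fun v (hv : v ∈ H.vertexSet ∧ v ≠ r) =>
    LGraph.exists_first_edge hpos (hc v hv.1) hv.2
  let F : Set β := {f | ∃ v, ∃ hv : v ∈ H.vertexSet ∧ v ≠ r, (s v hv).1 = f}
  have hT : ∀ v (hv : v ∈ H.vertexSet ∧ v ≠ r),
      (H.restrictEdges F).IsLink (s v hv).1 v (s v hv).2 := fun v hv => ⟨⟨v, hv, rfl⟩, hs v hv⟩
  have hdist : ∀ v ∈ H.vertexSet, (H.restrictEdges F).dist v r ≤ H.dist v r := by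
    intro v hv
    have : IsTrans α fun a b => H.dist a r < H.dist b r := ⟨fun _ _ _ => lt_trans⟩
    have : Std.Irrefl fun a b : α => H.dist a r < H.dist b r := ⟨fun _ => lt_irrefl _⟩
    induction v using (Finite.wellFounded_of_trans_of_irrefl
      fun a b : α => H.dist a r < H.dist b r).induction with
    | _ v ih =>
      by_cases hvr : v = r
      · subst hvr
        rw [LGraph.dist_self (by exact hv)]
        exact zero_le
      · have hl := hs v ⟨hv, hvr⟩
        have hle' := hle v ⟨hv, hvr⟩
        refine ((H.restrictEdges F).dist_triangle v (s v ⟨hv, hvr⟩).2 r).trans (le_trans ?_ hle')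
        rw [add_comm]
        exact add_le_add (ih _ (LGraph.dist_lt_of_first_edge hpos hl (hc v hv) hle') hl.right_mem)
          (LGraph.dist_le_len (hT v ⟨hv, hvr⟩))
  have hconn : ∀ v ∈ H.vertexSet, Connects (H.restrictEdges F).toGraph v r := fun v hv =>
    LGraph.connects_of_dist_lt_top ((hdist v hv).trans_lt (hc v hv).dist_lt_top)
  refine ⟨F, ?_, LGraph.restrictEdges_le, rfl, rfl, hr, ⟨?_, ?_⟩, fun v hv => ?_⟩
  · rintro _ ⟨v, hv, rfl⟩
    exact (hs v hv).edge_mem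
  · exact isConnected_of_forall_connects (u := r) hr fun v hv => (hconn v hv).symm
  · -- the descendants of `v` form a side of the cut that separates the ends of its first edge
    have key : ∀ v (hv : v ∈ H.vertexSet ∧ v ≠ r),
        ¬ Connects ((H.restrictEdges F).toGraph.deleteEdges {(s v hv).1}) v (s v hv).2 := by
      intro v hv hcon
      have hdesc : ∀ a, Relation.ReflTransGen
          (fun a b => ∃ h : a ∈ H.vertexSet ∧ a ≠ r, b = (s a h).2) a v →
          H.dist v r ≤ H.dist a r := by
        intro a ha
        induction ha using Relation.ReflTransGen.head_induction_on with
        | refl => exact le_rfl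
        | head h _ ih =>
          obtain ⟨h1, rfl⟩ := h
          exact ih.trans (LGraph.dist_lt_of_first_edge hpos (hs _ h1) (hc _ h1.1) (hle _ h1)).le
      have := hcon.induct (P := fun a => Relation.ReflTransGen
          (fun a b => ∃ h : a ∈ H.vertexSet ∧ a ≠ r, b = (s a h).2) a v) ?_ .refl
      · exact (hdesc _ this).not_gt
          (LGraph.dist_lt_of_first_edge hpos (hs _ hv) (hc _ hv.1) (hle _ hv))
      · rintro e a b ⟨⟨⟨x, hx, rfl⟩, hl⟩, hne⟩ ha
        have hxv : x ≠ v := by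
          rintro rfl
          exact hne rfl
        rcases hl.eq_and_eq_or_eq_and_eq (hs x hx) with ⟨h1, rfl⟩ | ⟨rfl, h1⟩ <;> subst h1
        · rcases Relation.ReflTransGen.cases_head ha with rfl | ⟨c, ⟨_, rfl⟩, h⟩
          · exact absurd rfl hxv
          · exact h
        · exact .head ⟨hx, rfl⟩ ha
    rintro e x y ⟨⟨v, hv, rfl⟩, hl⟩ hcon
    rcases hl.eq_and_eq_or_eq_and_eq (hs v hv) with ⟨h1, rfl⟩ | ⟨rfl, h1⟩ <;> subst h1
    · exact key _ hv hcon
    · exact key _ hv hcon.symm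
  · rw [LGraph.dist_comm, H.dist_comm]
    exact (hdist v hv).antisymm (LGraph.dist_anti LGraph.restrictEdges_le rfl)

/-- Balls are geodesically star-shaped: inside the ball around `r` the distances to `r` are those
of the whole graph. -/
theorem LGraph.dist_inducedOn_ball_le [Finite α] [Finite β] (hpos : H.PosLen)
    (hr : r ∈ H.vertexSet) {R : ℝ≥0∞} (hR : R < ∞) {v : α}
    (hvR : H.dist v r ≤ R) :
    (H.inducedOn {v | v ∈ H.vertexSet ∧ H.dist v r ≤ R}).dist v r ≤ H.dist v r := by
  refine LGraph.dist_induction hpos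
    (P := fun v => H.dist v r ≤ R →
      (H.inducedOn {v | v ∈ H.vertexSet ∧ H.dist v r ≤ R}).dist v r ≤ H.dist v r) (fun _ => ?_)
    (fun e v u hl hle ih hv => ?_) v (LGraph.connects_of_dist_lt_top (hvR.trans_lt hR)) hvR
  · rw [LGraph.dist_self]
    · exact zero_le
    · exact ⟨hr, by rw [LGraph.dist_self hr]; exact zero_le⟩
  · have hu : H.dist u r ≤ R := (le_self_add.trans hle).trans hv
    refine (LGraph.dist_triangle v u r).trans (le_trans ?_ hle)
    rw [add_comm]
    exact add_le_add (ih hu) (LGraph.dist_le_len ⟨hl, ⟨hl.left_mem, hv⟩, hl.right_mem, hu⟩)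

theorem IsShortestPathTree.dist_le {T : LGraph α β} (h : IsShortestPathTree T H r) {R : ℝ≥0∞}
    (hR : ∀ v ∈ H.vertexSet, H.dist v r ≤ R) {x y : α} (hx : x ∈ H.vertexSet)
    (hy : y ∈ H.vertexSet) : T.dist x y ≤ R + R := by
  obtain ⟨-, -, -, -, -, h⟩ := h
  refine (T.dist_triangle x r y).trans (add_le_add ?_ ?_)
  · rw [T.dist_comm, h x hx, H.dist_comm]
    exact hR x hx
  · rw [h y hy, H.dist_comm]
    exact hR y hy

end ShortestPath

/-! ### Low-diameter partitions -/

section Partition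

/-- The edge sets a partition routine may return: forests whose components carry shortest path
trees, of diameter at most `d`, of the subgraphs induced by them. -/
def IsLowDiameterForest (H : LGraph α β) (d : ℝ) (F : Set β) : Prop :=
  F ⊆ H.edgeSet ∧ ∀ U ∈ components (H.restrictEdges F).toGraph,
    (∃ r, IsShortestPathTree ((H.restrictEdges F).inducedOn U) (H.inducedOn U) r) ∧
    ∀ x ∈ U, ∀ y ∈ U, ((H.restrictEdges F).inducedOn U).dist x y ≤ ENNReal.ofReal d

theorem LGraph.ends_mem_of_mem_inducedOn {H : LGraph α β} {U : Set α} {e : β} {x y : α}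
    (he : e ∈ (H.inducedOn U).edgeSet) (h : H.IsLink e x y) : x ∈ U ∧ y ∈ U := by
  obtain ⟨a, b, hl, ha, hb⟩ := Graph.exists_isLink_of_mem_edgeSet he
  rcases h.eq_and_eq_or_eq_and_eq hl with ⟨rfl, rfl⟩ | ⟨rfl, rfl⟩
  exacts [⟨ha, hb⟩, ⟨hb, ha⟩]

/-- Edge sets on two complementary vertex sets do not interact: a walk in their union that starts
on one side stays there. -/
theorem LGraph.isWalk_union_iff {H : LGraph α β} {B C : Set α} {F F' : Set β}
    (hdis : Disjoint B C) (hB : B ⊆ H.vertexSet)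
    (hF : F ⊆ (H.inducedOn B).edgeSet) (hF' : F' ⊆ (H.inducedOn C).edgeSet)
    {x y : α} {w : List (β × α)} (hx : x ∈ B) :
    IsWalk (H.restrictEdges (F ∪ F')).toGraph x w y ↔
      IsWalk ((H.inducedOn B).restrictEdges F).toGraph x w y := by
  constructor
  · intro h
    refine (h.transfer (K := ((H.inducedOn B).restrictEdges F).toGraph) (U := B) ?_
      subset_rfl hx).1
    rintro e a b ⟨he | he, hl⟩ ha
    · have := LGraph.ends_mem_of_mem_inducedOn (hF he) hl
      exact ⟨this.2, he, hl, this⟩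
    · exact absurd (LGraph.ends_mem_of_mem_inducedOn (hF' he) hl).1
        (Set.disjoint_left.1 hdis ha)
  · intro h
    refine h.mono ?_
    exact ⟨hB, fun e a b hl => ⟨Or.inl hl.1, hl.2.1⟩⟩

/-- A shortest path tree of a piece `B` and a low-diameter forest of the rest form a low-diameter
forest. -/
theorem IsLowDiameterForest.union {H : LGraph α β} {d : ℝ} {B : Set α} {F F' : Set β} {r : α}
    (hB : B ⊆ H.vertexSet) (hF : F ⊆ (H.inducedOn B).edgeSet)
    (hT : IsShortestPathTree ((H.inducedOn B).restrictEdges F) (H.inducedOn B) r)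
    (hd : ∀ x ∈ B, ∀ y ∈ B, ((H.inducedOn B).restrictEdges F).dist x y ≤ ENNReal.ofReal d)
    (hF' : IsLowDiameterForest (H.inducedOn (H.vertexSet \ B)) d F') :
    IsLowDiameterForest H d (F ∪ F') := by
  have hdis : Disjoint B (H.vertexSet \ B) := Set.disjoint_sdiff_right
  refine ⟨Set.union_subset (hF.trans LGraph.inducedOn_edgeSet_subset)
    (hF'.1.trans LGraph.inducedOn_edgeSet_subset), ?_⟩
  rintro _ ⟨z, hz, rfl⟩
  by_cases hzB : z ∈ B
  · have hU : component (H.restrictEdges (F ∪ F')).toGraph z = B := by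
      ext y
      simp only [component, Connects, Set.mem_ofPred_eq,
        LGraph.isWalk_union_iff hdis hB hF hF'.1 hzB]
      exact ⟨fun ⟨w, hw⟩ => hw.right_mem, fun hy => hT.2.2.2.2.1.1.2 z hzB y hy⟩
    have hEq : (H.restrictEdges (F ∪ F')).inducedOn B = (H.inducedOn B).restrictEdges F := by
      refine LGraph.eq_of_toGraph_eq (Graph.ext rfl fun e x y => ?_) rfl
      simp only [LGraph.inducedOn_isLink, LGraph.restrictEdges_isLink, Set.mem_union]
      constructor
      · rintro ⟨⟨he | he, hl⟩, hx, hy⟩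
        · exact ⟨he, hl, hx, hy⟩
        · exact absurd (LGraph.ends_mem_of_mem_inducedOn (hF'.1 he) hl).1
            (Set.disjoint_left.1 hdis hx)
      · rintro ⟨he, hl, hx, hy⟩
        exact ⟨⟨Or.inl he, hl⟩, hx, hy⟩
    rw [hU, hEq]
    exact ⟨⟨r, hT⟩, hd⟩
  · have hzC : z ∈ H.vertexSet \ B := ⟨hz, hzB⟩
    set U := component (H.restrictEdges (F ∪ F')).toGraph z
    have hU : U = component ((H.inducedOn (H.vertexSet \ B)).restrictEdges F').toGraph z := by
      ext y
      simp only [U, component, Connects, Set.mem_ofPred_eq, Set.union_comm F F',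
        LGraph.isWalk_union_iff hdis.symm Set.sdiff_subset hF'.1 hF hzC]
    have hUC : U ⊆ H.vertexSet \ B := hU ▸ fun y hy => Connects.right_mem hy
    have hEq : (H.restrictEdges (F ∪ F')).inducedOn U =
        ((H.inducedOn (H.vertexSet \ B)).restrictEdges F').inducedOn U := by
      refine LGraph.eq_of_toGraph_eq (Graph.ext rfl fun e x y => ?_) rfl
      simp only [LGraph.inducedOn_isLink, LGraph.restrictEdges_isLink, Set.mem_union]
      constructor
      · rintro ⟨⟨he | he, hl⟩, hx, hy⟩
        · exact absurd (LGraph.ends_mem_of_mem_inducedOn (hF he) hl).1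
            (Set.disjoint_right.1 hdis (hUC hx))
        · exact ⟨⟨he, hl, hUC hx, hUC hy⟩, hx, hy⟩
      · rintro ⟨⟨he, hl, -, -⟩, hx, hy⟩
        exact ⟨⟨Or.inr he, hl⟩, hx, hy⟩
    have hEq' : H.inducedOn U = (H.inducedOn (H.vertexSet \ B)).inducedOn U := by
      refine LGraph.eq_of_toGraph_eq (Graph.ext rfl fun e x y => ?_) rfl
      simp only [LGraph.inducedOn_isLink]
      exact ⟨fun ⟨hl, hx, hy⟩ => ⟨⟨hl, hUC hx, hUC hy⟩, hx, hy⟩,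
        fun ⟨⟨hl, _⟩, hx, hy⟩ => ⟨hl, hx, hy⟩⟩
    rw [hEq, hEq']
    exact hF'.2 U (hU ▸ component_mem_components hzC)

/-- The memorylessness of the truncated geometric distribution, in the form needed for the
inductive estimate of the probability that an edge is cut: `k₀` and `k₁` are the radii at which
the ball reaches the two ends of the edge. -/
theorem geometric_cut_bound {ρ b ε : ℝ} (hρ0 : 0 ≤ ρ) (hρ1 : ρ < 1) (hb : 0 ≤ b) (hε : 0 ≤ ε)
    {N k₀ k₁ : ℕ} (m : ℕ) (hεN : ρ ^ N ≤ ε * (1 - ρ ^ N)) (hk : k₀ ≤ k₁)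
    (hbk : ((k₁ : ℝ) - k₀) * (1 - ρ) ≤ b) :
    ∑ k ∈ Finset.range N, ρ ^ k * (if k < k₀ then b * (1 + m * ε) else if k < k₁ then 1 else 0) ≤
      b * (1 + (m + 1 : ℕ) * ε) * ∑ k ∈ Finset.range N, ρ ^ k := by
  have hT : 0 ≤ b * (1 + m * ε) := by positivity
  have hbε : 0 ≤ b * ε := by positivity
  have h1ρ : 0 < 1 - ρ := by linarith
  by_cases hN : N ≤ k₀
  · rw [Finset.mul_sum]
    refine Finset.sum_le_sum fun k hk' => ?_
    rw [if_pos ((Finset.mem_range.1 hk').trans_le hN), mul_comm]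
    refine mul_le_mul_of_nonneg_right ?_ (by positivity)
    push_cast
    nlinarith
  push Not at hN
  have h1 : ∑ k ∈ Finset.range N, ρ ^ k *
        (if k < k₀ then b * (1 + m * ε) else if k < k₁ then 1 else 0) ≤
      (∑ k ∈ Finset.range k₀, ρ ^ k) * (b * (1 + m * ε)) + ((k₁ : ℝ) - k₀) * ρ ^ k₀ := by
    rw [← Finset.sum_range_add_sum_Ico _ hN.le]
    refine add_le_add ?_ ?_
    · rw [Finset.sum_mul]
      refine Finset.sum_le_sum fun k hk' => ?_
      rw [if_pos (Finset.mem_range.1 hk')]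
    · calc _ ≤ ∑ k ∈ Finset.Ico k₀ N, if k < k₁ then ρ ^ k₀ else 0 := by
            refine Finset.sum_le_sum fun k hk' => ?_
            rw [if_neg (by simpa using (Finset.mem_Ico.1 hk').1)]
            split_ifs
            · rw [mul_one]
              exact pow_le_pow_of_le_one hρ0 hρ1.le (Finset.mem_Ico.1 hk').1
            · simp
        _ = ∑ k ∈ Finset.Ico k₀ N with k < k₁, ρ ^ k₀ := (Finset.sum_filter _ _).symm
        _ ≤ ∑ k ∈ Finset.Ico k₀ k₁, ρ ^ k₀ := by
            refine Finset.sum_le_sum_of_subset_of_nonneg (fun k => ?_) fun _ _ _ => by positivity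
            simp only [Finset.mem_filter, Finset.mem_Ico]
            tauto
        _ = ((k₁ : ℝ) - k₀) * ρ ^ k₀ := by
            rw [Finset.sum_const, Nat.card_Ico, nsmul_eq_mul, Nat.cast_sub hk]
  refine h1.trans (le_of_mul_le_mul_left ?_ h1ρ)
  have hg0 := mul_neg_geom_sum ρ k₀
  have hgN := mul_neg_geom_sum ρ N
  have hρk : ρ ^ N ≤ ρ ^ k₀ := pow_le_pow_of_le_one hρ0 hρ1.le hN.le
  have hρk0 : 0 ≤ ρ ^ k₀ := by positivity
  calc _ = ((1 - ρ) * ∑ k ∈ Finset.range k₀, ρ ^ k) * (b * (1 + m * ε)) +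
        (((k₁ : ℝ) - k₀) * (1 - ρ)) * ρ ^ k₀ := by ring
    _ ≤ (1 - ρ ^ k₀) * (b * (1 + m * ε)) + b * ρ ^ k₀ := by
        rw [hg0]
        gcongr
    _ = b + m * (b * ε) * (1 - ρ ^ k₀) := by ring
    _ ≤ b + m * (b * ε) * (1 - ρ ^ N) := by gcongr
    _ ≤ b * (1 - ρ ^ N + ε * (1 - ρ ^ N)) + m * (b * ε) * (1 - ρ ^ N) := by
        gcongr
        nlinarith
    _ = b * (1 + (m + 1 : ℕ) * ε) * (1 - ρ ^ N) := by push_cast; ring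
    _ = _ := by rw [← hgN]; ring

/-- The geometric distribution truncated to `{0, …, N - 1}`. -/
theorem exists_truncatedGeometric {ρ : ℝ} (hρ0 : 0 < ρ) {N : ℕ} (hN : 0 < N) :
    ∃ γ : PMF (Fin N), ∀ k, γ k = ENNReal.ofReal (ρ ^ (k : ℕ) / ∑ j ∈ Finset.range N, ρ ^ j) := by
  have hZ : 0 < ∑ j ∈ Finset.range N, ρ ^ j :=
    Finset.sum_pos (fun _ _ => by positivity) (Finset.nonempty_range_iff.2 hN.ne')
  refine ⟨PMF.ofFintype (fun k => ENNReal.ofReal (ρ ^ (k : ℕ) / ∑ j ∈ Finset.range N, ρ ^ j)) ?_,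
    fun k => rfl⟩
  rw [← ENNReal.ofReal_sum_of_nonneg fun _ _ => by positivity, ← Finset.sum_div,
    Fin.sum_univ_eq_sum_range (fun k => ρ ^ k), div_self hZ.ne', ENNReal.ofReal_one]

theorem truncatedGeometric_cut_bound {ρ b ε : ℝ} (hρ0 : 0 < ρ) (hρ1 : ρ < 1) (hb : 0 ≤ b)
    (hε : 0 ≤ ε) {N k₀ k₁ : ℕ} (m : ℕ) (hεN : ρ ^ N ≤ ε * (1 - ρ ^ N)) (hk : k₀ ≤ k₁)
    (hbk : ((k₁ : ℝ) - k₀) * (1 - ρ) ≤ b) (hN : 0 < N) {γ : PMF (Fin N)}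
    (hγ : ∀ k, γ k = ENNReal.ofReal (ρ ^ (k : ℕ) / ∑ j ∈ Finset.range N, ρ ^ j))
    {c : Fin N → ℝ≥0∞} (hc : ∀ k : Fin N, (k : ℕ) < k₀ → c k ≤ ENNReal.ofReal (b * (1 + m * ε)))
    (hc1 : ∀ k, c k ≤ 1) (hc0 : ∀ k : Fin N, k₁ ≤ (k : ℕ) → c k = 0) :
    ∑ k, γ k * c k ≤ ENNReal.ofReal (b * (1 + (m + 1 : ℕ) * ε)) := by
  set Z := ∑ j ∈ Finset.range N, ρ ^ j with hZdef
  have hZ : 0 < Z :=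
    Finset.sum_pos (fun _ _ => by positivity) (Finset.nonempty_range_iff.2 hN.ne')
  set g : ℕ → ℝ := fun k => if k < k₀ then b * (1 + m * ε) else if k < k₁ then 1 else 0
  have hg : ∀ k, 0 ≤ g k := by
    intro k
    have : 0 ≤ b * (1 + m * ε) := by positivity
    simp only [g]
    split_ifs
    exacts [this, zero_le_one, le_rfl]
  calc ∑ k, γ k * c k ≤ ∑ k : Fin N, ENNReal.ofReal (ρ ^ (k : ℕ) / Z * g k) := by
        refine Finset.sum_le_sum fun k _ => ?_
        rw [hγ, ENNReal.ofReal_mul (by positivity)]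
        gcongr
        by_cases h1 : (k : ℕ) < k₀
        · simpa only [g, if_pos h1] using hc k h1
        by_cases h2 : (k : ℕ) < k₁
        · simpa only [g, if_neg h1, if_pos h2, ENNReal.ofReal_one] using hc1 k
        · rw [hc0 k (not_lt.1 h2)]
          exact zero_le
    _ = ENNReal.ofReal ((∑ k ∈ Finset.range N, ρ ^ k * g k) / Z) := by
        rw [← ENNReal.ofReal_sum_of_nonneg fun (k : Fin N) _ => mul_nonneg (by positivity) (hg k),
          Fin.sum_univ_eq_sum_range (fun k => ρ ^ k / Z * g k), Finset.sum_div]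
        congr 1
        exact Finset.sum_congr rfl fun k _ => by ring
    _ ≤ _ := by
        refine ENNReal.ofReal_le_ofReal ?_
        rw [div_le_iff₀ hZ]
        exact geometric_cut_bound hρ0.le hρ1 hb hε m hεN hk hbk

/-- The radii at which the ball around `x₀` reaches the ends of an edge. -/
theorem LGraph.exists_ball_radii {H : LGraph α β} (hpos : H.PosLen) {x₀ : α} {h : ℝ} (hh : 0 < h)
    {e : β} {x y : α} (hl : H.IsLink e x y) (hle : h ≤ H.len e) (hx : Connects H.toGraph x x₀) :
    ∃ kx ky : ℕ, (∀ k : ℕ, H.dist x x₀ ≤ ENNReal.ofReal (k * h) ↔ kx ≤ k) ∧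
      (∀ k : ℕ, H.dist y x₀ ≤ ENNReal.ofReal (k * h) ↔ ky ≤ k) ∧
      (ky : ℝ) - kx ≤ 2 * H.len e / h ∧ (kx : ℝ) - ky ≤ 2 * H.len e / h := by
  have hy : Connects H.toGraph y x₀ := (Connects.of_isLink hl).symm.trans hx
  have hlen : 0 < H.len e := hpos e hl.edge_mem
  have key : ∀ z, Connects H.toGraph z x₀ → ∀ k : ℕ,
      H.dist z x₀ ≤ ENNReal.ofReal (k * h) ↔ ⌈(H.dist z x₀).toReal / h⌉₊ ≤ k := by
    intro z hz k
    rw [ENNReal.le_ofReal_iff_toReal_le hz.dist_lt_top.ne (by positivity), Nat.ceil_le,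
      div_le_iff₀ hh]
  have bd : ∀ z z', H.IsLink e z z' → Connects H.toGraph z x₀ →
      (⌈(H.dist z' x₀).toReal / h⌉₊ : ℝ) - ⌈(H.dist z x₀).toReal / h⌉₊ ≤ 2 * H.len e / h := by
    intro z z' hl hz
    have hz' : Connects H.toGraph z' x₀ := (Connects.of_isLink hl).symm.trans hz
    have h1 : (H.dist z' x₀).toReal ≤ (H.dist z x₀).toReal + H.len e := by
      have := LGraph.dist_le_add_len (u := x₀) hl
      rw [H.dist_comm, H.dist_comm x₀ z] at this
      have := ENNReal.toReal_mono (by simp [hz.dist_lt_top.ne]) this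
      rwa [ENNReal.toReal_add hz.dist_lt_top.ne ENNReal.ofReal_ne_top,
        ENNReal.toReal_ofReal hlen.le] at this
    have h2 : (⌈(H.dist z' x₀).toReal / h⌉₊ : ℝ) < (H.dist z' x₀).toReal / h + 1 :=
      Nat.ceil_lt_add_one (by positivity)
    have h3 := Nat.le_ceil ((H.dist z x₀).toReal / h)
    have h4 : (H.dist z' x₀).toReal / h ≤ (H.dist z x₀).toReal / h + H.len e / h := by
      rw [← add_div]
      gcongr
    have h5 : 1 ≤ H.len e / h := by rwa [one_le_div hh]
    rw [two_mul, add_div]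
    linarith
  exact ⟨_, _, key x hx, key y hy, bd x y hl hx, bd y x hl.symm hy⟩

variable [Finite α] [Finite β]

/-- One round of ball growing around `x₀` with radius `R`. -/
theorem LGraph.exists_ball_tree {H : LGraph α β} (hpos : H.PosLen) {x₀ : α}
    (hx₀ : x₀ ∈ H.vertexSet) {R d : ℝ} (hR : 0 ≤ R) (hd : 2 * R ≤ d) :
    ∃ F ⊆ (H.inducedOn {v | v ∈ H.vertexSet ∧ H.dist v x₀ ≤ ENNReal.ofReal R}).edgeSet,
      IsShortestPathTree
        ((H.inducedOn {v | v ∈ H.vertexSet ∧ H.dist v x₀ ≤ ENNReal.ofReal R}).restrictEdges F)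
        (H.inducedOn {v | v ∈ H.vertexSet ∧ H.dist v x₀ ≤ ENNReal.ofReal R}) x₀ ∧
      ∀ x y, x ∈ H.vertexSet ∧ H.dist x x₀ ≤ ENNReal.ofReal R →
        y ∈ H.vertexSet ∧ H.dist y x₀ ≤ ENNReal.ofReal R →
        ((H.inducedOn {v | v ∈ H.vertexSet ∧ H.dist v x₀ ≤ ENNReal.ofReal R}).restrictEdges F).dist
          x y ≤ ENNReal.ofReal d := by
  set B := {v | v ∈ H.vertexSet ∧ H.dist v x₀ ≤ ENNReal.ofReal R}
  have hball : ∀ v ∈ B, (H.inducedOn B).dist v x₀ ≤ ENNReal.ofReal R := fun v hv =>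
    (LGraph.dist_inducedOn_ball_le hpos hx₀ ENNReal.ofReal_lt_top hv.2).trans hv.2
  have hx₀B : x₀ ∈ B := ⟨hx₀, by rw [LGraph.dist_self hx₀]; exact zero_le⟩
  obtain ⟨F, hF, hT⟩ := LGraph.exists_shortestPathTree (H := H.inducedOn B) hpos.inducedOn hx₀B
    fun v hv => LGraph.connects_of_dist_lt_top ((hball v hv).trans_lt ENNReal.ofReal_lt_top)
  refine ⟨F, hF, hT, fun x y hx hy => (hT.dist_le hball hx hy).trans ?_⟩
  rw [← ENNReal.ofReal_add hR hR]
  exact ENNReal.ofReal_le_ofReal (by linarith)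

/-- Random ball growing: repeatedly cut out a ball of truncated geometric radius in what is left
of the graph. The radius is `k * h`, where `k < N`, with probability proportional to `ρ ^ k`. No
edge is shorter than the step `h`, so an edge `e` is crossed during at most `2 * H.len e / h`
consecutive steps. The truncation costs a summand `ε` for each of the at most `m` rounds. -/
theorem LGraph.exists_law_of_geometric {d h ρ ε lam : ℝ} {N : ℕ} (hh : 0 < h) (hN : 0 < N)
    (hNd : 2 * (N * h) ≤ d) (hρ0 : 0 < ρ) (hρ1 : ρ < 1) (hε : 0 ≤ ε)
    (hεN : ρ ^ N ≤ ε * (1 - ρ ^ N)) (hlam : 1 - ρ ≤ lam * h) (m : ℕ) (H : LGraph α β)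
    (hpos : H.PosLen) (hle : ∀ e ∈ H.edgeSet, h ≤ H.len e) (hm : H.order ≤ m) :
    ∃ μ : PMF (Set β), (∀ F ∈ μ.support, IsLowDiameterForest H d F) ∧
      ∀ e x y, H.IsLink e x y →
        μ.toOuterMeasure {F | ¬ Connects (H.restrictEdges F).toGraph x y} ≤
          ENNReal.ofReal (2 * lam * H.len e * (1 + m * ε)) := by
  induction m generalizing H with
  | zero =>
    have hV : H.vertexSet = ∅ := by
      simpa [LGraph.order, Set.ncard_eq_zero (Set.toFinite _)] using hm
    refine ⟨PMF.pure ∅, fun F hF => ?_, fun e x y hl => ?_⟩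
    · obtain rfl : F = ∅ := by simpa using hF
      refine ⟨Set.empty_subset _, ?_⟩
      rintro _ ⟨z, hz, -⟩
      simp [hV] at hz
    · have := hl.left_mem
      simp [hV] at this
  | succ m ih =>
    by_cases hne : H.vertexSet.Nonempty
    swap
    · obtain ⟨μ, h1, h2⟩ := ih H hpos hle (by
        simp [LGraph.order, Set.not_nonempty_iff_eq_empty.1 hne])
      exact ⟨μ, h1, fun e x y hl => absurd ⟨x, hl.left_mem⟩ hne⟩
    obtain ⟨x₀, hx₀⟩ := hne
    let B : Fin N → Set α := fun k => {v | v ∈ H.vertexSet ∧ H.dist v x₀ ≤ ENNReal.ofReal (k * h)}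
    choose F hF hT hFd using fun k : Fin N => LGraph.exists_ball_tree hpos hx₀
      (R := k * h) (d := d) (by positivity) (le_trans (by gcongr; exact k.2.le) hNd)
    have hx₀B : ∀ k, x₀ ∈ B k := fun k => ⟨hx₀, by rw [LGraph.dist_self hx₀]; exact zero_le⟩
    choose μ hμ hcut using fun k : Fin N => ih (H.inducedOn (H.vertexSet \ B k)) hpos.inducedOn
      (fun e he => hle e (LGraph.inducedOn_edgeSet_subset he)) (by
        have : (H.vertexSet \ B k).ncard < H.vertexSet.ncard :=
          Set.ncard_lt_ncard ⟨Set.sdiff_subset, fun h => (h hx₀).2 (hx₀B k)⟩ (Set.toFinite _)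
        have hm' : H.vertexSet.ncard ≤ m + 1 := hm
        change (H.vertexSet \ B k).ncard ≤ m
        omega)
    obtain ⟨γ, hγ⟩ := exists_truncatedGeometric hρ0 hN
    refine ⟨γ.bind fun k => (μ k).map (F k ∪ ·), fun F' hF' => ?_, fun e x y hl => ?_⟩
    · simp only [PMF.mem_support_bind_iff, PMF.mem_support_map_iff] at hF'
      obtain ⟨k, -, F', hF', rfl⟩ := hF'
      exact IsLowDiameterForest.union (fun v hv => hv.1) (hF k) (hT k)
        (fun x hx y hy => hFd k x y hx hy) (hμ k F' hF')
    · have hlen := hpos e hl.edge_mem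
      have hlam0 : 0 < lam := pos_of_mul_pos_left (by linarith : 0 < lam * h) hh.le
      have hb : 0 ≤ 2 * lam * H.len e := by positivity
      rw [PMF.toOuterMeasure_bind_apply, tsum_fintype]
      simp only [PMF.toOuterMeasure_map_apply]
      -- the conditional probabilities, given the radius of the ball around `x₀`
      have hin : ∀ k, x ∈ B k → y ∈ B k → (μ k).toOuterMeasure ((F k ∪ ·) ⁻¹'
          {F | ¬ Connects (H.restrictEdges F).toGraph x y}) = 0 := by
        intro k hx hy
        rw [PMF.toOuterMeasure_apply_eq_zero_iff, Set.disjoint_left]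
        intro F' hF' hn
        refine hn ?_
        obtain ⟨w, hw⟩ := (hT k).2.2.2.2.1.1.2 x hx y hy
        exact ⟨w, (LGraph.isWalk_union_iff Set.disjoint_sdiff_right (fun v hv => hv.1) (hF k)
          (hμ k F' hF').1 hx).2 hw⟩
      have hout : ∀ k, x ∉ B k → y ∉ B k → (μ k).toOuterMeasure ((F k ∪ ·) ⁻¹'
          {F | ¬ Connects (H.restrictEdges F).toGraph x y}) ≤
          ENNReal.ofReal (2 * lam * H.len e * (1 + m * ε)) := by
        intro k hx hy
        have hx' : x ∈ H.vertexSet \ B k := ⟨hl.left_mem, hx⟩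
        have hy' : y ∈ H.vertexSet \ B k := ⟨hl.right_mem, hy⟩
        refine le_trans (PMF.toOuterMeasure_mono _ ?_) (hcut k e x y ⟨hl, hx', hy'⟩)
        rintro F' ⟨hF'1, hF'2⟩ ⟨w, hw⟩
        refine hF'1 ⟨w, ?_⟩
        change IsWalk (H.restrictEdges (F k ∪ F')).toGraph x w y
        rw [Set.union_comm]
        exact (LGraph.isWalk_union_iff Set.disjoint_sdiff_left Set.sdiff_subset
          (hμ k F' hF'2).1 (hF k) hx').2 hw
      have hone : ∀ k, (μ k).toOuterMeasure ((F k ∪ ·) ⁻¹'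
          {F | ¬ Connects (H.restrictEdges F).toGraph x y}) ≤ 1 := fun k => by
        refine (PMF.toOuterMeasure_mono _
          (Set.inter_subset_left.trans (Set.subset_univ _))).trans_eq ?_
        rw [PMF.toOuterMeasure_apply_eq_one_iff]
        exact Set.subset_univ _
      suffices h : ∃ k₀ k₁ : ℕ, k₀ ≤ k₁ ∧ ((k₁ : ℝ) - k₀) * (1 - ρ) ≤ 2 * lam * H.len e ∧
          (∀ k : Fin N, (k : ℕ) < k₀ → x ∉ B k ∧ y ∉ B k) ∧
          (∀ k : Fin N, k₁ ≤ (k : ℕ) → x ∈ B k ∧ y ∈ B k) by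
        obtain ⟨k₀, k₁, hk, hbk, hk₀, hk₁⟩ := h
        exact truncatedGeometric_cut_bound hρ0 hρ1 hb hε m hεN hk hbk hN hγ
          (fun k h => hout k (hk₀ k h).1 (hk₀ k h).2) hone
          (fun k h => hin k (hk₁ k h).1 (hk₁ k h).2)
      by_cases hx : Connects H.toGraph x x₀
      · obtain ⟨kx, ky, hkx, hky, h1, h2⟩ := LGraph.exists_ball_radii hpos hh hl
          (hle e hl.edge_mem) hx
        refine ⟨min kx ky, max kx ky, min_le_max, ?_, fun k hk => ?_, fun k hk => ?_⟩
        · have : ((max kx ky : ℕ) : ℝ) - (min kx ky : ℕ) ≤ 2 * H.len e / h := by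
            rcases le_total kx ky with h | h <;> simp [h, h1, h2]
          calc _ ≤ (2 * H.len e / h) * (lam * h) := by
                refine mul_le_mul this hlam (by linarith) (by positivity)
            _ = _ := by field_simp
        · exact ⟨fun h => (lt_min_iff.1 hk).1.not_ge ((hkx k).1 h.2),
            fun h => (lt_min_iff.1 hk).2.not_ge ((hky k).1 h.2)⟩
        · exact ⟨⟨hl.left_mem, (hkx k).2 ((le_max_left _ _).trans hk)⟩,
            ⟨hl.right_mem, (hky k).2 ((le_max_right _ _).trans hk)⟩⟩
      · have hy : ¬ Connects H.toGraph y x₀ := fun h => hx ((Connects.of_isLink hl).trans h)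
        refine ⟨N, N, le_rfl, by simpa using hb, fun k _ => ⟨fun h => hx ?_, fun h => hy ?_⟩,
          fun k hk => absurd k.2 hk.not_gt⟩
        · exact LGraph.connects_of_dist_lt_top (h.2.trans_lt ENNReal.ofReal_lt_top)
        · exact LGraph.connects_of_dist_lt_top (h.2.trans_lt ENNReal.ofReal_lt_top)

/-- Ball growing with rate `lam = 2 log (n + 1) / d` and balls of radius at most `d / 2`: the
truncation then has probability about `1 / n`, which is harmless over `n` rounds. -/
theorem exists_isPartitionRoutine :
    ∃ P : LGraph α β → ℝ → PMF (Set β), IsPartitionRoutine 16 P := by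
  have key : ∀ (H : LGraph α β) (d : ℝ), ∃ μ : PMF (Set β), H.PosLen → 0 < d →
      (∀ F ∈ μ.support, IsLowDiameterForest H d F) ∧
      ∀ e x y, H.IsLink e x y →
        μ.toOuterMeasure {F | ¬ Connects (H.restrictEdges F).toGraph x y} ≤
          ENNReal.ofReal (16 * H.len e * Real.log H.order / d) := by
    intro H d
    by_cases hH : H.PosLen ∧ 0 < d
    swap
    · exact ⟨PMF.pure ∅, fun h1 h2 => absurd ⟨h1, h2⟩ hH⟩
    obtain ⟨hpos, hd⟩ := hH
    obtain ⟨c, hc, hcle⟩ : ∃ c : ℝ, 0 < c ∧ ∀ e ∈ H.edgeSet, c ≤ H.len e := by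
      rcases H.edgeSet.eq_empty_or_nonempty with h | h
      · exact ⟨1, one_pos, by simp [h]⟩
      · obtain ⟨e, he, hmin⟩ := Set.exists_min_image _ H.len (Set.toFinite _) h
        exact ⟨_, hpos e he, hmin⟩
    -- the step `d / 2 / N` of the radii is chosen smaller than every edge
    obtain ⟨N, hN⟩ := exists_nat_gt (d / 2 / c)
    have hN0 : (0 : ℝ) < N := lt_trans (by positivity) hN
    have hh : 0 < d / 2 / N := by positivity
    have hhc : d / 2 / N ≤ c := by
      rw [div_le_iff₀ hN0]
      rw [div_lt_iff₀ hc] at hN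
      linarith
    -- `n` is the number of vertices, except that it must not vanish for the empty graph
    set n : ℕ := max H.order 1
    have hn1 : (1 : ℝ) ≤ n := by exact_mod_cast le_max_right _ _
    have hlog : 0 < Real.log (n + 1) := Real.log_pos (by linarith)
    set lam := Real.log (n + 1) / (d / 2)
    have hlam : 0 < lam := by positivity
    have hρN : Real.exp (-(lam * (d / 2 / N))) ^ N = 1 / (n + 1) := by
      rw [← Real.exp_nat_mul]
      have : (N : ℝ) * -(lam * (d / 2 / N)) = -Real.log (n + 1) := by
        simp only [lam]
        field_simp
      rw [this, Real.exp_neg, Real.exp_log (by linarith), one_div]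
    obtain ⟨μ, h1, h2⟩ := LGraph.exists_law_of_geometric (d := d) (h := d / 2 / N)
      (ρ := Real.exp (-(lam * (d / 2 / N)))) (ε := 1 / n) (lam := lam) hh
      (by exact_mod_cast hN0) (by field_simp; rfl) (Real.exp_pos _)
      (by rw [Real.exp_lt_one_iff]; simp only [Left.neg_neg_iff]; positivity) (by positivity)
      (by rw [hρN]; refine le_of_eq ?_; field_simp; ring)
      (by have := Real.add_one_le_exp (-(lam * (d / 2 / N))); linarith) n H hpos
      (fun e he => hhc.trans (hcle e he)) (le_max_left _ _)
    refine ⟨μ, fun _ _ => ⟨h1, fun e x y hl => ?_⟩⟩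
    -- loops are never cut, and any other edge has two ends, so that `2 ≤ n` and
    -- `log (n + 1) ≤ 2 log n`
    by_cases hxy : x = y
    · subst hxy
      have : {F | ¬ Connects (H.restrictEdges F).toGraph x x} = ∅ := by
        ext F
        simpa using Connects.refl (G := (H.restrictEdges F).toGraph) hl.left_mem
      simp [this]
    have hn2 : 2 ≤ H.order := by
      rw [← Set.ncard_pair hxy]
      refine Set.ncard_le_ncard ?_ (Set.toFinite _)
      rintro z (rfl | rfl)
      exacts [hl.left_mem, hl.right_mem]
    have hn : n = H.order := max_eq_left (by omega)
    refine (h2 e x y hl).trans (ENNReal.ofReal_le_ofReal ?_)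
    have hn2' : (2 : ℝ) ≤ n := by rw [hn]; exact_mod_cast hn2
    have hll : Real.log (n + 1) ≤ 2 * Real.log n := by
      have : Real.log ((n : ℝ) ^ 2) = 2 * Real.log n := by rw [Real.log_pow]; norm_num
      rw [← this]
      exact Real.log_le_log (by linarith) (by nlinarith)
    have hlen := hpos e hl.edge_mem
    have e1 : (n : ℝ) * (1 / n) = 1 := by field_simp
    rw [e1, ← hn]
    calc 2 * lam * H.len e * (1 + 1) = 8 * H.len e * Real.log (n + 1) / d := by
          simp only [lam]
          field_simp
          ring
      _ ≤ 8 * H.len e * (2 * Real.log n) / d := by gcongr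
      _ = _ := by ring
  choose P hP using key
  exact ⟨P, fun H d hpos hd => hP H d hpos hd⟩

end Partition

/-! ### Tree reductions -/

section TreeReduction

/-- The simple graph with vertex set `M` whose edges are the pairs in `E` with both ends in `M`. -/
def sym2Graph (M : Set α) (E : Set (Sym2 α)) : Graph α (Sym2 α) where
  vertexSet := M
  IsLink f x y := f ∈ E ∧ f = s(x, y) ∧ x ∈ M ∧ y ∈ M
  isLink_symm := fun _ _ => ⟨fun _ _ h => ⟨h.1, h.2.1.trans Sym2.eq_swap, h.2.2.2, h.2.2.1⟩⟩
  eq_or_eq_of_isLink_of_isLink := by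
    rintro f x y v w ⟨-, rfl, -⟩ ⟨-, h, -⟩
    have := (Sym2.eq_iff.1 h)
    tauto
  left_mem_of_isLink := fun _ _ _ h => h.2.2.1

/-- The graph on `M` whose edge `f ∈ E` stands for the path `pth f` of `T`. -/
def skeletonGraph (T : LGraph α β) (M : Set α) (E : Set (Sym2 α))
    (pth : Sym2 α → List (β × α)) : LGraph α (Sym2 α) where
  toGraph := sym2Graph M E
  len f := T.walkLen (pth f)

/-- The pairs in `E` are joined by edge-disjoint paths `pth f` of `T` between vertices of `M`. -/
structure IsSkeleton (T : Graph α β) (M : Set α) (E : Set (Sym2 α))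
    (pth : Sym2 α → List (β × α)) : Prop where
  subset : M ⊆ T.vertexSet
  isPath : ∀ f ∈ E, ∃ x y, f = s(x, y) ∧ x ∈ M ∧ y ∈ M ∧ x ≠ y ∧ IsPath T x (pth f) y
  disjoint : ∀ f ∈ E, ∀ g ∈ E, f ≠ g → ∀ e ∈ (pth f).map Prod.fst, e ∉ (pth g).map Prod.fst

/-- The edges of `T` on the paths of a skeleton. -/
def usedEdges (E : Set (Sym2 α)) (pth : Sym2 α → List (β × α)) : Set β :=
  {e | ∃ f ∈ E, e ∈ (pth f).map Prod.fst}

/-- The vertices of `T` on the paths of a skeleton. -/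
def usedVertices (M : Set α) (E : Set (Sym2 α)) (pth : Sym2 α → List (β × α)) : Set α :=
  M ∪ {x | ∃ f ∈ E, x ∈ (pth f).map Prod.snd}

variable {T : LGraph α β} {M : Set α} {E : Set (Sym2 α)} {pth : Sym2 α → List (β × α)}

namespace IsSkeleton

theorem mem_of_mem {T : Graph α β} (h : IsSkeleton T M E pth) {x y : α} (hf : s(x, y) ∈ E) :
    x ∈ M ∧ y ∈ M := by
  obtain ⟨a, b, hab, ha, hb, -⟩ := h.isPath _ hf
  rcases Sym2.eq_iff.1 hab with ⟨rfl, rfl⟩ | ⟨rfl, rfl⟩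
  exacts [⟨ha, hb⟩, ⟨hb, ha⟩]

theorem edgeSet_eq {T : Graph α β} (h : IsSkeleton T M E pth) : (sym2Graph M E).edgeSet = E := by
  ext f
  rw [Graph.edge_mem_iff_exists_isLink]
  constructor
  · rintro ⟨x, y, hf, -⟩
    exact hf
  · intro hf
    obtain ⟨x, y, rfl, hx, hy, -⟩ := h.isPath f hf
    exact ⟨x, y, hf, rfl, hx, hy⟩

theorem exists_walk_of_isLink {T : Graph α β} (h : IsSkeleton T M E pth) {f : Sym2 α} {a b : α}
    (hl : (sym2Graph M E).IsLink f a b) :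
    ∃ W, IsWalk T a W b ∧ (W.map Prod.fst).Perm ((pth f).map Prod.fst) := by
  obtain ⟨hf, hab, -⟩ := hl
  obtain ⟨x, y, hxy, -, -, -, hp⟩ := h.isPath f hf
  rcases Sym2.eq_iff.1 (hab.symm.trans hxy) with ⟨rfl, rfl⟩ | ⟨rfl, rfl⟩
  · exact ⟨_, hp.1, List.Perm.refl _⟩
  · obtain ⟨W, hW, he⟩ := hp.1.exists_reverse
    exact ⟨W, hW, he ▸ List.reverse_perm _⟩

theorem exists_walk {T : Graph α β} (h : IsSkeleton T M E pth) {a b : α}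
    {w : List (Sym2 α × α)} (hw : IsWalk (sym2Graph M E) a w b) :
    ∃ W, IsWalk T a W b ∧
      (W.map Prod.fst).Perm ((w.map Prod.fst).flatMap fun f => (pth f).map Prod.fst) := by
  induction hw with
  | nil hu => exact ⟨[], .nil (h.subset hu), by simp⟩
  | cons hl _ ih =>
    obtain ⟨W₁, h1, h2⟩ := h.exists_walk_of_isLink hl
    obtain ⟨W₂, h3, h4⟩ := ih
    exact ⟨W₁ ++ W₂, h1.append h3, by simpa using h2.append h4⟩

theorem walkLen_eq (w : List (Sym2 α × α)) : (skeletonGraph T M E pth).walkLen w =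
    (((w.map Prod.fst).flatMap fun f => (pth f).map Prod.fst).map T.len).sum := by
  induction w with
  | nil => simp
  | cons s w ih =>
    have : (skeletonGraph T M E pth).len s.1 = T.walkLen (pth s.1) := rfl
    simp [ih, this, LGraph.walkLen_eq_sum_edges (pth s.1)]

/-- In a forest every edge of the path of `f` separates the ends of `f`. -/
theorem not_connects {T : Graph α β} (hT : IsForest T) (h : IsSkeleton T M E pth) {f : Sym2 α}
    {a b : α} (hl : (sym2Graph M E).IsLink f a b) {e : β} (he : e ∈ (pth f).map Prod.fst) :
    ¬ Connects (T.deleteEdges {e}) a b := by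
  obtain ⟨hf, hab, -⟩ := hl
  obtain ⟨x, y, hxy, -, -, -, hp⟩ := h.isPath f hf
  have key : ¬ Connects (T.deleteEdges {e}) x y := by
    intro hc
    obtain ⟨w₁, p, q, w₂, heq, h1, h2, h3⟩ := hp.1.split_edge he
    have hn := hp.nodup_edges
    rw [heq, List.map_append, List.map_cons, List.nodup_append] at hn
    have hw1 : e ∉ w₁.map Prod.fst := fun h' => hn.2.2 e h' e (by simp) rfl
    have hw2 : e ∉ w₂.map Prod.fst := (List.nodup_cons.1 hn.2.1).1
    exact hT e p q h2 ((Connects.symm ⟨_, h1.deleteEdges hw1⟩).trans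
      (hc.trans (Connects.symm ⟨_, h3.deleteEdges hw2⟩)))
  rcases Sym2.eq_iff.1 (hab.symm.trans hxy) with ⟨rfl, rfl⟩ | ⟨rfl, rfl⟩
  · exact key
  · exact fun h => key h.symm

/-- A walk of the skeleton that avoids `f` is a walk of `T` that avoids the path of `f`. -/
theorem connects_deleteEdges {T : Graph α β} (h : IsSkeleton T M E pth) {f : Sym2 α} {a b : α}
    {w : List (Sym2 α × α)} (hw : IsWalk (sym2Graph M E) a w b) (hf : f ∈ E)
    (hfw : f ∉ w.map Prod.fst) {e : β} (he : e ∈ (pth f).map Prod.fst) :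
    Connects (T.deleteEdges {e}) a b := by
  obtain ⟨W, hW, hperm⟩ := h.exists_walk hw
  refine ⟨W, hW.deleteEdges fun heW => ?_⟩
  obtain ⟨g, hg, heg⟩ := List.mem_flatMap.1 (hperm.mem_iff.1 heW)
  have hgE : g ∈ E := h.edgeSet_eq ▸ hw.edge_mem hg
  exact h.disjoint f hf g hgE (fun hfg => hfw (hfg ▸ hg)) e he heg

theorem isForest {T : Graph α β} (hT : IsForest T) (h : IsSkeleton T M E pth) :
    IsForest (sym2Graph M E) := by
  rintro f a b hl ⟨w, hw⟩
  obtain ⟨x, y, hxy, -, -, hne, hp⟩ := h.isPath f hl.1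
  have hpne : pth f ≠ [] := by
    intro h0
    have h1 := hp.1
    rw [h0] at h1
    cases h1
    exact hne rfl
  obtain ⟨s, hs⟩ := List.exists_mem_of_ne_nil _ hpne
  have he : s.1 ∈ (pth f).map Prod.fst := List.mem_map_of_mem hs
  refine h.not_connects hT hl he (h.connects_deleteEdges hw.of_deleteEdges hl.1 (fun hf => ?_) he)
  have := hw.edge_mem hf
  simp at this

/-- Edge-disjointness of the paths makes the skeleton of a forest isometric. -/
theorem dist_eq (hpos : T.PosLen) (hT : IsForest T.toGraph) (h : IsSkeleton T.toGraph M E pth)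
    {x y : α} (hc : Connects (sym2Graph M E) x y) :
    (skeletonGraph T M E pth).dist x y = T.dist x y := by
  refine le_antisymm ?_ ?_
  · obtain ⟨w, hw⟩ := hc
    obtain ⟨p, hp, -⟩ := hw.exists_isPath
    refine LGraph.le_dist fun W hW => ?_
    refine (IsWalk.dist_le (G := skeletonGraph T M E pth) hp.1).trans
      (ENNReal.ofReal_le_ofReal ?_)
    rw [walkLen_eq, LGraph.walkLen_eq_sum_edges]
    have hE : ∀ f ∈ p.map Prod.fst, f ∈ E := fun f hf => h.edgeSet_eq ▸ hp.1.edge_mem hf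
    have hn : ((p.map Prod.fst).flatMap fun f => (pth f).map Prod.fst).Nodup := by
      rw [List.nodup_flatMap]
      refine ⟨fun f hf => ?_, hp.nodup_edges.imp_of_mem fun {f g} hf hg hfg e he =>
        h.disjoint f (hE f hf) g (hE g hg) hfg e he⟩
      obtain ⟨_, _, -, -, -, -, hpf⟩ := h.isPath f (hE f hf)
      exact hpf.nodup_edges
    have hsub : ((p.map Prod.fst).flatMap fun f => (pth f).map Prod.fst) ⊆ W.map Prod.fst := by
      intro e he
      by_contra heW
      obtain ⟨f, hf, hef⟩ := List.mem_flatMap.1 he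
      have hpn := hp.nodup_edges
      obtain ⟨p₁, a, b, p₂, rfl, h1, h2, h3⟩ := hp.1.split_edge hf
      rw [List.map_append, List.map_cons, List.nodup_append] at hpn
      have hp1 : f ∉ p₁.map Prod.fst := fun h' => hpn.2.2 f h' f (by simp) rfl
      have hp2 : f ∉ p₂.map Prod.fst := (List.nodup_cons.1 hpn.2.1).1
      refine h.not_connects hT h2 hef ?_
      exact (h.connects_deleteEdges h1 (hE f hf) hp1 hef).symm.trans
        (.trans ⟨W, hW.deleteEdges heW⟩ (h.connects_deleteEdges h3 (hE f hf) hp2 hef).symm)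
    obtain ⟨L, hL, hsubl⟩ := hn.subperm hsub
    rw [← (hL.map T.len).sum_eq]
    refine (hsubl.map T.len).sum_le_sum fun r hr => ?_
    obtain ⟨e, he, rfl⟩ := List.mem_map.1 hr
    exact (hpos e (hW.edge_mem he)).le
  · refine LGraph.le_dist fun w hw => ?_
    obtain ⟨W, hW, hperm⟩ := h.exists_walk hw
    refine hW.dist_le.trans_eq ?_
    rw [walkLen_eq, LGraph.walkLen_eq_sum_edges, (hperm.map T.len).sum_eq]

open Classical in
/-- The paths are edge-disjoint, so each of them can use the edges of `T` at full weight. -/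
theorem exists_pathEmbedding [Finite α] (hpos : T.PosLen) (h : IsSkeleton T.toGraph M E pth) :
    ∃ φ : PathEmbedding (skeletonGraph T M E pth) T, ∀ x, φ.π x = x := by
  have hE : (skeletonGraph T M E pth).edgeSet = E := h.edgeSet_eq
  refine ⟨{ π := id, path := pth,
            W := fun f e => if e ∈ (pth f).map Prod.fst then 1 / T.len e else 0,
            π_mem := fun x hx => h.subset hx, path_isPath := ?_, W_pos := ?_, W_zero := ?_,
            congestion := ?_, dilation := ?_ }, fun _ => rfl⟩
  · intro f hf
    rw [hE] at hf
    obtain ⟨x, y, hxy, hx, hy, hne, hp⟩ := h.isPath f hf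
    refine ⟨x, y, ⟨hf, hxy, hx, hy⟩, hp, fun h0 => ?_⟩
    have h1 := hp.1
    rw [h0] at h1
    cases h1
    exact hne rfl
  · intro f hf e he
    rw [hE] at hf
    obtain ⟨x, y, -, -, -, -, hp⟩ := h.isPath f hf
    rw [if_pos he]
    exact one_div_pos.2 (hpos e (hp.1.edge_mem he))
  · intro f _ e he
    rw [if_neg he]
  · intro e he
    rw [hE]
    by_cases hex : ∃ f ∈ E, e ∈ (pth f).map Prod.fst
    · obtain ⟨f, hf, hef⟩ := hex
      rw [finsum_eq_single _ f fun g hg => ?_]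
      · rw [finsum_eq_if, if_pos hf, if_pos hef]
      · rw [finsum_eq_if]
        split_ifs with h1 h2
        · exact absurd h2 (h.disjoint f hf g h1 (Ne.symm hg) e hef)
        · rfl
        · rfl
    · push Not at hex
      rw [finsum_mem_congr rfl fun f hf => if_neg (hex f hf), finsum_mem_zero]
      exact (one_div_pos.2 (hpos e he)).le
  · intro f _
    refine le_of_eq ?_
    change _ = T.walkLen (pth f)
    rw [LGraph.walkLen]
    congr 1
    refine List.map_congr_left fun s hs => ?_
    rw [if_pos (List.mem_map_of_mem hs), one_div_one_div]

theorem insert_vertex {T : Graph α β} (h : IsSkeleton T M E pth) {m : α} (hm : m ∈ T.vertexSet) :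
    IsSkeleton T (insert m M) E pth :=
  ⟨Set.insert_subset hm h.subset, fun f hf => by
    obtain ⟨x, y, h1, h2, h3, h4⟩ := h.isPath f hf
    exact ⟨x, y, h1, Or.inr h2, Or.inr h3, h4⟩, h.disjoint⟩

theorem erase_edge {T : Graph α β} (h : IsSkeleton T M E pth) (f : Sym2 α) :
    IsSkeleton T M (E \ {f}) pth :=
  ⟨h.subset, fun g hg => h.isPath g hg.1, fun g hg g' hg' => h.disjoint g hg.1 g' hg'.1⟩

open Classical in
/-- Add a path that shares no edge with the skeleton. -/
theorem insert_edge {T : Graph α β} (h : IsSkeleton T M E pth) {a b : α} (ha : a ∈ M) (hb : b ∈ M)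
    (hab : a ≠ b) (hE : s(a, b) ∉ E) {w : List (β × α)} (hw : IsPath T a w b)
    (hdis : ∀ e ∈ w.map Prod.fst, e ∉ usedEdges E pth) :
    IsSkeleton T M (insert s(a, b) E) (Function.update pth s(a, b) w) ∧
      usedEdges (insert s(a, b) E) (Function.update pth s(a, b) w) =
        usedEdges E pth ∪ {e | e ∈ w.map Prod.fst} := by
  have hne : ∀ f ∈ E, Function.update pth s(a, b) w f = pth f := fun f hf =>
    Function.update_of_ne (fun h' => hE (by rwa [← h'])) _ _
  refine ⟨⟨h.subset, ?_, ?_⟩, ?_⟩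
  · rintro f (rfl | hf)
    · exact ⟨a, b, rfl, ha, hb, hab, by rwa [Function.update_self]⟩
    · rw [hne f hf]
      exact h.isPath f hf
  · rintro f (rfl | hf) g (rfl | hg) hfg e he
    · exact absurd rfl hfg
    · rw [Function.update_self] at he
      rw [hne g hg]
      exact fun h' => hdis e he ⟨g, hg, h'⟩
    · rw [Function.update_self]
      rw [hne f hf] at he
      exact fun h' => hdis e h' ⟨f, hf, he⟩
    · rw [hne g hg]
      rw [hne f hf] at he
      exact h.disjoint f hf g hg hfg e he
  · ext e
    constructor
    · rintro ⟨f, rfl | hf, he⟩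
      · exact Or.inr (by rwa [Function.update_self] at he)
      · exact Or.inl ⟨f, hf, by rwa [hne f hf] at he⟩
    · rintro (⟨f, hf, he⟩ | he)
      · exact ⟨f, Or.inr hf, by rwa [hne f hf]⟩
      · exact ⟨_, Or.inl rfl, by rwa [Function.update_self]⟩

/-- Make a vertex on the path of an edge a vertex of the skeleton. -/
theorem subdivide {T : Graph α β} (h : IsSkeleton T M E pth) (hc : IsConnected (sym2Graph M E))
    {m : α} (hm : m ∈ usedVertices M E pth) :
    ∃ E' pth', IsSkeleton T (insert m M) E' pth' ∧ IsConnected (sym2Graph (insert m M) E') ∧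
      usedEdges E' pth' ⊆ usedEdges E pth := by
  classical
  by_cases hmM : m ∈ M
  · rw [Set.insert_eq_of_mem hmM]
    exact ⟨E, pth, h, hc, subset_rfl⟩
  obtain ⟨f, hf, hmf⟩ := hm.resolve_left hmM
  obtain ⟨x, y, rfl, hx, hy, hxy, hp⟩ := h.isPath f hf
  obtain ⟨w₁, w₂, heq, h1, h2, hsuf⟩ := hp.1.split_vertex (List.mem_cons_of_mem x hmf)
  have hn := hp.nodup_edges
  rw [heq, List.map_append, List.nodup_append] at hn
  have hp1 : IsPath T x w₁ m := ⟨h1, hp.2.sublist (by rw [heq]; simp)⟩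
  have hp2 : IsPath T m w₂ y := ⟨h2, hp.2.sublist hsuf.sublist⟩
  have hmT : m ∈ T.vertexSet := h1.right_mem
  have hfe : ∀ e, e ∈ (pth s(x, y)).map Prod.fst → e ∉ usedEdges (E \ {s(x, y)}) pth := by
    rintro e he ⟨g, hg, heg⟩
    exact h.disjoint _ hf g hg.1 (Ne.symm hg.2) e he heg
  have hxm : x ≠ m := fun h => hmM (h ▸ hx)
  have hym : m ≠ y := fun h => hmM (h ▸ hy)
  have hnot : ∀ g ∈ E, m ∉ g := by
    intro g hg hmg
    obtain ⟨a, b, rfl, ha, hb, -⟩ := h.isPath g hg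
    rcases Sym2.mem_iff.1 hmg with rfl | rfl
    exacts [hmM ha, hmM hb]
  obtain ⟨s1, u1⟩ := ((h.erase_edge s(x, y)).insert_vertex hmT).insert_edge (Or.inr hx) (Or.inl rfl)
    hxm (fun h' => hnot _ h'.1 (by simp)) hp1
    (fun e he => hfe e (by rw [heq]; simp only [List.map_append, List.mem_append]; exact Or.inl he))
  obtain ⟨s2, u2⟩ := s1.insert_edge (Or.inl rfl) (Or.inr hy) hym (by
      rintro (h' | h')
      · rcases Sym2.eq_iff.1 h' with ⟨h', -⟩ | ⟨-, h'⟩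
        exacts [hxm h'.symm, hxy h'.symm]
      · exact hnot _ h'.1 (by simp)) hp2 (by
      intro e he
      rw [u1]
      rintro (h' | h')
      · exact hfe e (by rw [heq]; simp only [List.map_append, List.mem_append]; exact Or.inr he) h'
      · exact hn.2.2 e h' e he rfl)
  refine ⟨_, _, s2, ?_, ?_⟩
  · set E' := insert s(m, y) (insert s(x, m) (E \ {s(x, y)}))
    have lx : Connects (sym2Graph (insert m M) E') x m :=
      .of_isLink ⟨Or.inr (Or.inl rfl), rfl, Or.inr hx, Or.inl rfl⟩
    have ly : Connects (sym2Graph (insert m M) E') m y :=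
      .of_isLink ⟨Or.inl rfl, rfl, Or.inl rfl, Or.inr hy⟩
    have hold : ∀ z ∈ M, Connects (sym2Graph (insert m M) E') x z := by
      intro z hz
      refine (hc.2 x hx z hz).map (f := id) (fun z hz => Or.inr hz) ?_
      rintro g a b ⟨hg, rfl, ha, hb⟩
      by_cases hgf : s(a, b) = s(x, y)
      · rcases Sym2.eq_iff.1 hgf with ⟨rfl, rfl⟩ | ⟨rfl, rfl⟩
        · exact lx.trans ly
        · exact (lx.trans ly).symm
      · exact .of_isLink ⟨Or.inr (Or.inr ⟨hg, hgf⟩), rfl, Or.inr ha, Or.inr hb⟩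
    refine isConnected_of_forall_connects (u := x) (Or.inr hx) ?_
    rintro z (rfl | hz)
    exacts [lx, hold z hz]
  · rw [u2, u1]
    rintro e ((⟨g, hg, he⟩ | he) | he)
    · exact ⟨g, hg.1, he⟩
    · exact ⟨_, hf, by rw [heq]; simp only [List.map_append, List.mem_append]; exact Or.inl he⟩
    · exact ⟨_, hf, by rw [heq]; simp only [List.map_append, List.mem_append]; exact Or.inr he⟩

theorem ends_mem_usedVertices {T : Graph α β} (h : IsSkeleton T M E pth) {e : β} {a b : α}
    (he : e ∈ usedEdges E pth) (hl : T.IsLink e a b) : a ∈ usedVertices M E pth := by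
  obtain ⟨f, hf, he⟩ := he
  obtain ⟨x, y, -, hx, -, -, hp⟩ := h.isPath f hf
  have := (hp.1.ends_mem_support he hl).1
  rcases List.mem_cons.1 this with rfl | h'
  exacts [Or.inl hx, Or.inr ⟨f, hf, h'⟩]

end IsSkeleton

/-- Stop a walk when it first meets `X`: every edge of the initial segment has an end outside
`X`. -/
theorem IsWalk.exists_first_hit {T : Graph α β} {X : Set α} {u v : α} {w : List (β × α)}
    (h : IsWalk T u w v) (hv : v ∈ X) :
    ∃ m ∈ X, ∃ w', IsWalk T u w' m ∧
      ∀ e ∈ w'.map Prod.fst, ∃ a b, T.IsLink e a b ∧ a ∉ X := by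
  induction h with
  | @nil u hu => exact ⟨u, hv, [], .nil hu, by simp⟩
  | @cons u x v e w hl hw ih =>
    by_cases hu : u ∈ X
    · exact ⟨u, hu, [], .nil hl.left_mem, by simp⟩
    · obtain ⟨m, hm, w', hw', h'⟩ := ih hv
      refine ⟨m, hm, (e, x) :: w', .cons hl hw', fun e' he' => ?_⟩
      rcases List.mem_cons.1 he' with rfl | he'
      · exact ⟨u, x, hl, hu⟩
      · exact h' e' he'

/-- Every set of vertices of a connected graph is contained in a small connected skeleton: attach
the vertices one by one, each by a path to the first vertex of the skeleton on its way. -/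
theorem exists_isSkeleton [Finite α] {T : Graph α β} (hT : IsConnected T) {S : Set α}
    (hS : S.Nonempty) (hST : S ⊆ T.vertexSet) :
    ∃ M E pth, IsSkeleton T M E pth ∧ IsConnected (sym2Graph M E) ∧ S ⊆ M ∧
      M.ncard + 1 ≤ 2 * S.ncard := by
  classical
  induction S, Set.toFinite S using Set.Finite.induction_on with
  | empty => exact absurd hS (by simp)
  | @insert a S haS hfin ih =>
    have haT : a ∈ T.vertexSet := hST (Or.inl rfl)
    have hcard := Set.ncard_insert_of_notMem haS hfin
    rcases S.eq_empty_or_nonempty with rfl | hSne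
    · refine ⟨{a}, ∅, fun _ => [], ⟨by simpa using haT, by simp, by simp⟩,
        isConnected_of_forall_connects (u := a) rfl ?_, by simp, by simp⟩
      rintro _ rfl
      exact .refl rfl
    obtain ⟨M, E, pth, h, hc, hSM, hcd⟩ := ih hSne fun x hx => hST (Or.inr hx)
    by_cases haM : a ∈ M
    · exact ⟨M, E, pth, h, hc, Set.insert_subset haM hSM, by omega⟩
    obtain ⟨s, hs⟩ := hSne
    obtain ⟨w, hw⟩ := hT.2 a haT s (h.subset (hSM hs))
    obtain ⟨m, hm, w', hw', hhit⟩ := hw.exists_first_hit (X := usedVertices M E pth)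
      (Or.inl (hSM hs))
    obtain ⟨E', pth', h', hc', hu'⟩ := h.subdivide hc hm
    have hcard1 : (insert m M).ncard ≤ M.ncard + 1 := Set.ncard_insert_le m M
    by_cases ham : a = m
    · subst ham
      exact ⟨_, _, _, h', hc', Set.insert_subset_insert hSM, by omega⟩
    obtain ⟨p, hp, hsub⟩ := hw'.exists_isPath
    have haM' : a ∉ insert m M := by simp [ham, haM]
    obtain ⟨h2, -⟩ := (h'.insert_vertex haT).insert_edge (a := a) (b := m) (Or.inl rfl)
      (Or.inr (Or.inl rfl)) ham (fun hE => haM' (h'.mem_of_mem hE).1) hp (by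
        intro e he heu
        obtain ⟨x, y, hl, hx⟩ := hhit e ((hsub.map Prod.fst).subset he)
        exact hx (h.ends_mem_usedVertices (hu' heu) hl))
    have hcard2 := Set.ncard_insert_le a (insert m M)
    refine ⟨_, _, _, h2, ?_, Set.insert_subset_insert (hSM.trans (Set.subset_insert _ _)), by omega⟩
    refine isConnected_of_forall_connects (u := m) (Or.inr (Or.inl rfl)) ?_
    rintro z (rfl | hz)
    · refine Connects.of_isLink (e := s(z, m)) ?_ |>.symm
      exact ⟨Or.inl rfl, rfl, Or.inl rfl, Or.inr (Or.inl rfl)⟩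
    · refine (hc'.2 m (Or.inl rfl) z hz).mono ?_
      exact ⟨Set.subset_insert _ _,
        fun f x y hl => ⟨Or.inr hl.1, hl.2.1, Or.inr hl.2.2.1, Or.inr hl.2.2.2⟩⟩

/-- A connected skeleton of a tree that contains the prescribed vertices is a tree reduction. -/
theorem exists_isTreeReduction [Finite α] :
    ∃ R : LGraph α β → Set α → LGraph α (Sym2 α), IsTreeReduction R := by
  have key : ∀ (T : LGraph α β) (S : Set α), ∃ R : LGraph α (Sym2 α),
      T.PosLen → IsTree T.toGraph → S.Nonempty → S ⊆ T.vertexSet →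
      IsTree R.toGraph ∧ S ⊆ R.vertexSet ∧ R.order + 1 ≤ 2 * S.ncard ∧
      (∀ x ∈ S, ∀ y ∈ S, R.dist x y = T.dist x y) ∧
      ∃ φ : PathEmbedding R T, ∀ x ∈ R.vertexSet, φ.π x = x := by
    intro T S
    by_cases h : T.PosLen ∧ IsTree T.toGraph ∧ S.Nonempty ∧ S ⊆ T.vertexSet
    · obtain ⟨hpos, hT, hS, hST⟩ := h
      obtain ⟨M, E, pth, h, hc, hSM, hcard⟩ := exists_isSkeleton hT.1 hS hST
      obtain ⟨φ, hφ⟩ := h.exists_pathEmbedding hpos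
      exact ⟨skeletonGraph T M E pth, fun _ _ _ _ => ⟨⟨hc, h.isForest hT.2⟩, hSM, hcard,
        fun x hx y hy => h.dist_eq hpos hT.2 (hc.2 x (hSM hx) y (hSM hy)), φ, fun x _ => hφ x⟩⟩
    · exact ⟨skeletonGraph T ∅ ∅ fun _ => [], fun h1 h2 h3 h4 => absurd ⟨h1, h2, h3, h4⟩ h⟩
  choose R hR using key
  exact ⟨R, hR⟩

end TreeReduction

/-! ### The levels of Bartal's algorithm -/

section Bartal

theorem IsLowDiameterForest.isForest {H : LGraph α β} {d : ℝ} {F : Set β}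
    (h : IsLowDiameterForest H d F) : IsForest (H.restrictEdges F).toGraph := by
  rintro e x y hl ⟨w, hw⟩
  have hU := component_mem_components hl.left_mem
  obtain ⟨r, -, -, -, -, hT, -⟩ := (h.2 _ hU).1
  have hx := mem_component_self hl.left_mem
  refine hT.2 e x y ⟨hl, hx, components.isLink_mem hU hl hx⟩ ⟨w, ?_⟩
  refine ((components.isWalk_inducedOn_iff hU hx).2 hw.of_deleteEdges).deleteEdges fun he => ?_
  have := hw.edge_mem he
  simp at this

theorem IsLowDiameterForest.dist_le {H : LGraph α β} {d : ℝ} {F : Set β}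
    (h : IsLowDiameterForest H d F) {x y : α} (hc : Connects (H.restrictEdges F).toGraph x y) :
    (H.restrictEdges F).dist x y ≤ ENNReal.ofReal d := by
  have hU := component_mem_components hc.left_mem
  have hx := mem_component_self hc.left_mem
  rw [← components.dist_inducedOn hU hx]
  exact (h.2 _ hU).2 x hx y (components.mem_of_connects hU hx hc)

/-- The graph that Bartal's algorithm hands to the partition routine for the vertex set `U` of a
component of level `i`. -/
noncomputable def callGraph (G : LGraph α β) (d : ℕ → ℝ) (i : ℕ) (U : Set α) : LGraph α β :=
  (G.restrictEdges {e | G.len e < d (i + 1) / Real.log G.order}).inducedOn U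

/-- The properties of the levels `L 0, …, L t` of Bartal's algorithm on `G` with bounds `d` that
do not depend on the random choices. -/
structure IsBartalRun (G : LGraph α β) (t : ℕ) (d : ℕ → ℝ) (L : ℕ → Set β) : Prop where
  isTree_zero : IsTree (G.restrictEdges (L 0)).toGraph
  isForest : ∀ i ≤ t, IsForest (G.restrictEdges (L i)).toGraph
  laminar : ∀ i < t, ∀ x y, Connects (G.restrictEdges (L (i + 1))).toGraph x y →
    Connects (G.restrictEdges (L i)).toGraph x y
  dist_le : ∀ i ≤ t, ∀ x y, Connects (G.restrictEdges (L i)).toGraph x y →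
    (G.restrictEdges (L i)).dist x y ≤ ENNReal.ofReal (d i)
  len_le : ∀ i ≤ t, ∀ e ∈ G.edgeSet, e ∈ L i → G.len e ≤ d i / Real.log G.order
  last_empty : ∀ e ∈ G.edgeSet, e ∉ L t

variable {G : LGraph α β} {t : ℕ} {d : ℕ → ℝ} {T₀ : Set β} {ω : Fin t × Set α → Set β}

theorem bartalLevels_succ {i : ℕ} (hi : i < t) : bartalLevels G t T₀ ω (i + 1) =
    ⋃ U ∈ components (G.restrictEdges (bartalLevels G t T₀ ω i)).toGraph, ω (⟨i, hi⟩, U) := by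
  rw [bartalLevels, dif_pos hi]

/-- Within a component `U` of level `i`, the walks of level `i + 1` are those of the forest
returned for `U`. -/
theorem isWalk_bartalLevels_succ
    (hω : ∀ k : Fin t × Set α, ω k ⊆ (callGraph G d k.1 k.2).edgeSet) {i : ℕ} (hi : i < t)
    {U : Set α} (hU : U ∈ components (G.restrictEdges (bartalLevels G t T₀ ω i)).toGraph)
    {x y : α} (hx : x ∈ U) {w : List (β × α)} :
    IsWalk (G.restrictEdges (bartalLevels G t T₀ ω (i + 1))).toGraph x w y ↔
      IsWalk ((callGraph G d i U).restrictEdges (ω (⟨i, hi⟩, U))).toGraph x w y := by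
  have hlink : ∀ U' e a b, e ∈ ω (⟨i, hi⟩, U') → G.IsLink e a b →
      (callGraph G d i U').IsLink e a b := by
    intro U' e a b he hl
    obtain ⟨a', b', hl'⟩ := Graph.exists_isLink_of_mem_edgeSet (hω _ he)
    have := LGraph.ends_mem_of_mem_inducedOn (hω _ he) ⟨hl'.1.1, hl⟩
    exact ⟨⟨hl'.1.1, hl⟩, this⟩
  constructor
  · intro h
    refine (h.transfer (U := U)
      (K := ((callGraph G d i U).restrictEdges (ω (⟨i, hi⟩, U))).toGraph) ?_ subset_rfl hx).1
    rintro e a b ⟨he, hl⟩ ha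
    rw [bartalLevels_succ hi] at he
    simp only [Set.mem_iUnion] at he
    obtain ⟨U', hU', he⟩ := he
    have h1 := hlink U' e a b he hl
    obtain rfl := components.eq_of_mem hU' hU h1.2.1 ha
    exact ⟨h1.2.2, he, h1⟩
  · intro h
    have hUV : U ⊆ (G.restrictEdges (bartalLevels G t T₀ ω i)).vertexSet := components.subset hU
    refine h.mono ?_
    refine ⟨hUV, fun e a b hl => ⟨?_, hl.2.1.2⟩⟩
    rw [bartalLevels_succ hi]
    exact Set.mem_biUnion hU hl.1

theorem one_le_dist (h : ∀ e ∈ G.edgeSet, 1 ≤ G.len e) {x y : α} (hxy : x ≠ y) :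
    1 ≤ G.dist x y := by
  refine LGraph.le_dist fun w hw => ?_
  cases hw with
  | nil _ => exact absurd rfl hxy
  | @cons _ z _ e w hl hw =>
    have hpos : G.PosLen := fun e he => zero_lt_one.trans_le (h e he)
    rw [ENNReal.one_le_ofReal, LGraph.walkLen_cons]
    linarith [hpos.walkLen_nonneg hw, h e hl.edge_mem]

/-- Whatever low-diameter forests are returned, the levels refine each other, and the last level is
empty because every edge has length at least `1`. -/
theorem isBartalRun_bartalLevels (hloop : G.toGraph.Loopless) (hlen : ∀ e ∈ G.edgeSet, 1 ≤ G.len e)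
    (ht : 0 < t) (hdt : d t < 1)
    (hT₀ : IsTree (G.restrictEdges T₀).toGraph)
    (hdist : ∀ x ∈ G.vertexSet, ∀ y ∈ G.vertexSet,
      (G.restrictEdges T₀).dist x y ≤ ENNReal.ofReal (d 0))
    (hlen0 : ∀ e ∈ G.edgeSet, G.len e ≤ d 0 / Real.log G.order)
    (hω : ∀ k : Fin t × Set α, IsLowDiameterForest (callGraph G d k.1 k.2) (d (k.1 + 1)) (ω k)) :
    IsBartalRun G t d (bartalLevels G t T₀ ω) := by
  have hω' : ∀ k : Fin t × Set α, ω k ⊆ (callGraph G d k.1 k.2).edgeSet := fun k => (hω k).1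
  have hdist' : ∀ i < t, ∀ x y,
      Connects (G.restrictEdges (bartalLevels G t T₀ ω (i + 1))).toGraph x y →
      (G.restrictEdges (bartalLevels G t T₀ ω (i + 1))).dist x y ≤ ENNReal.ofReal (d (i + 1)) := by
    rintro i hi x y ⟨w, hw⟩
    have hx : x ∈ (G.restrictEdges (bartalLevels G t T₀ ω i)).vertexSet := hw.left_mem
    have hU := component_mem_components hx
    have hxU := mem_component_self hx
    have := (hω (⟨i, hi⟩, component (G.restrictEdges (bartalLevels G t T₀ ω i)).toGraph x)).dist_le
      ⟨w, (isWalk_bartalLevels_succ hω' hi hU hxU).1 hw⟩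
    refine le_trans (le_of_eq ?_) this
    exact LGraph.dist_congr (fun w => isWalk_bartalLevels_succ hω' hi hU hxU) rfl
  refine ⟨hT₀, ?_, ?_, ?_, ?_, ?_⟩
  · rintro (_ | i) hi
    · exact hT₀.2
    rintro e x y hl ⟨w, hw⟩
    have hx : x ∈ (G.restrictEdges (bartalLevels G t T₀ ω i)).vertexSet := hl.2.left_mem
    have hU := component_mem_components hx
    have hxU := mem_component_self hx
    have h1 := (isWalk_bartalLevels_succ hω' hi hU hxU).1 hw.of_deleteEdges
    have h2 := (isWalk_bartalLevels_succ hω' hi hU hxU).1 (.single hl)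
    cases h2 with
    | cons h2 _ =>
      refine (hω (⟨i, hi⟩, _)).isForest e x y h2 ⟨w, h1.deleteEdges fun he => ?_⟩
      have := hw.edge_mem he
      simp at this
  · rintro i hi x y ⟨w, hw⟩
    have hx : x ∈ (G.restrictEdges (bartalLevels G t T₀ ω i)).vertexSet := hw.left_mem
    exact ((isWalk_bartalLevels_succ hω' hi (component_mem_components hx)
      (mem_component_self hx)).1 hw).right_mem
  · rintro (_ | i) hi x y hc
    · exact hdist x hc.left_mem y hc.right_mem
    · exact hdist' i hi x y hc
  · rintro (_ | i) hi e he heL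
    · exact hlen0 e he
    · rw [bartalLevels_succ hi] at heL
      simp only [Set.mem_iUnion] at heL
      obtain ⟨U, -, heU⟩ := heL
      obtain ⟨_, _, hl⟩ := Graph.exists_isLink_of_mem_edgeSet (hω' _ heU)
      exact le_of_lt hl.1.1
  · intro e he heL
    obtain ⟨i, rfl⟩ : ∃ i, t = i + 1 := ⟨t - 1, by omega⟩
    obtain ⟨x, y, hl⟩ := Graph.exists_isLink_of_mem_edgeSet he
    have hl' : (G.restrictEdges (bartalLevels G (i + 1) T₀ ω (i + 1))).IsLink e x y := ⟨heL, hl⟩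
    have hxy : x ≠ y := by
      rintro rfl
      exact hloop.not_isLoopAt e x hl
    have h1 := hdist' i (Nat.lt_succ_self i) x y (.of_isLink hl')
    have h2 := one_le_dist
      (G := G.restrictEdges (bartalLevels G (i + 1) T₀ ω (i + 1))) (fun e he => hlen e he.1) hxy
    have := ENNReal.one_le_ofReal.1 (h2.trans h1)
    linarith

/-- Trees with short edges have small diameter. -/
theorem dist_le_order_mul [Finite α] {T : LGraph α β} {Δ : ℝ} (hΔ0 : 0 ≤ Δ)
    (hΔ : ∀ e ∈ T.edgeSet, T.len e ≤ Δ) {x y : α} (h : Connects T.toGraph x y) :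
    T.dist x y ≤ ENNReal.ofReal (T.order * Δ) := by
  obtain ⟨w, hw⟩ := h
  obtain ⟨p, hp, -⟩ := hw.exists_isPath
  refine hp.1.dist_le.trans (ENNReal.ofReal_le_ofReal ?_)
  rw [LGraph.walkLen_eq_sum_edges]
  refine (List.sum_le_card_nsmul _ Δ ?_).trans ?_
  · intro r hr
    obtain ⟨e, he, rfl⟩ := List.mem_map.1 hr
    exact hΔ e (hp.1.edge_mem he)
  · rw [nsmul_eq_mul]
    refine mul_le_mul_of_nonneg_right ?_ hΔ0
    rw [List.length_map, List.length_map]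
    exact_mod_cast hp.length_lt.le

/-! ### Geometric sums over the levels -/

/-- The terms of a geometric progression that do not exceed `1` have a bounded sum. -/
theorem sum_geometric_le {a y : ℝ} (ha : 0 < a) (hy : 0 < y) (m : ℕ) :
    ∑ i ∈ Finset.range m, (if y * 4 ^ i ≤ 1 then (y * 4 ^ i) ^ a else 0) ≤ (1 + a) / a := by
  set ρ : ℝ := 4 ^ (-a)
  have hρ0 : 0 < ρ := by positivity
  have hρ4 : ∀ z : ℝ, 0 < z → ρ * (z * 4) ^ a = z ^ a := by
    intro z hz
    rw [Real.mul_rpow hz.le (by norm_num), mul_left_comm, ← Real.rpow_add (by norm_num)]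
    simp
  have key : (∑ i ∈ Finset.range m, (if y * 4 ^ i ≤ 1 then (y * 4 ^ i) ^ a else 0)) * (1 - ρ) ≤ 1 ∧
      (∑ i ∈ Finset.range m, (if y * 4 ^ i ≤ 1 then (y * 4 ^ i) ^ a else 0)) * (1 - ρ) ≤
        ρ * (y * 4 ^ m) ^ a := by
    induction m with
    | zero => simp; positivity
    | succ m ih =>
      have hz : 0 < y * 4 ^ m := by positivity
      rw [Finset.sum_range_succ, pow_succ, ← mul_assoc y, hρ4 _ hz]
      split_ifs with h
      · have h1 : (y * 4 ^ m) ^ a ≤ 1 := Real.rpow_le_one hz.le h ha.le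
        constructor <;> nlinarith [ih.2]
      · have h1 : ρ * (y * 4 ^ m) ^ a ≤ (y * 4 ^ m) ^ a := by
          refine mul_le_of_le_one_left (by positivity) ?_
          exact Real.rpow_le_one_of_one_le_of_nonpos (by norm_num) (by linarith)
        rw [add_zero]
        exact ⟨ih.1, ih.2.trans h1⟩
  have h1 : ρ ≤ 1 / (1 + a) := by
    have hlog4 : 1 ≤ Real.log 4 := by
      rw [Real.le_log_iff_exp_le (by norm_num)]
      linarith [Real.exp_one_lt_d9]
    have : 1 + a ≤ 4 ^ a := by
      rw [Real.rpow_def_of_pos (by norm_num)]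
      have := Real.add_one_le_exp (Real.log 4 * a)
      nlinarith
    simp only [ρ]
    rw [Real.rpow_neg (by norm_num), inv_eq_one_div]
    gcongr
  have h2 : a / (1 + a) ≤ 1 - ρ := by
    have : a / (1 + a) = 1 - 1 / (1 + a) := by field_simp; ring
    linarith
  have h3 : 0 < a / (1 + a) := by positivity
  have h4 := (le_div_iff₀ (h3.trans_le h2)).2 key.1
  refine h4.trans ?_
  rw [← one_div_div a]
  gcongr

end Bartal

/-! ### Switching exponents -/

section Switch

/-- The levels `L 0, L 1, …` with the rescaled lengths of `embeddableDecompose`. -/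
noncomputable def switchedLevels (p q : ℝ) (G : LGraph α β) (d' : ℕ → ℝ) (L : ℕ → Set β) (i : ℕ) :
    LGraph α β :=
  ((G.powLen (p / q)).restrictEdges (L i)).scaleLen (switchFactor 1 p q G.order d' i)

variable {p q : ℝ}

/-- For the lengths `m = l ^ (p / q)` on which the decomposition runs, `l = m ^ ((q - p) / p) * m`;
`switchFactor` replaces the first factor by its maximum over the edges of a level. -/
theorem rpow_split {l : ℝ} (hp : 0 < p) (hpq : p < q) (hl : 0 < l) :
    l = (l ^ (p / q)) ^ ((q - p) / p) * l ^ (p / q) := by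
  have hq : 0 < q := hp.trans hpq
  rw [← Real.rpow_mul hl.le, ← Real.rpow_add hl]
  have : p / q * ((q - p) / p) + p / q = 1 := by field_simp; ring
  rw [this, Real.rpow_one]

theorem le_rpow_mul {l r : ℝ} (hp : 0 < p) (hpq : p < q) (hl : 0 < l) (hr : l ^ (p / q) ≤ r) :
    l ≤ r ^ ((q - p) / p) * l ^ (p / q) := by
  have hq : 0 < q := hp.trans hpq
  conv_lhs => rw [rpow_split hp hpq hl]
  have : 0 < q - p := sub_pos.2 hpq
  gcongr

theorem rpow_le_switchFactor {n : ℕ} {d' : ℕ → ℝ} {i : ℕ} (hpq : p < q) (hqp : q - p ≤ 1)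
    (h : 0 ≤ d' i / Real.log n) :
    (d' i / Real.log n) ^ ((q - p) / p) ≤ switchFactor 1 p q n d' i := by
  rw [switchFactor]
  refine le_mul_of_one_le_left (by positivity) ?_
  rw [one_le_div (sub_pos.2 hpq)]
  exact hqp

theorem switchFactor_pos {n : ℕ} {d' : ℕ → ℝ} {i : ℕ} (hpq : p < q) (h : 0 < d' i / Real.log n) :
    0 < switchFactor 1 p q n d' i := by
  rw [switchFactor]
  have := sub_pos.2 hpq
  positivity

variable {G : LGraph α β} {t : ℕ} {d' : ℕ → ℝ} {L : ℕ → Set β}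

open Classical in
/-- The levels together use at most the weight of each edge: the weights of its copies form a
geometric progression. -/
theorem sum_weight_switchedLevels_le (hp : 0 < p) (hpq : p < q) (hq1 : q ≤ 1)
    (hlog : 0 < Real.log G.order) (hd0 : 0 < d' 0) (hd : ∀ i, d' i = d' 0 / 4 ^ i) {e : β}
    (hl : 1 ≤ G.len e)
    (hL : ∀ i ≤ t, e ∈ L i → G.len e ^ (p / q) ≤ d' i / Real.log G.order) :
    ∑ i ∈ Finset.range (t + 1), (if e ∈ L i then 1 / (switchedLevels p q G d' L i).len e else 0) ≤
      1 / G.len e := by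
  have hq : 0 < q := hp.trans hpq
  have hqp : 0 < q - p := sub_pos.2 hpq
  have hl0 : 0 < G.len e := zero_lt_one.trans_le hl
  set m := G.len e ^ (p / q) with hm
  have hm0 : 0 < m := by positivity
  set a := (q - p) / p with ha
  have ha0 : 0 < a := by positivity
  have hterm : ∀ i ∈ Finset.range (t + 1),
      (if e ∈ L i then 1 / (switchedLevels p q G d' L i).len e else 0) ≤
        (q - p) / G.len e * (if m * Real.log G.order / d' 0 * 4 ^ i ≤ 1 then
          (m * Real.log G.order / d' 0 * 4 ^ i) ^ a else 0) := by
    intro i hi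
    have hdi : 0 < d' i := by rw [hd]; positivity
    have hy : m * Real.log G.order / d' 0 * 4 ^ i = m / (d' i / Real.log G.order) := by
      rw [hd i]
      field_simp
    rw [hy]
    have hr : 0 < d' i / Real.log G.order := by positivity
    split_ifs with h1 h2 h2
    · refine le_of_eq ?_
      change 1 / (switchFactor 1 p q G.order d' i * m) = _
      rw [switchFactor, Real.div_rpow hm0.le hr.le]
      conv_rhs => rw [rpow_split hp hpq hl0]
      rw [← hm, ← ha]
      field_simp
    · exact absurd (by rw [div_le_one hr]; exact hL i (by simpa [Nat.lt_succ_iff] using hi) h1) h2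
    · positivity
    · simp
  refine (Finset.sum_le_sum hterm).trans ?_
  rw [← Finset.mul_sum]
  refine (mul_le_mul_of_nonneg_left (sum_geometric_le ha0 (by positivity) (t + 1))
    (by positivity)).trans ?_
  have : (q - p) / G.len e * ((1 + a) / a) = q / G.len e := by
    rw [ha]
    field_simp
    ring
  rw [this]
  gcongr

section Run

variable (hp : 0 < p) (hpq : p < q) (hqp : q - p ≤ 1) (hlog : 0 < Real.log G.order)
  (hd0 : 0 < d' 0) (hd : ∀ i, d' i = d' 0 / 4 ^ i) (hl : ∀ e ∈ G.edgeSet, 1 ≤ G.len e)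
  (hrun : IsBartalRun (G.powLen (p / q)) t d' L)

include hp hpq hqp hlog hd0 hd hl hrun

theorem switchedLevels_wSubgraph {i : ℕ} (hi : i ≤ t) :
    (switchedLevels p q G d' L i).WSubgraph G := by
  refine ⟨LGraph.restrictEdges_le, fun e he => ?_⟩
  have hle := hl e he.1
  have hr : 0 ≤ d' i / Real.log G.order := by rw [hd]; positivity
  refine (le_rpow_mul hp hpq (zero_lt_one.trans_le hle) (hrun.len_le i hi e he.1 he.2)).trans ?_
  exact mul_le_mul_of_nonneg_right (rpow_le_switchFactor hpq hqp hr) (by positivity)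

theorem isBartalDecomposition_switchedLevels :
    IsBartalDecomposition G t (switchedLevels p q G d' L) where
  forest := hrun.isForest
  vertexSet_eq _ _ := rfl
  spanning := hrun.isTree_zero
  last_empty := Set.eq_empty_of_forall_notMem fun e he => hrun.last_empty e he.1 he.2
  subgraph _ hi := switchedLevels_wSubgraph hp hpq hqp hlog hd0 hd hl hrun hi
  laminar := hrun.laminar

theorem boundsDiameter_switchedLevels :
    BoundsDiameter (1 / 4) G t (switchBounds 1 p q G.order d') (switchedLevels p q G d' L) where
  pos i _ := by
    have hdi : 0 < d' i := by rw [hd]; positivity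
    exact mul_pos (switchFactor_pos hpq (by positivity)) hdi
  geometric i _ := by
    have hdi : 0 < d' i := by rw [hd]; positivity
    have hdi' : d' (i + 1) = d' i / 4 := by rw [hd, hd i, pow_succ]; field_simp
    have hqp' : 0 < q - p := sub_pos.2 hpq
    rw [switchBounds, switchBounds, switchFactor, switchFactor, hdi']
    have : (d' i / 4 / Real.log G.order) ^ ((q - p) / p) ≤
        (d' i / Real.log G.order) ^ ((q - p) / p) := by
      gcongr
      linarith
    have h1 : 0 < 1 / (q - p) := by positivity
    calc _ ≤ 1 / (q - p) * (d' i / Real.log G.order) ^ ((q - p) / p) * (d' i / 4) := by gcongr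
      _ = _ := by ring
  diam i hi x y hc := by
    have hdi : 0 < d' i := by rw [hd]; positivity
    have hs := switchFactor_pos (i := i) (d' := d') (n := G.order) hpq (by positivity)
    rw [switchedLevels, LGraph.dist_scaleLen hs, switchBounds, ENNReal.ofReal_mul hs.le]
    gcongr
    exact hrun.dist_le i hi x y hc
  edge_len i hi e he := by
    have hdi : 0 < d' i := by rw [hd]; positivity
    have hqp' : 0 < q - p := sub_pos.2 hpq
    have hle := hrun.len_le i hi e he.1 he.2
    refine (le_rpow_mul hp hpq (zero_lt_one.trans_le (hl e he.1)) hle).trans ?_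
    rw [switchBounds, mul_div_assoc]
    exact mul_le_mul (rpow_le_switchFactor hpq hqp (by positivity)) hle
      (Real.rpow_nonneg (zero_le_one.trans (hl e he.1)) _) (switchFactor_pos hpq (by positivity)).le

omit hqp in
open Classical in
/-- Every copy of an edge is embedded as the edge itself. -/
theorem embeddable_levelUnion_switchedLevels [Finite β] (hq1 : q ≤ 1)
    (hloop : G.toGraph.Loopless) :
    Embeddable (levelUnion t (switchedLevels p q G d' L)) G := by
  have := Fintype.ofFinite β
  have hlenpos : ∀ i, ∀ e ∈ G.edgeSet, 0 < (switchedLevels p q G d' L i).len e := by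
    intro i e he
    have hdi : 0 < d' i := by rw [hd]; positivity
    have := hl e he
    exact mul_pos (switchFactor_pos hpq (by positivity))
      (Real.rpow_pos_of_pos (zero_lt_one.trans_le this) _)
  have hedge : ∀ f, f ∈ (levelUnion t (switchedLevels p q G d' L)).edgeSet ↔
      f.2 ∈ L f.1 ∧ f.2 ∈ G.edgeSet := by
    intro f
    rw [Graph.edge_mem_iff_exists_isLink]
    constructor
    · rintro ⟨x, y, h⟩
      exact ⟨h.1, h.2.edge_mem⟩
    · rintro ⟨h1, h2⟩
      obtain ⟨x, y, h⟩ := Graph.exists_isLink_of_mem_edgeSet h2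
      exact ⟨x, y, h1, h⟩
  have hex : ∀ f, f ∈ (levelUnion t (switchedLevels p q G d' L)).edgeSet → ∃ x y,
      (levelUnion t (switchedLevels p q G d' L)).IsLink f x y := fun f hf =>
    Graph.exists_isLink_of_mem_edgeSet hf
  have : Nonempty α := by
    by_contra h
    rw [not_nonempty_iff] at h
    simp [LGraph.order, Set.eq_empty_of_isEmpty] at hlog
  choose! x y hxy using hex
  refine ⟨{ π := id, path := fun f => [(f.2, y f)],
            W := fun f e => if e = f.2 then 1 / (switchedLevels p q G d' L f.1).len e else 0,
            π_mem := ?_, path_isPath := ?_, W_pos := ?_, W_zero := ?_,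
            congestion := ?_, dilation := ?_ }⟩
  · intro z hz
    obtain ⟨i, hi⟩ := Set.mem_iUnion.1 hz
    exact hi
  · intro f hf
    have hlink : G.IsLink f.2 (x f) (y f) := (hxy f hf).2
    refine ⟨x f, y f, hxy f hf, isPath_single hlink ?_, by simp⟩
    intro (heq : x f = y f)
    rw [heq] at hlink
    exact hloop.not_isLoopAt _ _ hlink
  · intro f hf e he
    obtain rfl : e = f.2 := by simpa using he
    rw [if_pos rfl]
    exact one_div_pos.2 (hlenpos _ _ ((hedge f).1 hf).2)
  · intro f _ e he
    exact if_neg (by simpa using he)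
  · intro e he
    refine le_trans (le_of_eq ?_)
      (sum_weight_switchedLevels_le (t := t) (L := L) hp hpq hq1 hlog hd0 hd (hl e he)
        fun i hi heL => hrun.len_le i hi e he heL)
    rw [finsum_mem_def, finsum_eq_sum_of_fintype, Fintype.sum_prod_type,
      ← Fin.sum_univ_eq_sum_range
        (fun i => if e ∈ L i then 1 / (switchedLevels p q G d' L i).len e else 0)]
    refine Finset.sum_congr rfl fun i _ => ?_
    rw [Finset.sum_eq_single e]
    · simp only [Set.indicator_apply, hedge, if_true, he, and_true]
    · intro f _ hf
      simp only [Set.indicator_apply, if_neg (Ne.symm hf), ite_self]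
    · simp
  · intro f _
    simp [levelUnion, LGraph.edgeUnion]

end Run

end Switch

/-! ### Independence of the calls -/

section Independence

variable {ι : Type*} {γ : Type*} [Fintype ι] [Fintype γ]

theorem independentLaw_apply (P : ι → PMF γ) (ω : ι → γ) :
    independentLaw P ω = ∏ i, P i (ω i) := rfl

theorem mem_support_of_mem_support_independentLaw {P : ι → PMF γ} {ω : ι → γ}
    (h : ω ∈ (independentLaw P).support) (i : ι) : ω i ∈ (P i).support := by
  rw [PMF.mem_support_iff, independentLaw_apply, Finset.prod_ne_zero_iff] at h
  exact h i (Finset.mem_univ i)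

open Classical in
/-- Resampling a single coordinate does not change expectations. -/
theorem sum_independentLaw_resample (P : ι → PMF γ) (k : ι) (f : (ι → γ) → ℝ≥0∞) :
    ∑ ω, independentLaw P ω * f ω =
      ∑ ω, independentLaw P ω * ∑ a, P k a * f (Function.update ω k a) := by
  have hprod : ∀ (b : γ) (ν : {j // j ≠ k} → γ),
      independentLaw P ((Equiv.piSplitAt k fun _ => γ).symm (b, ν)) =
        P k b * ∏ j : {j // j ≠ k}, P j (ν j) := by
    intro b ν
    rw [independentLaw_apply, Fintype.prod_eq_mul_prod_subtype_ne _ k]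
    congr 1
    · simp [Equiv.piSplitAt]
    · refine Finset.prod_congr rfl fun j _ => ?_
      simp [Equiv.piSplitAt, j.2]
  have hupd : ∀ (b a : γ) (ν : {j // j ≠ k} → γ),
      Function.update ((Equiv.piSplitAt k fun _ => γ).symm (b, ν)) k a =
        (Equiv.piSplitAt k fun _ => γ).symm (a, ν) := by
    intro b a ν
    funext j
    by_cases hj : j = k
    · subst hj
      simp [Equiv.piSplitAt]
    · simp [Equiv.piSplitAt, hj]
  have hone : ∑ b, P k b = 1 := by
    rw [← tsum_fintype (L := .unconditional γ)]
    exact (P k).tsum_coe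
  rw [← (Equiv.piSplitAt k fun _ => γ).symm.sum_comp,
    ← (Equiv.piSplitAt k fun _ => γ).symm.sum_comp,
    Fintype.sum_prod_type_right, Fintype.sum_prod_type_right]
  refine Finset.sum_congr rfl fun ν _ => ?_
  simp only [hprod, hupd]
  simp only [mul_right_comm _ (∏ j : {j // j ≠ k}, P j (ν j))]
  rw [← Finset.sum_mul, ← Finset.sum_mul, ← Finset.sum_mul, hone, one_mul]

theorem sum_pmf_mul_indicator (P : PMF γ) (S : Set γ) :
    ∑ a, P a * S.indicator 1 a = P.toOuterMeasure S := by
  rw [PMF.toOuterMeasure_apply, tsum_fintype]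
  exact Finset.sum_congr rfl fun a _ => by by_cases h : a ∈ S <;> simp [h]

open Classical in
/-- If `f` does not depend on the coordinate `k`, then the event `ω k ∈ S` is independent of `f`. -/
theorem sum_independentLaw_mul_indicator (P : ι → PMF γ) (k : ι) {f : (ι → γ) → ℝ≥0∞}
    (hf : ∀ ω ω', (∀ j ≠ k, ω j = ω' j) → f ω = f ω') (S : Set γ) :
    ∑ ω, independentLaw P ω * (f ω * S.indicator 1 (ω k)) =
      (∑ ω, independentLaw P ω * f ω) * (P k).toOuterMeasure S := by
  rw [sum_independentLaw_resample P k, Finset.sum_mul]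
  refine Finset.sum_congr rfl fun ω _ => ?_
  rw [mul_assoc, ← sum_pmf_mul_indicator, Finset.mul_sum (a := f ω)]
  refine congrArg (independentLaw P ω * ·) (Finset.sum_congr rfl fun a _ => ?_)
  rw [Function.update_self, hf (Function.update ω k a) ω fun j hj => Function.update_of_ne hj _ _]
  ring

theorem sum_pmf_eq_one (P : PMF γ) : ∑ a, P a = 1 := by
  rw [← tsum_fintype (L := .unconditional γ)]
  exact P.tsum_coe

open Classical in
/-- The events `ω (key U) ∈ S U` are independent of the disjoint events `A U`, so the union of the
events `A U ∩ {ω (key U) ∈ S U}` is no more likely than the likeliest of the `S U`. -/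
theorem independentLaw_toOuterMeasure_le {κ : Type*} [Fintype κ] (P : ι → PMF γ) (key : κ → ι)
    {A : κ → Set (ι → γ)} {S : κ → Set γ} {E : Set (ι → γ)} {b : ℝ≥0∞}
    (hA : ∀ U ω ω', (∀ j ≠ key U, ω j = ω' j) → (ω ∈ A U ↔ ω' ∈ A U))
    (hdis : ∀ ω U U', ω ∈ A U → ω ∈ A U' → U = U')
    (hS : ∀ U ω, ω ∈ A U → (P (key U)).toOuterMeasure (S U) ≤ b)
    (hE : ∀ ω ∈ (independentLaw P).support, ω ∈ E → ∃ U, ω ∈ A U ∧ ω (key U) ∈ S U) :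
    (independentLaw P).toOuterMeasure E ≤ b := by
  set μ := independentLaw P with hμ
  have hA1 : ∀ ω, ∑ U, (A U).indicator (1 : (ι → γ) → ℝ≥0∞) ω ≤ 1 := by
    intro ω
    by_cases h : ∃ U, ω ∈ A U
    · obtain ⟨U, hU⟩ := h
      rw [Finset.sum_eq_single U]
      · simp [hU]
      · intro U' _ hne
        exact Set.indicator_of_notMem (fun hU' => hne (hdis ω _ _ hU' hU)) _
      · simp
    · push Not at h
      rw [Finset.sum_eq_zero fun U _ => Set.indicator_of_notMem (h U) _]
      exact zero_le
  have hcut : ∀ ω, μ ω * E.indicator 1 ω ≤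
      ∑ U, μ ω * ((A U).indicator 1 ω * (S U).indicator 1 (ω (key U))) := by
    intro ω
    by_cases hω : ω ∈ μ.support
    swap
    · rw [PMF.mem_support_iff, not_not] at hω
      simp [hω]
    rw [← Finset.mul_sum]
    gcongr
    by_cases hc : ω ∈ E
    swap
    · simp [hc]
    obtain ⟨U, h1, h2⟩ := hE ω hω hc
    refine le_trans ?_ (Finset.single_le_sum
      (f := fun U => (A U).indicator (1 : (ι → γ) → ℝ≥0∞) ω * (S U).indicator 1 (ω (key U)))
      (fun _ _ => zero_le) (Finset.mem_univ U))
    simp [hc, h1, h2]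
  rw [← sum_pmf_mul_indicator]
  calc _ ≤ ∑ ω, ∑ U, μ ω * ((A U).indicator 1 ω * (S U).indicator 1 (ω (key U))) :=
        Finset.sum_le_sum fun ω _ => hcut ω
    _ = ∑ U, (∑ ω, μ ω * (A U).indicator 1 ω) * (P (key U)).toOuterMeasure (S U) := by
        rw [Finset.sum_comm]
        refine Finset.sum_congr rfl fun U _ => ?_
        refine sum_independentLaw_mul_indicator P (key U) ?_ (S U)
        intro ω ω' h
        simp only [Set.indicator_apply, hA U ω ω' h, Pi.one_apply]
    _ ≤ ∑ U, (∑ ω, μ ω * (A U).indicator 1 ω) * b := by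
        refine Finset.sum_le_sum fun U _ => ?_
        by_cases hU : ∃ ω, ω ∈ A U
        · obtain ⟨ω, hω⟩ := hU
          exact mul_le_mul_right (hS U ω hω) _
        · push Not at hU
          rw [Finset.sum_eq_zero fun ω _ => by rw [Set.indicator_of_notMem (hU ω), mul_zero]]
          simp
    _ = (∑ ω, μ ω * ∑ U, (A U).indicator 1 ω) * b := by
        rw [← Finset.sum_mul, Finset.sum_comm]
        simp only [Finset.mul_sum]
    _ ≤ 1 * b := by
        gcongr
        rw [← sum_pmf_eq_one μ]
        exact Finset.sum_le_sum fun ω _ => mul_le_of_le_one_right zero_le (hA1 ω)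
    _ = b := one_mul _

/-- If a random variable is bounded by a constant plus a sum of multiples of indicators, then its
expectation is bounded in terms of the probabilities of the events. -/
theorem expectation_map_le {Ω Ω' κ : Type*} [Fintype Ω] (P : PMF Ω) (g : Ω → Ω') (X : Ω' → ℝ≥0∞)
    (s : Finset κ) (c b : κ → ℝ≥0∞) (E : κ → Set Ω) (c₀ : ℝ≥0∞)
    (hX : ∀ ω ∈ P.support, X (g ω) ≤ ∑ i ∈ s, c i * (E i).indicator 1 ω + c₀)
    (hb : ∀ i ∈ s, P.toOuterMeasure (E i) ≤ b i) :
    expectation (P.map g) X ≤ ∑ i ∈ s, c i * b i + c₀ := by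
  classical
  have hexp : expectation (P.map g) X = ∑ ω, P ω * X (g ω) := by
    simp only [expectation, PMF.map_apply, ← ENNReal.tsum_mul_right]
    rw [ENNReal.tsum_comm, tsum_fintype]
    refine Finset.sum_congr rfl fun ω _ => ?_
    rw [tsum_eq_single (g ω)]
    · simp
    · intro b hb
      simp [hb]
  rw [hexp]
  calc ∑ ω, P ω * X (g ω) ≤ ∑ ω, P ω * (∑ i ∈ s, c i * (E i).indicator 1 ω + c₀) := by
        refine Finset.sum_le_sum fun ω _ => ?_
        by_cases hω : ω ∈ P.support
        · exact mul_le_mul_right (hX ω hω) _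
        · rw [PMF.mem_support_iff, not_not] at hω
          simp [hω]
    _ = ∑ i ∈ s, c i * P.toOuterMeasure (E i) + c₀ := by
        simp only [mul_add, Finset.sum_add_distrib, Finset.mul_sum, ← Finset.sum_mul,
          sum_pmf_eq_one, one_mul, ← sum_pmf_mul_indicator]
        rw [Finset.sum_comm]
        congr 1
        refine Finset.sum_congr rfl fun i _ => Finset.sum_congr rfl fun ω _ => ?_
        ring
    _ ≤ _ := by
        gcongr with i hi
        exact hb i hi

end Independence

/-! ### The probability that an edge is first cut at a given level -/

section CutProbability

variable {G : LGraph α β} {t : ℕ} {d : ℕ → ℝ} {T₀ : Set β}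

theorem bartalLevels_congr {ω ω' : Fin t × Set α → Set β} {i : ℕ}
    (h : ∀ k : Fin t × Set α, (k.1 : ℕ) < i → ω k = ω' k) :
    bartalLevels G t T₀ ω i = bartalLevels G t T₀ ω' i := by
  induction i with
  | zero => rfl
  | succ i ih =>
    by_cases hi : i < t
    · rw [bartalLevels_succ hi, bartalLevels_succ hi, ih fun k hk => h k (by omega)]
      simp only [h (⟨i, hi⟩, _) (Nat.lt_succ_self i)]
    · rw [bartalLevels, bartalLevels, dif_neg hi, dif_neg hi]

/-- The edge with ends `x` and `y` is first cut at level `i`. -/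
def FirstCut (G : LGraph α β) (L : ℕ → Set β) (x y : α) (i : ℕ) : Prop :=
  Connects (G.restrictEdges (L i)).toGraph x y ∧
    ¬ Connects (G.restrictEdges (L (i + 1))).toGraph x y

/-- An edge is cut at level `i + 1` only by the call on the component of level `i` that contains
it, and that component is determined by the calls on the earlier levels. -/
theorem toOuterMeasure_firstCut_le {K : ℝ} (hK : 0 ≤ K) [Fintype α] [Fintype β]
    {P : LGraph α β → ℝ → PMF (Set β)} (hP : IsPartitionRoutine K P)
    (hpos : G.PosLen) {e : β} {x y : α} (hl : G.IsLink e x y) {i : ℕ} (hi : i < t)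
    (hd : ∀ j, 0 < d j) (hlen : G.len e < d (i + 1) / Real.log G.order) :
    (independentLaw fun k : Fin t × Set α =>
        P (callGraph G d k.1 k.2) (d (k.1 + 1))).toOuterMeasure
      {ω | FirstCut G (bartalLevels G t T₀ ω) x y i} ≤
      ENNReal.ofReal (K * G.len e * Real.log G.order / d (i + 1)) := by
  refine independentLaw_toOuterMeasure_le
    (fun k : Fin t × Set α => P (callGraph G d k.1 k.2) (d (k.1 + 1)))
    (key := fun U : Set α => ((⟨i, hi⟩, U) : Fin t × Set α))
    (A := fun U =>
      {ω | U ∈ components (G.restrictEdges (bartalLevels G t T₀ ω i)).toGraph ∧ x ∈ U ∧ y ∈ U})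
    (S := fun U => {F | ¬ Connects ((callGraph G d i U).restrictEdges F).toGraph x y}) ?_ ?_ ?_ ?_
  · intro U ω ω' h
    have : bartalLevels G t T₀ ω i = bartalLevels G t T₀ ω' i :=
      bartalLevels_congr fun k hk => h k fun hk' => by simp [hk'] at hk
    simp only [Set.mem_ofPred_eq, this]
  · intro ω U U' hU hU'
    exact components.eq_of_mem hU.1 hU'.1 hU.2.1 hU'.2.1
  · rintro U ω ⟨hU, hx, hy⟩
    have hUV : U ⊆ (G.restrictEdges (bartalLevels G t T₀ ω i)).vertexSet := components.subset hU
    have hpos' : (callGraph G d i U).PosLen := hpos.restrictEdges.inducedOn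
    refine ((hP _ _ hpos' (hd _)).2 e x y ⟨⟨hlen, hl⟩, hx, hy⟩).trans (ENNReal.ofReal_le_ofReal ?_)
    have hle := hpos e hl.edge_mem
    have hdi := hd (i + 1)
    have hUcard : 0 < U.ncard := (Set.ncard_pos (Set.toFinite U)).2 ⟨x, hx⟩
    have hlog : Real.log (callGraph G d i U).order ≤ Real.log G.order := by
      refine Real.log_le_log (by exact_mod_cast hUcard) ?_
      exact_mod_cast Set.ncard_le_ncard hUV (Set.toFinite _)
    change K * G.len e * _ / _ ≤ _
    gcongr
  · intro ω hω hc
    have hsub : ∀ k : Fin t × Set α, ω k ⊆ (callGraph G d k.1 k.2).edgeSet := fun k =>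
      ((hP _ _ hpos.restrictEdges.inducedOn
        (hd _)).1 _ (mem_support_of_mem_support_independentLaw hω k)).1
    have hU := component_mem_components hc.1.left_mem
    have hx := mem_component_self hc.1.left_mem
    refine ⟨_, ⟨hU, hx, hc.1⟩, ?_⟩
    rintro ⟨w, hw⟩
    exact hc.2 ⟨w, (isWalk_bartalLevels_succ hsub hi hU hx).2 hw⟩

end CutProbability

/-! ### The stretch of the decomposition -/

section Stretch

variable {p q : ℝ} {G : LGraph α β} {t : ℕ} {d' : ℕ → ℝ} {L : ℕ → Set β}

theorem exists_lt_and_not_succ {Q : ℕ → Prop} {t : ℕ} (h0 : Q 0) (ht : ¬ Q t) :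
    ∃ i < t, Q i ∧ ¬ Q (i + 1) := by
  by_contra! h
  have : ∀ i ≤ t, Q i := by
    intro i
    induction i with
    | zero => exact fun _ => h0
    | succ i ih => exact fun hi => h i hi (ih (by omega))
  exact ht (this t le_rfl)

/-- In `G` no edge is a loop, so every edge is cut eventually, and its `cutLevel` is not the junk
value of an infimum over the empty set. -/
theorem cutLevel_switchedLevels (hloop : G.toGraph.Loopless)
    (hrun : IsBartalRun (G.powLen (p / q)) t d' L) {e : β} {x y : α} (hl : G.IsLink e x y) :
    cutLevel G (switchedLevels p q G d' L) e < t ∧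
      FirstCut (G.powLen (p / q)) L x y (cutLevel G (switchedLevels p q G d' L) e) := by
  have hxy : y ≠ x := by
    rintro rfl
    exact hloop.not_isLoopAt _ _ hl
  have ht : ¬ Connects ((G.powLen (p / q)).restrictEdges (L t)).toGraph x y := by
    intro hc
    refine hxy (hc.induct (P := fun z => z = x) (fun e a b hl' _ => ?_) rfl)
    exact absurd hl'.1 (hrun.last_empty e hl'.2.edge_mem)
  obtain ⟨i, hi, h1, h2⟩ := exists_lt_and_not_succ
    (Q := fun i => Connects ((G.powLen (p / q)).restrictEdges (L i)).toGraph x y)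
    (hrun.isTree_zero.1.2 x hl.left_mem y hl.right_mem) ht
  have hmem : i ∈ {i | FirstCutAt G (switchedLevels p q G d' L) e i} := ⟨x, y, hl, h1, h2⟩
  refine ⟨(Nat.sInf_le hmem).trans_lt hi, ?_⟩
  obtain ⟨x', y', hl', h1', h2'⟩ := Nat.sInf_mem ⟨i, hmem⟩
  rcases hl.eq_and_eq_or_eq_and_eq hl' with ⟨rfl, rfl⟩ | ⟨rfl, rfl⟩
  · exact ⟨h1', h2'⟩
  · exact ⟨h1'.symm, fun h => h2' h.symm⟩

/-- The rescaled bound of level `i`, relative to the length of an edge, in terms of the bound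
`d' i / log n` on the lengths `l ^ (p / q)` of the edges of that level. -/
theorem switchBounds_div_rpow {n : ℕ} {l : ℝ} (hp : 0 < p) (hpq : p < q) (hlog : 0 < Real.log n)
    (hl : 0 < l) {i : ℕ} (hd : 0 < d' i) :
    (switchBounds 1 p q n d' i / l) ^ p =
      (1 / (q - p) * Real.log n) ^ p * (d' i / Real.log n / l ^ (p / q)) ^ q := by
  have hqp : 0 < q - p := sub_pos.2 hpq
  have hr : 0 < d' i / Real.log n := by positivity
  set r := d' i / Real.log n with hr_def
  have hm : 0 < l ^ (p / q) := by positivity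
  have hd_eq : d' i = r * Real.log n := by rw [hr_def]; field_simp
  have h1 : switchBounds 1 p q n d' i / l =
      (1 / (q - p) * Real.log n) * (r / l ^ (p / q)) ^ (q / p) := by
    conv_lhs => rw [rpow_split hp hpq hl]
    have : q / p = (q - p) / p + 1 := by field_simp; ring
    rw [this, Real.rpow_add_one (by positivity), Real.div_rpow hr.le hm.le, switchBounds,
      switchFactor, ← hr_def, hd_eq]
    field_simp
  rw [h1, Real.mul_rpow (by positivity) (by positivity), ← Real.rpow_mul (by positivity),
    div_mul_cancel₀ _ hp.ne']

/-- The contributions of the levels at which an edge may be cut by the partition routine. -/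
theorem sum_stretch_le {n : ℕ} {l K : ℝ} (hp : 0 < p) (hpq : p < q) (hq1 : q < 1) (hK : 0 ≤ K)
    (hlog : 0 < Real.log n) (hl : 0 < l) (hd0 : 0 < d' 0) (hd : ∀ i, d' i = d' 0 / 4 ^ i) :
    ∑ i ∈ Finset.range t with l ^ (p / q) < d' (i + 1) / Real.log n,
        (switchBounds 1 p q n d' i / l) ^ p * (K * l ^ (p / q) * Real.log n / d' (i + 1)) ≤
      (1 / (q - p) * Real.log n) ^ p * (4 * K * ((1 + (1 - q)) / (1 - q))) := by
  have hqp : 0 < q - p := sub_pos.2 hpq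
  set m := l ^ (p / q) with hm_def
  have hm : 0 < m := by positivity
  set A := (1 / (q - p) * Real.log n) ^ p
  have hA : 0 < A := by positivity
  rw [Finset.sum_filter]
  calc _ ≤ ∑ i ∈ Finset.range t, A * (4 * K) *
        (if m * Real.log n / d' 0 * 4 ^ i ≤ 1 then (m * Real.log n / d' 0 * 4 ^ i) ^ (1 - q)
          else 0) := by
        refine Finset.sum_le_sum fun i _ => ?_
        have hdi : 0 < d' i := by rw [hd]; positivity
        have hdi' : d' (i + 1) = d' i / 4 := by rw [hd, hd i, pow_succ]; field_simp
        have hy : m * Real.log n / d' 0 * 4 ^ i = m / (d' i / Real.log n) := by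
          rw [hd i]
          field_simp
        rw [hy]
        have hr : 0 < d' i / Real.log n := by positivity
        have hr' : d' (i + 1) / Real.log n = d' i / Real.log n / 4 := by rw [hdi']; ring
        by_cases h : m < d' (i + 1) / Real.log n
        · rw [if_pos h, if_pos (by rw [div_le_one hr]; linarith),
            switchBounds_div_rpow hp hpq hlog hl hdi, ← hm_def]
          refine le_of_eq ?_
          have h2 : K * m * Real.log n / d' (i + 1) = 4 * K * (m / (d' i / Real.log n)) := by
            rw [hdi']
            field_simp
          rw [h2, ← inv_div (d' i / Real.log n) m, Real.inv_rpow (by positivity),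
            ← Real.rpow_neg (by positivity), neg_sub, Real.rpow_sub_one (by positivity)]
          ring
        · rw [if_neg h]
          split_ifs <;> positivity
    _ ≤ A * (4 * K) * ((1 + (1 - q)) / (1 - q)) := by
        rw [← Finset.mul_sum]
        gcongr
        exact sum_geometric_le (by linarith) (by positivity) t
    _ = _ := by ring

theorem embeddableDecompose_eq [Fintype α] [Fintype β] (P : LGraph α β → ℝ → PMF (Set β))
    (T₀ : Set β) : embeddableDecompose 1 p q (decomposeSimple P T₀ t d') d' G =
      (independentLaw fun k : Fin t × Set α =>
        P (callGraph (G.powLen (p / q)) d' k.1 k.2) (d' (k.1 + 1))).map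
        fun ω => switchedLevels p q G d' (bartalLevels (G.powLen (p / q)) t T₀ ω) := by
  rw [embeddableDecompose, decomposeSimple, PMF.map_comp]
  rfl

/-- A level `i` contributes at most `(d i / l) ^ p` times the probability of a cut, which is at most
`K * m * log n / d' (i + 1)`, where `m = l ^ (p / q)`. As `(d i / l) ^ p` grows only like
`(d' i) ^ q` with `q < 1`, these contributions form a geometric series, dominated by the lowest
level on which the edge is short enough to be kept. -/
theorem expectation_decompStretch_le [Fintype α] [Fintype β] {K : ℝ} (hK : 0 ≤ K)
    {P : LGraph α β → ℝ → PMF (Set β)} (hP : IsPartitionRoutine K P) {T₀ : Set β}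
    (hp : 0 < p) (hp1 : p < 1) (hq : q = (1 + p) / 2) (hloop : G.toGraph.Loopless)
    (hlog : 0 < Real.log G.order) (hlen : ∀ e ∈ G.edgeSet, 1 ≤ G.len e) (hd0 : 0 < d' 0)
    (hd : ∀ i, d' i = d' 0 / 4 ^ i)
    (hrun : ∀ ω ∈ (independentLaw fun k : Fin t × Set α =>
        P (callGraph (G.powLen (p / q)) d' k.1 k.2) (d' (k.1 + 1))).support,
      IsBartalRun (G.powLen (p / q)) t d' (bartalLevels (G.powLen (p / q)) t T₀ ω))
    {e : β} (he : e ∈ G.edgeSet) :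
    expectation (embeddableDecompose 1 p q (decomposeSimple P T₀ t d') d' G)
        (fun B => ENNReal.ofReal (decompStretch p G (switchBounds 1 p q G.order d') B e)) ≤
      ENNReal.ofReal ((32 * K + 8) * (1 / (1 - p)) ^ 2 * Real.log G.order ^ p) := by
  have hpq : p < q := by linarith
  have hq1 : q < 1 := by linarith
  have hqp : 0 < q - p := sub_pos.2 hpq
  have hdpos : ∀ i, 0 < d' i := fun i => by rw [hd]; positivity
  have hl1 := hlen e he
  have hl0 : 0 < G.len e := zero_lt_one.trans_le hl1
  obtain ⟨x, y, hl⟩ := Graph.exists_isLink_of_mem_edgeSet he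
  set A := (1 / (q - p) * Real.log G.order) ^ p with hA_def
  have hA : 0 < A := by positivity
  have hpos : (G.powLen (p / q)).PosLen := fun f hf =>
    Real.rpow_pos_of_pos (zero_lt_one.trans_le (hlen f hf)) _
  have hc0 : ∀ i, 0 ≤ (switchBounds 1 p q G.order d' i / G.len e) ^ p := by
    intro i
    have := hdpos i
    have := switchFactor_pos (i := i) (d' := d') (n := G.order) hpq (by positivity)
    rw [switchBounds]
    positivity
  rw [embeddableDecompose_eq]
  refine (expectation_map_le _ _ _
    ((Finset.range t).filter fun i => G.len e ^ (p / q) < d' (i + 1) / Real.log G.order)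
    (fun i => ENNReal.ofReal ((switchBounds 1 p q G.order d' i / G.len e) ^ p))
    (fun i => ENNReal.ofReal (K * G.len e ^ (p / q) * Real.log G.order / d' (i + 1)))
    (fun i => {ω | FirstCut (G.powLen (p / q)) (bartalLevels (G.powLen (p / q)) t T₀ ω) x y i})
    (ENNReal.ofReal (A * 4)) ?_ ?_).trans ?_
  · intro ω hω
    obtain ⟨hi, hcut⟩ := cutLevel_switchedLevels hloop (hrun ω hω) hl
    rw [decompStretch]
    set i := cutLevel G
      (switchedLevels p q G d' (bartalLevels (G.powLen (p / q)) t T₀ ω)) e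
    by_cases hgood : G.len e ^ (p / q) < d' (i + 1) / Real.log G.order
    · refine le_add_right ?_
      refine le_trans ?_ (Finset.single_le_sum (fun _ _ => zero_le)
        (Finset.mem_filter.2 ⟨Finset.mem_range.2 hi, hgood⟩))
      rw [Set.indicator_of_mem (by exact hcut)]
      simp
    · -- an edge too long for level `i + 1` may well be cut there, but then `d i` is not much
      -- larger than the edge
      refine le_add_left (ENNReal.ofReal_le_ofReal ?_)
      rw [switchBounds_div_rpow hp hpq hlog hl0 (hdpos i)]
      have hdi' : d' (i + 1) = d' i / 4 := by rw [hd, hd i, pow_succ]; field_simp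
      have hdi := hdpos i
      have h4 : d' i / Real.log G.order / G.len e ^ (p / q) ≤ 4 := by
        rw [div_le_iff₀ (by positivity)]
        rw [hdi', not_lt, div_div, mul_comm (4 : ℝ), ← div_div] at hgood
        linarith
      have hq0 : 0 < q := hp.trans hpq
      gcongr
      calc _ ≤ (4 : ℝ) ^ q := by gcongr
        _ ≤ 4 ^ (1 : ℝ) := Real.rpow_le_rpow_of_exponent_le (by norm_num) hq1.le
        _ = 4 := Real.rpow_one _
  · intro i hi
    obtain ⟨hi, hgood⟩ := Finset.mem_filter.1 hi
    exact toOuterMeasure_firstCut_le hK hP hpos (G := G.powLen (p / q)) hl (Finset.mem_range.1 hi)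
      hdpos hgood
  · simp only [← ENNReal.ofReal_mul (hc0 _)]
    rw [← ENNReal.ofReal_sum_of_nonneg, ← ENNReal.ofReal_add]
    · refine ENNReal.ofReal_le_ofReal ?_
      refine (add_le_add (sum_stretch_le hp hpq hq1 hK hlog hl0 hd0 hd) le_rfl).trans ?_
      have hs : 0 < 1 - p := by linarith
      have e1 : q - p = (1 - p) / 2 := by rw [hq]; ring
      have e2 : 1 - q = (1 - p) / 2 := by rw [hq]; ring
      have hA_le : A ≤ 2 / (1 - p) * Real.log G.order ^ p := by
        rw [hA_def, Real.mul_rpow (by positivity) hlog.le]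
        gcongr
        have : 1 / (q - p) = 2 / (1 - p) := by rw [e1]; field_simp
        rw [this]
        calc (2 / (1 - p)) ^ p ≤ (2 / (1 - p)) ^ (1 : ℝ) :=
              Real.rpow_le_rpow_of_exponent_le (by rw [le_div_iff₀ hs]; linarith) hp1.le
          _ = _ := Real.rpow_one _
      have h2 : (1 + (1 - q)) / (1 - q) ≤ 4 / (1 - p) := by
        rw [e2, div_le_div_iff₀ (by positivity) hs]
        nlinarith
      have h3 : 4 ≤ 4 / (1 - p) := by
        rw [le_div_iff₀ hs]
        linarith
      calc A * (4 * K * ((1 + (1 - q)) / (1 - q))) + A * 4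
          ≤ A * (4 * K * (4 / (1 - p))) + A * (4 / (1 - p)) := by gcongr
        _ = A * ((16 * K + 4) / (1 - p)) := by ring
        _ ≤ (2 / (1 - p) * Real.log G.order ^ p) * ((16 * K + 4) / (1 - p)) := by gcongr
        _ = _ := by field_simp; ring
    · refine Finset.sum_nonneg fun i _ => mul_nonneg (hc0 i) ?_
      have := hdpos (i + 1)
      positivity
    · positivity
    · intro i _
      have := hdpos (i + 1)
      exact mul_nonneg (hc0 i) (by positivity)

/-- Whatever the partition routine returns, the levels have the required properties. -/
theorem isBartalRun_of_mem_support [Fintype α] [Fintype β] {K Δ : ℝ}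
    {P : LGraph α β → ℝ → PMF (Set β)} (hP : IsPartitionRoutine K P) {T₀ : Set β} {r : α}
    (hp : 0 < p) (hpq : p < q) (hloop : G.toGraph.Loopless) (hn : 2 ≤ G.order)
    (hlen : ∀ e ∈ G.edgeSet, 1 ≤ G.len e ∧ G.len e ≤ Δ) (hΔ : 1 ≤ Δ)
    (hdt : bartalBounds G.order Δ t < 1)
    (hT₀ : IsShortestPathTree ((G.powLen (p / q)).restrictEdges T₀) (G.powLen (p / q)) r)
    {ω : Fin t × Set α → Set β}
    (hω : ω ∈ (independentLaw fun k : Fin t × Set α =>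
      P (callGraph (G.powLen (p / q)) (bartalBounds G.order Δ) k.1 k.2)
        (bartalBounds G.order Δ (k.1 + 1))).support) :
    IsBartalRun (G.powLen (p / q)) t (bartalBounds G.order Δ)
      (bartalLevels (G.powLen (p / q)) t T₀ ω) := by
  have hq : 0 < q := hp.trans hpq
  have hn' : (2 : ℝ) ≤ G.order := by exact_mod_cast hn
  have hlog : 0 < Real.log G.order := Real.log_pos (by linarith)
  have hd0 : bartalBounds G.order Δ 0 = 2 * G.order * Δ := by simp [bartalBounds]
  have hdpos : ∀ i, 0 < bartalBounds G.order Δ i := fun i => by rw [bartalBounds]; positivity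
  have hone : ∀ e ∈ G.edgeSet, 1 ≤ (G.powLen (p / q)).len e := fun e he =>
    Real.one_le_rpow (hlen e he).1 (by positivity)
  have hleΔ : ∀ e ∈ G.edgeSet, (G.powLen (p / q)).len e ≤ Δ := fun e he =>
    calc G.len e ^ (p / q) ≤ G.len e ^ (1 : ℝ) :=
          Real.rpow_le_rpow_of_exponent_le (hlen e he).1 ((div_le_one hq).2 hpq.le)
      _ ≤ Δ := by rw [Real.rpow_one]; exact (hlen e he).2
  have hpos : (G.powLen (p / q)).PosLen := fun f hf => zero_lt_one.trans_le (hone f hf)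
  refine isBartalRun_bartalLevels hloop hone ?_ hdt hT₀.2.2.2.2.1 ?_ ?_ ?_
  · rw [pos_iff_ne_zero]
    rintro rfl
    rw [hd0] at hdt
    nlinarith
  · intro x hx y hy
    refine (dist_le_order_mul (T := (G.powLen (p / q)).restrictEdges T₀) (Δ := Δ) (by linarith)
      (fun e he => hleΔ e he.1)
      (hT₀.2.2.2.2.1.1.2 x hx y hy)).trans (ENNReal.ofReal_le_ofReal ?_)
    rw [hd0]
    change (G.order : ℝ) * Δ ≤ _
    nlinarith
  · intro e he
    refine (hleΔ e he).trans ?_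
    change Δ ≤ _ / Real.log G.order
    rw [le_div_iff₀ hlog, hd0, mul_comm]
    have : Real.log G.order ≤ G.order :=
      (Real.log_le_sub_one_of_pos (by linarith)).trans (by linarith)
    nlinarith
  · intro k
    exact (hP _ _ hpos.restrictEdges.inducedOn (hdpos _)).1 _
      (mem_support_of_mem_support_independentLaw hω k)

end Stretch

/-! ### Centers -/

section Centers

variable {G : LGraph α β} {t : ℕ} {B : ℕ → LGraph α β} {Z : ℕ → Set α}

/-- The least vertices of the components, for a fixed order of the vertices, are centers: the least
vertex of a component is also the least vertex of its component at the next level. -/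
theorem IsBartalDecomposition.exists_isCenterChoice [Finite α] (hB : IsBartalDecomposition G t B) :
    ∃ Z, IsCenterChoice t B Z := by
  obtain ⟨n, ⟨f⟩⟩ := Finite.exists_equiv_fin α
  refine ⟨fun i => {z | z ∈ (B i).vertexSet ∧ ∀ x, Connects (B i).toGraph z x → f z ≤ f x},
    fun i _ z hz => hz.1, fun i _ U hU => ?_, fun i hi z hz => ?_⟩
  · obtain ⟨z, hz, hmin⟩ := Set.exists_min_image U f (Set.toFinite _) (components.nonempty hU)
    refine ⟨z, ⟨⟨components.subset hU hz,
      fun x hx => hmin x (components.mem_of_connects hU hz hx)⟩, hz⟩, ?_⟩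
    rintro z' ⟨hz'1, hz'2⟩
    exact f.injective (le_antisymm (hz'1.2 z (components.connects hU hz'2 hz)) (hmin z' hz'2))
  · refine ⟨?_, fun x hx => hz.2 x (hB.laminar i hi _ _ hx)⟩
    rw [hB.vertexSet_eq (i + 1) (by omega), ← hB.vertexSet_eq i hi.le]
    exact hz.1

open Classical in
/-- The center of the component of `x` at level `i`. -/
noncomputable def center (B : ℕ → LGraph α β) (Z : ℕ → Set α) (i : ℕ) (x : α) : α :=
  if h : ∃ z ∈ Z i, Connects (B i).toGraph x z then h.choose else x

variable (hB : IsBartalDecomposition G t B) (hZ : IsCenterChoice t B Z)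

include hZ

theorem IsCenterChoice.center_spec {i : ℕ} (hi : i ≤ t) {x : α} (hx : x ∈ (B i).vertexSet) :
    center B Z i x ∈ Z i ∧ Connects (B i).toGraph x (center B Z i x) := by
  have h : ∃ z ∈ Z i, Connects (B i).toGraph x z := by
    obtain ⟨z, ⟨h1, h2⟩, -⟩ := hZ.unique i hi _ (component_mem_components hx)
    exact ⟨z, h1, h2⟩
  rw [center, dif_pos h]
  exact h.choose_spec

theorem IsCenterChoice.center_eq {i : ℕ} (hi : i ≤ t) {x z : α} (hz : z ∈ Z i)
    (h : Connects (B i).toGraph x z) : center B Z i x = z := by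
  have hc := hZ.center_spec hi h.left_mem
  exact (hZ.unique i hi _ (component_mem_components h.left_mem)).unique hc ⟨hz, h⟩

theorem IsCenterChoice.center_congr {i : ℕ} (hi : i ≤ t) {x y : α}
    (h : Connects (B i).toGraph x y) : center B Z i x = center B Z i y :=
  have hc := hZ.center_spec hi h.right_mem
  hZ.center_eq hi hc.1 (h.trans hc.2)

theorem IsCenterChoice.center_self {i : ℕ} (hi : i ≤ t) {x : α} (hx : x ∈ Z i) :
    center B Z i x = x :=
  hZ.center_eq hi hx (.refl (hZ.mem i hi hx))

theorem IsCenterChoice.mono_of_le {i j : ℕ} (hij : i ≤ j) (hj : j ≤ t) : Z i ⊆ Z j := by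
  induction j, hij using Nat.le_induction with
  | base => exact subset_rfl
  | succ j hij ih => exact (ih (by omega)).trans (hZ.mono j (by omega))

omit hZ
include hB

theorem IsBartalDecomposition.connects_of_le {i j : ℕ} (hij : i ≤ j) (hj : j ≤ t) {x y : α}
    (h : Connects (B j).toGraph x y) : Connects (B i).toGraph x y := by
  induction j, hij using Nat.le_induction with
  | base => exact h
  | succ j hij ih => exact ih (by omega) (hB.laminar j (by omega) _ _ h)

theorem IsBartalDecomposition.eq_of_connects_last {x y : α}
    (h : Connects (B t).toGraph x y) : x = y := by
  refine h.induct (P := fun z => x = z) (fun e a b hl _ => ?_) rfl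
  have := hl.edge_mem
  rw [hB.last_empty] at this
  exact absurd this (Set.notMem_empty e)

theorem IsBartalDecomposition.posLen (hpos : G.PosLen) {i : ℕ} (hi : i ≤ t) : (B i).PosLen :=
  fun e he => (hpos e ((hB.subgraph i hi).1.edgeSet_mono he)).trans_le ((hB.subgraph i hi).2 e he)

theorem IsBartalDecomposition.center_last (hZ : IsCenterChoice t B Z) {x : α}
    (hx : x ∈ G.vertexSet) : center B Z t x = x :=
  (hB.eq_of_connects_last (hZ.center_spec le_rfl (by rwa [hB.vertexSet_eq t le_rfl])).2).symm

end Centers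

/-! ### The Steiner tree of a decomposition -/

section BuildTree

theorem LGraph.dist_map_le {G : LGraph α β} {K : LGraph α' β'} (f : α → α') (g : β → β')
    (hV : ∀ x ∈ G.vertexSet, f x ∈ K.vertexSet)
    (hL : ∀ e x y, G.IsLink e x y → K.IsLink (g e) (f x) (f y))
    (hlen : ∀ e, K.len (g e) = G.len e) (x y : α) : K.dist (f x) (f y) ≤ G.dist x y := by
  refine LGraph.le_dist fun w hw => ?_
  suffices h : ∃ W, IsWalk K.toGraph (f x) W (f y) ∧ K.walkLen W = G.walkLen w by
    obtain ⟨W, hW, hlen⟩ := h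
    exact hlen ▸ hW.dist_le
  induction hw with
  | nil hu => exact ⟨[], .nil (hV _ hu), rfl⟩
  | cons hl _ ih =>
    obtain ⟨W, hW, h⟩ := ih
    exact ⟨_, .cons (hL _ _ _ hl) hW, by simp [h, hlen]⟩

variable {G : LGraph α β} {t : ℕ} {B : ℕ → LGraph α β} {Z : ℕ → Set α}
  {R : LGraph α β → Set α → LGraph α (Sym2 α)}

/-- The small tree, on vertices of `G`, that replaces the tree of `B i` on the component `U`. -/
def piece (R : LGraph α β → Set α → LGraph α (Sym2 α)) (B : ℕ → LGraph α β) (Z : ℕ → Set α)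
    (i : ℕ) (U : Set α) : LGraph α (Sym2 α) :=
  R ((B i).inducedOn U) (Z (i + 1) ∩ U)

theorem steinerVertex_of_mem {i : Fin t} {x : α} (hx : x ∈ Z (i + 1)) :
    steinerVertex t Z i x = Sum.inl x := if_pos hx

theorem steinerVertex_of_notMem {i : Fin t} {x : α} (hx : x ∉ Z (i + 1)) :
    steinerVertex t Z i x = Sum.inr (i, x) := if_neg hx

theorem buildTree_isLink
    {f : {k : Fin t × Set α // k.2 ∈ components (B k.1).toGraph} × Sym2 α}
    {a b : α ⊕ (Fin t × α)} : (buildTree R t B Z).IsLink f a b ↔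
      ∃ x y, (piece R B Z f.1.1.1 f.1.1.2).IsLink f.2 x y ∧
        steinerVertex t Z f.1.1.1 x = a ∧ steinerVertex t Z f.1.1.1 y = b := Iff.rfl

theorem mem_vertexSet_buildTree {a : α ⊕ (Fin t × α)} : a ∈ (buildTree R t B Z).vertexSet ↔
    ∃ (i : Fin t) (U : Set α), U ∈ components (B i).toGraph ∧
      ∃ x ∈ (piece R B Z i U).vertexSet, steinerVertex t Z i x = a := by
  constructor
  · intro h
    obtain ⟨⟨⟨i, U⟩, hU⟩, x, hx, rfl⟩ := Set.mem_iUnion.1 h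
    exact ⟨i, U, hU, x, hx, rfl⟩
  · rintro ⟨i, U, hU, x, hx, rfl⟩
    exact Set.mem_iUnion.2 ⟨⟨(i, U), hU⟩, x, hx, rfl⟩

variable [Finite α] (hB : IsBartalDecomposition G t B) (hZ : IsCenterChoice t B Z)
  (hR : IsTreeReduction R) (hpos : G.PosLen)

include hB hZ hR hpos

theorem piece_spec (i : Fin t) {U : Set α} (hU : U ∈ components (B i).toGraph) :
    IsTree (piece R B Z i U).toGraph ∧ Z (i + 1) ∩ U ⊆ (piece R B Z i U).vertexSet ∧
      (piece R B Z i U).vertexSet ⊆ U ∧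
      (∀ x ∈ Z (i + 1) ∩ U, ∀ y ∈ Z (i + 1) ∩ U,
        (piece R B Z i U).dist x y = (B i).dist x y) ∧
      ∃ φ : PathEmbedding (piece R B Z i U) ((B i).inducedOn U),
        ∀ x ∈ (piece R B Z i U).vertexSet, φ.π x = x := by
  have hi : (i : ℕ) ≤ t := i.2.le
  obtain ⟨u, hu⟩ := components.nonempty hU
  have hc := hZ.center_spec hi (components.subset hU hu)
  obtain ⟨h1, h2, -, h3, φ, hφ⟩ := hR ((B i).inducedOn U) (Z (i + 1) ∩ U)
    (hB.posLen hpos hi).inducedOn ((hB.forest i hi).isTree_inducedOn hU)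
    ⟨_, hZ.mono i i.2 hc.1, components.mem_of_connects hU hu hc.2⟩ Set.inter_subset_right
  refine ⟨h1, h2, fun x hx => ?_, fun x hx y hy => ?_, φ, hφ⟩
  · have := φ.π_mem x hx
    rwa [hφ x hx] at this
  · rw [← components.dist_inducedOn hU hx.2]
    exact h3 x hx y hy

omit hB hZ hR hpos [Finite α] in
theorem dist_buildTree_le_piece (i : Fin t) {U : Set α} (hU : U ∈ components (B i).toGraph)
    (x y : α) : (buildTree R t B Z).dist (steinerVertex t Z i x) (steinerVertex t Z i y) ≤
      (piece R B Z i U).dist x y :=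
  LGraph.dist_map_le (steinerVertex t Z i) (fun f => (⟨(i, U), hU⟩, f))
    (fun x hx => mem_vertexSet_buildTree.2 ⟨i, U, hU, x, hx, rfl⟩)
    (fun _ x y hl => buildTree_isLink.2 ⟨x, y, hl, rfl, rfl⟩) (fun _ => rfl) x y

theorem inl_mem_buildTree (ht : 0 < t) {x : α} (hx : x ∈ G.vertexSet) :
    Sum.inl x ∈ (buildTree R t B Z).vertexSet := by
  obtain ⟨i, rfl⟩ : ∃ i, t = i + 1 := ⟨t - 1, by omega⟩
  have hxZ : x ∈ Z (i + 1) := by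
    have := (hZ.center_spec le_rfl (by rwa [hB.vertexSet_eq _ le_rfl] : x ∈ _)).1
    rwa [hB.center_last hZ hx] at this
  have hxB : x ∈ (B i).vertexSet := by rwa [hB.vertexSet_eq i (by omega)]
  have hU := component_mem_components hxB
  refine mem_vertexSet_buildTree.2 ⟨⟨i, by omega⟩, _, hU, x, ?_, steinerVertex_of_mem hxZ⟩
  exact (piece_spec hB hZ hR hpos ⟨i, by omega⟩ hU).2.1 ⟨hxZ, mem_component_self hxB⟩

/-- The distances in the Steiner tree from a vertex to the centers of its components are bounded by
a geometric sum of diameters. -/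
theorem dist_center_le (ht : 0 < t) {d : ℕ → ℝ} (hd : BoundsDiameter (1 / 4) G t d B) {x : α}
    (hx : x ∈ G.vertexSet) {i : ℕ} (hi : i ≤ t) :
    (buildTree R t B Z).dist (Sum.inl x) (Sum.inl (center B Z i x)) ≤
      ENNReal.ofReal (4 / 3 * d i) := by
  induction hi using Nat.decreasingInduction with
  | self =>
    rw [hB.center_last hZ hx, LGraph.dist_self (inl_mem_buildTree hB hZ hR hpos ht hx)]
    exact zero_le
  | of_succ i hi ih =>
    have hV : ∀ j ≤ t, x ∈ (B j).vertexSet := fun j hj => by rwa [hB.vertexSet_eq j hj]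
    have hc := hZ.center_spec hi (hV (i + 1) hi)
    have hc' := hZ.center_spec hi.le (hV i hi.le)
    set z := center B Z (i + 1) x
    set z' := center B Z i x
    have hzz' : Connects (B i).toGraph z z' := (hB.laminar i hi _ _ hc.2).symm.trans hc'.2
    have hU := component_mem_components hzz'.left_mem
    have h1 : (buildTree R t B Z).dist (Sum.inl z) (Sum.inl z') ≤ ENNReal.ofReal (d i) := by
      have hz' : z' ∈ Z (i + 1) := hZ.mono i hi hc'.1
      have := dist_buildTree_le_piece (R := R) (Z := Z) ⟨i, hi⟩ hU z z'
      rw [steinerVertex_of_mem hc.1, steinerVertex_of_mem hz',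
        (piece_spec hB hZ hR hpos ⟨i, hi⟩ hU).2.2.2.1 z ⟨hc.1, mem_component_self hzz'.left_mem⟩ z'
          ⟨hz', hzz'⟩] at this
      exact this.trans (hd.diam i hi.le z z' hzz')
    refine ((buildTree R t B Z).dist_triangle _ (Sum.inl z) _).trans ((add_le_add ih h1).trans ?_)
    have h2 := hd.pos (i + 1) hi
    have h3 := hd.pos i hi.le
    rw [← ENNReal.ofReal_add (by positivity) h3.le]
    refine ENNReal.ofReal_le_ofReal ?_
    linarith [hd.geometric i hi]

theorem dist_buildTree_le (ht : 0 < t) {d : ℕ → ℝ} (hd : BoundsDiameter (1 / 4) G t d B) {i : ℕ}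
    (hi : i ≤ t) {x y : α} (h : Connects (B i).toGraph x y) :
    (buildTree R t B Z).dist (Sum.inl x) (Sum.inl y) ≤ ENNReal.ofReal (3 * d i) := by
  have hV := hB.vertexSet_eq i hi
  have h1 := dist_center_le hB hZ hR hpos ht hd (hV ▸ h.left_mem) hi
  have h2 := dist_center_le hB hZ hR hpos ht hd (hV ▸ h.right_mem) hi
  rw [← hZ.center_congr hi h, LGraph.dist_comm] at h2
  refine (LGraph.dist_triangle _ _ _).trans ((add_le_add h1 h2).trans ?_)
  have := hd.pos i hi
  rw [← ENNReal.ofReal_add (by positivity) (by positivity)]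
  exact ENNReal.ofReal_le_ofReal (by linarith)

theorem isConnected_buildTree (ht : 0 < t) {d : ℕ → ℝ} (hd : BoundsDiameter (1 / 4) G t d B) :
    IsConnected (buildTree R t B Z).toGraph := by
  obtain ⟨r, hr⟩ := hB.spanning.1.1
  have hV : ∀ i ≤ t, (B i).vertexSet = G.vertexSet := hB.vertexSet_eq
  have hr' : r ∈ G.vertexSet := hV 0 (by omega) ▸ hr
  have hinl : ∀ x ∈ G.vertexSet, Connects (buildTree R t B Z).toGraph (Sum.inl r) (Sum.inl x) :=
    fun x hx => LGraph.connects_of_dist_lt_top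
      ((dist_buildTree_le hB hZ hR hpos ht hd (i := 0) (by omega)
        (hB.spanning.1.2 r hr x ((hV 0 (by omega)).symm ▸ hx))).trans_lt ENNReal.ofReal_lt_top)
  refine isConnected_of_forall_connects (inl_mem_buildTree hB hZ hR hpos ht hr') fun a ha => ?_
  obtain ⟨i, U, hU, x, hx, rfl⟩ := mem_vertexSet_buildTree.1 ha
  obtain ⟨hT, hS, hVU, -⟩ := piece_spec hB hZ hR hpos i hU
  have hxB : x ∈ (B i).vertexSet := components.subset hU (hVU hx)
  have hc := hZ.center_spec i.2.le hxB
  have hcZ := hZ.mono i i.2 hc.1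
  have hcU := components.mem_of_connects hU (hVU hx) hc.2
  refine (hinl (center B Z i x) (hV i i.2.le ▸ hc.2.right_mem)).trans ?_
  rw [← steinerVertex_of_mem (i := i) hcZ]
  refine LGraph.connects_of_dist_lt_top
    ((dist_buildTree_le_piece i hU _ _).trans_lt (Connects.dist_lt_top ?_))
  exact hT.1.2 _ (hS ⟨hcZ, hcU⟩) x hx

omit hB hZ hR hpos [Finite α] in
open Classical in
/-- The retraction of the Steiner tree onto the piece of the component `U` of level `i`, whose
center is `z`: every other piece is mapped to the center through which it is attached. -/
noncomputable def retraction (t : ℕ) (B : ℕ → LGraph α β) (Z : ℕ → Set α) (i : ℕ) (U : Set α)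
    (z : α) : α ⊕ (Fin t × α) → α
  | Sum.inl x => if x ∈ U then center B Z (i + 1) x else z
  | Sum.inr (j, x) => if (j : ℕ) < i then z else
      if x ∈ U then (if (j : ℕ) = i then x else center B Z (i + 1) x) else z

omit [Finite α] hB hR hpos in
theorem retraction_self (i : Fin t) {U : Set α} {z x : α} (hx : x ∈ U) :
    retraction t B Z i U z (steinerVertex t Z i x) = x := by
  by_cases hxZ : x ∈ Z (i + 1)
  · rw [steinerVertex_of_mem hxZ, retraction, if_pos hx, hZ.center_self i.2 hxZ]
  · rw [steinerVertex_of_notMem hxZ, retraction, if_neg (lt_irrefl _), if_pos hx, if_pos rfl]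

omit [Finite α] hR hpos in
open Classical in
/-- The retraction is constant on every other piece. -/
theorem retraction_eq (i : Fin t) {U : Set α} (hU : U ∈ components (B i).toGraph) {z : α}
    (hz : z ∈ Z i) (hzU : z ∈ U) (j : Fin t) {U' : Set α} (hU' : U' ∈ components (B j).toGraph)
    (hne : ¬ (j = i ∧ U' = U)) {x y : α} (hx : x ∈ U') (hy : y ∈ U') :
    retraction t B Z i U z (steinerVertex t Z j x) =
      retraction t B Z i U z (steinerVertex t Z j y) := by
  have hxy := components.connects hU' hx hy
  rcases lt_trichotomy (j : ℕ) i with hji | hji | hji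
  · have key : ∀ x, retraction t B Z i U z (steinerVertex t Z j x) = z := by
      intro x
      by_cases hxZ : x ∈ Z (j + 1)
      · rw [steinerVertex_of_mem hxZ, retraction]
        split_ifs with hxU
        · have hxi : x ∈ Z i := hZ.mono_of_le hji i.2.le hxZ
          rw [hZ.center_self i.2 (hZ.mono i i.2 hxi)]
          exact (hZ.unique i i.2.le U hU).unique ⟨hxi, hxU⟩ ⟨hz, hzU⟩
        · rfl
      · rw [steinerVertex_of_notMem hxZ, retraction, if_pos hji]
    rw [key, key]
  · obtain rfl : j = i := Fin.ext hji
    have hnot : ∀ x ∈ U', x ∉ U := fun x hx hxU =>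
      hne ⟨rfl, components.eq_of_mem hU' hU hx hxU⟩
    have key : ∀ x ∈ U', retraction t B Z j U z (steinerVertex t Z j x) = z := by
      intro x hx
      by_cases hxZ : x ∈ Z (j + 1)
      · rw [steinerVertex_of_mem hxZ, retraction, if_neg (hnot x hx)]
      · rw [steinerVertex_of_notMem hxZ, retraction, if_neg (lt_irrefl _), if_neg (hnot x hx)]
    rw [key x hx, key y hy]
  · have key : ∀ x, retraction t B Z i U z (steinerVertex t Z j x) =
        if x ∈ U then center B Z (i + 1) x else z := by
      intro x
      by_cases hxZ : x ∈ Z (j + 1)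
      · rw [steinerVertex_of_mem hxZ, retraction]
      · rw [steinerVertex_of_notMem hxZ, retraction, if_neg hji.not_gt, if_neg hji.ne']
    have hxU : x ∈ U ↔ y ∈ U :=
      ⟨fun h => components.mem_of_connects hU h (hB.connects_of_le hji.le j.2.le hxy),
        fun h => components.mem_of_connects hU h (hB.connects_of_le hji.le j.2.le hxy.symm)⟩
    rw [key, key, hZ.center_congr i.2 (hB.connects_of_le hji j.2.le hxy)]
    simp only [hxU]

/-- A walk around an edge of a piece would be retracted to a walk around it within the piece, which
is a tree. -/
theorem isForest_buildTree : IsForest (buildTree R t B Z).toGraph := by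
  rintro ⟨⟨⟨i, U⟩, hU⟩, f⟩ a b hl hcon
  obtain ⟨x, y, hxy, rfl, rfl⟩ := buildTree_isLink.1 hl
  obtain ⟨hT, -, hVU, -⟩ := piece_spec hB hZ hR hpos i hU
  obtain ⟨z, ⟨hz, hzU⟩, -⟩ := hZ.unique i i.2.le U hU
  have hρ : ∀ x ∈ (piece R B Z i U).vertexSet,
      retraction t B Z i U z (steinerVertex t Z i x) = x := fun x hx =>
    retraction_self hZ i (hVU hx)
  refine hT.2 f x y hxy ?_
  have := hcon.induct (P := fun c => Connects ((piece R B Z i U).toGraph.deleteEdges {f}) x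
    (retraction t B Z i U z c)) ?_ ?_
  · rwa [hρ y hxy.right_mem] at this
  · rintro ⟨⟨⟨j, U'⟩, hU'⟩, f'⟩ c c' ⟨hl', hne⟩ hc
    obtain ⟨x', y', hxy', rfl, rfl⟩ := buildTree_isLink.1 hl'
    by_cases hk : j = i ∧ U' = U
    · obtain ⟨rfl, rfl⟩ := hk
      rw [hρ x' hxy'.left_mem] at hc
      rw [hρ y' hxy'.right_mem]
      refine hc.trans (.of_isLink (e := f') ?_)
      rw [Graph.deleteEdges_isLink]
      refine ⟨hxy', fun hf => hne ?_⟩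
      rw [Set.mem_singleton_iff.1 hf]
      rfl
    · have hVU' := (piece_spec hB hZ hR hpos j hU').2.2.1
      have := retraction_eq hB hZ i hU hz hzU j hU' hk (hVU' hxy'.left_mem) (hVU' hxy'.right_mem)
      rwa [← this]
  · rw [hρ x hxy.left_mem]
    exact .refl hxy.left_mem

open Classical in
/-- Every piece embeds into the tree of its component, and at each level an edge of `G` lies in at
most one of these. -/
theorem embeddable_buildTree [Finite β]
    (hcong : ∀ e ∈ G.edgeSet, ∑ i ∈ Finset.range (t + 1),
      (if e ∈ (B i).edgeSet then 1 / (B i).len e else 0) ≤ 1 / G.len e) :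
    Embeddable (buildTree R t B Z) G := by
  have := Fintype.ofFinite {k : Fin t × Set α // k.2 ∈ components (B k.1).toGraph}
  have := Fintype.ofFinite (Sym2 α)
  choose φ hφ using fun k : {k : Fin t × Set α // k.2 ∈ components (B k.1).toGraph} =>
    (piece_spec hB hZ hR hpos k.1.1 k.2).2.2.2.2
  have hedge : ∀ f, f ∈ (buildTree R t B Z).edgeSet ↔
      f.2 ∈ (piece R B Z f.1.1.1 f.1.1.2).edgeSet := by
    intro f
    rw [Graph.edge_mem_iff_exists_isLink, Graph.edge_mem_iff_exists_isLink]
    constructor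
    · rintro ⟨a, b, hl⟩
      obtain ⟨x, y, hl, -⟩ := buildTree_isLink.1 hl
      exact ⟨x, y, hl⟩
    · rintro ⟨x, y, hl⟩
      exact ⟨_, _, buildTree_isLink.2 ⟨x, y, hl, rfl, rfl⟩⟩
  have hle : ∀ k : {k : Fin t × Set α // k.2 ∈ components (B k.1).toGraph},
      ((B k.1.1).inducedOn k.1.2).toGraph ≤ G.toGraph := fun k =>
    (LGraph.inducedOn_le (components.subset k.2)).trans (hB.subgraph _ k.1.1.2.le).1
  have hπ : ∀ (i : Fin t) (x : α),
      Sum.elim id (fun s : Fin t × α => s.2) (steinerVertex t Z i x) = x := by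
    intro i x
    rw [steinerVertex]
    split_ifs <;> rfl
  refine ⟨{ π := Sum.elim id fun s => s.2, path := fun f => (φ f.1).path f.2,
            W := fun f e => (φ f.1).W f.2 e,
            π_mem := ?_, path_isPath := ?_, W_pos := ?_, W_zero := ?_,
            congestion := ?_, dilation := ?_ }⟩
  · intro a ha
    obtain ⟨i, U, hU, x, hx, rfl⟩ := mem_vertexSet_buildTree.1 ha
    rw [hπ, ← hB.vertexSet_eq i i.2.le]
    exact components.subset hU ((piece_spec hB hZ hR hpos i hU).2.2.1 hx)
  · intro f hf
    obtain ⟨x, y, hl, hp, hne⟩ := (φ f.1).path_isPath f.2 ((hedge f).1 hf)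
    rw [hφ f.1 x hl.left_mem, hφ f.1 y hl.right_mem] at hp
    refine ⟨_, _, buildTree_isLink.2 ⟨x, y, hl, rfl, rfl⟩, ?_, hne⟩
    rw [hπ, hπ]
    exact hp.mono (hle f.1)
  · exact fun f hf => (φ f.1).W_pos f.2 ((hedge f).1 hf)
  · exact fun f hf => (φ f.1).W_zero f.2 ((hedge f).1 hf)
  · intro e he
    refine le_trans ?_ (hcong e he)
    -- each piece uses at most the weight of its level, and at each level at most one piece uses `e`
    have hpiece : ∀ k : {k : Fin t × Set α // k.2 ∈ components (B k.1).toGraph},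
        ∑ f, (buildTree R t B Z).edgeSet.indicator (fun f => (φ f.1).W f.2 e) (k, f) ≤
          if e ∈ ((B k.1.1).inducedOn k.1.2).edgeSet then 1 / (B k.1.1).len e else 0 := by
      intro k
      have h1 : ∑ f, (buildTree R t B Z).edgeSet.indicator (fun f => (φ f.1).W f.2 e) (k, f) =
          ∑ᶠ f ∈ (piece R B Z k.1.1 k.1.2).edgeSet, (φ k).W f e := by
        rw [finsum_mem_def, finsum_eq_sum_of_fintype]
        refine Finset.sum_congr rfl fun f _ => ?_
        simp only [Set.indicator_apply, hedge]
      rw [h1]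
      split_ifs with hek
      · exact (φ k).congestion e hek
      · refine le_of_eq (finsum_mem_eq_zero_of_forall_eq_zero fun f hf => (φ k).W_zero f hf e ?_)
        intro hef
        obtain ⟨x, y, -, hp, -⟩ := (φ k).path_isPath f hf
        exact hek (hp.1.edge_mem hef)
    rw [finsum_mem_def, finsum_eq_sum_of_fintype, Fintype.sum_prod_type]
    refine (Finset.sum_le_sum fun k _ => hpiece k).trans ?_
    rw [← Finset.sum_filter, ← Finset.sum_filter]
    have hinj : Set.InjOn
        (fun k : {k : Fin t × Set α // k.2 ∈ components (B k.1).toGraph} => (k.1.1 : ℕ))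
        (Finset.univ.filter fun k : {k : Fin t × Set α // k.2 ∈ components (B k.1).toGraph} =>
          e ∈ ((B k.1.1).inducedOn k.1.2).edgeSet : Finset _) := by
      rintro ⟨⟨i, U⟩, hU⟩ hk ⟨⟨i', U'⟩, hU'⟩ hk' hii'
      obtain rfl : i = i' := Fin.ext hii'
      simp only [Finset.coe_filter, Finset.mem_univ, true_and, Set.mem_ofPred_eq] at hk hk'
      obtain ⟨x, y, hl, hx, -⟩ := Graph.exists_isLink_of_mem_edgeSet hk
      have hx' := (LGraph.ends_mem_of_mem_inducedOn hk' hl).1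
      obtain rfl := components.eq_of_mem hU hU' hx hx'
      rfl
    rw [← Finset.sum_image (f := fun i => 1 / (B i).len e) hinj]
    refine Finset.sum_le_sum_of_subset_of_nonneg (fun i hi => ?_) fun i hi _ => ?_
    · obtain ⟨k, hk, rfl⟩ := Finset.mem_image.1 hi
      refine Finset.mem_filter.2 ⟨Finset.mem_range.2 (by have := k.1.1.2; omega), ?_⟩
      exact (LGraph.inducedOn_edgeSet_subset (Finset.mem_filter.1 hk).2)
    · obtain ⟨hi, hei⟩ := Finset.mem_filter.1 hi
      have := Finset.mem_range.1 hi
      exact (one_div_pos.2 (hB.posLen hpos (by omega) e hei)).le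
  · exact fun f hf => (φ f.1).dilation f.2 ((hedge f).1 hf)

end BuildTree

/-! ### The stretch of the Steiner tree -/

theorem expectation_le_mul {Ω : Type*} {𝓓 : PMF Ω} {X Y : Ω → ℝ≥0∞} {c : ℝ≥0∞}
    (h : ∀ a ∈ 𝓓.support, X a ≤ c * Y a) : expectation 𝓓 X ≤ c * expectation 𝓓 Y := by
  rw [expectation, expectation, ← ENNReal.tsum_mul_left]
  refine ENNReal.tsum_le_tsum fun a => ?_
  by_cases ha : a ∈ 𝓓.support
  · rw [mul_left_comm]
    gcongr
    exact h a ha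
  · simp [(𝓓.apply_eq_zero_iff a).2 ha]

section TreeStretch

variable {p : ℝ} {G : LGraph α β} {t : ℕ} {d : ℕ → ℝ} {B : ℕ → LGraph α β} {Z : ℕ → Set α}
  {R : LGraph α β → Set α → LGraph α (Sym2 α)}

/-- Both ends of an edge are close, in the Steiner tree, to the center of the component in which
they last lie together, so the edge is stretched by little more than in the decomposition. -/
theorem treeStretch_le_decompStretch [Finite α] (hp : 0 < p) (hp1 : p ≤ 1)
    (hB : IsBartalDecomposition G t B) (hZ : IsCenterChoice t B Z) (hR : IsTreeReduction R)
    (hpos : G.PosLen) (hd : BoundsDiameter (1 / 4) G t d B) {e : β} {x y : α}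
    (he : e ∈ G.edgeSet) (ht : cutLevel G B e < t)
    (hcon : Connects (B (cutLevel G B e)).toGraph x y) :
    treeStretch p G (buildTree R t B Z) e x y ≤
      3 * ENNReal.ofReal (decompStretch p G d B e) := by
  have hl : 0 < G.len e := hpos e he
  have hdi := hd.pos _ ht.le
  have h := dist_buildTree_le hB hZ hR hpos (by omega) hd ht.le hcon
  calc treeStretch p G (buildTree R t B Z) e x y
      ≤ (ENNReal.ofReal (3 * d (cutLevel G B e)) / ENNReal.ofReal (G.len e)) ^ p := by
        rw [treeStretch]
        gcongr
    _ = ENNReal.ofReal ((3 * (d (cutLevel G B e) / G.len e)) ^ p) := by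
        rw [← ENNReal.ofReal_div_of_pos hl, ENNReal.ofReal_rpow_of_nonneg (by positivity) hp.le,
          mul_div_assoc]
    _ ≤ ENNReal.ofReal (3 * decompStretch p G d B e) := by
        refine ENNReal.ofReal_le_ofReal ?_
        rw [Real.mul_rpow (by norm_num) (by positivity), decompStretch]
        gcongr
        calc (3 : ℝ) ^ p ≤ 3 ^ (1 : ℝ) := Real.rpow_le_rpow_of_exponent_le (by norm_num) hp1
          _ = 3 := Real.rpow_one _
    _ = _ := by
        rw [ENNReal.ofReal_mul (by norm_num)]
        norm_num

end TreeStretch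

theorem IsConnected.edgeSet_nonempty [Finite α] {G : LGraph α β} (hc : IsConnected G.toGraph)
    (hn : 2 ≤ G.order) : G.edgeSet.Nonempty := by
  obtain ⟨x, hx, y, hy, hne⟩ := (Set.one_lt_ncard (s := G.vertexSet)).1 hn
  by_contra! h
  refine hne ((hc.2 x hx y hy).induct (P := fun z => x = z) (fun e a b hl _ => ?_) rfl)
  exact absurd hl.edge_mem (h ▸ Set.notMem_empty e)

end LowStretch

open LowStretch

theorem mainTheorem2 :
    ∃ K c cgeo C : ℝ, 0 < K ∧ 0 < c ∧ c < 1 ∧ 0 < cgeo ∧ 0 < C ∧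
    ∀ (α : Type u) (β : Type v) [Fintype α] [Fintype β],
      (∃ P : LGraph α β → ℝ → PMF (Set β), IsPartitionRoutine K P) ∧
      (∃ R : LGraph α β → Set α → LGraph α (Sym2 α),
        IsTreeReduction R) ∧
      ∀ (P : LGraph α β → ℝ → PMF (Set β)), IsPartitionRoutine K P →
      ∀ (G : LGraph α β) (Δ p q : ℝ) (t : ℕ),
        G.toGraph.Loopless → IsConnected G.toGraph → 2 ≤ G.order →
        (∀ e ∈ G.edgeSet, 1 ≤ G.len e ∧ G.len e ≤ Δ) →
        0 < p → p < 1 → q = (1 + p) / 2 →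
        bartalBounds G.order Δ t < 1 →
        (∃ (T₀ : Set β) (r : α),
          IsShortestPathTree ((G.powLen (p / q)).restrictEdges T₀) (G.powLen (p / q)) r) ∧
        ∀ (T₀ : Set β) (r : α),
          IsShortestPathTree ((G.powLen (p / q)).restrictEdges T₀) (G.powLen (p / q)) r →
        ∀ (d' d : ℕ → ℝ) (𝓓 : PMF (ℕ → LGraph α β)),
          d' = bartalBounds G.order Δ →
          d = switchBounds cgeo p q G.order d' →
          𝓓 = embeddableDecompose cgeo p q
            (decomposeSimple P T₀ t d') d' G →
          (∀ B ∈ 𝓓.support, IsEmbeddableBartalDecomposition G t B ∧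
            BoundsDiameter c G t d B ∧ ∃ Z₀ : ℕ → Set α, IsCenterChoice t B Z₀) ∧
          (∀ e ∈ G.edgeSet,
            expectation 𝓓
                (fun B => ENNReal.ofReal (decompStretch p G d B e)) ≤
              ENNReal.ofReal (C * (1 / (1 - p)) ^ 2 * Real.log G.order ^ p)) ∧
          ∀ (R : LGraph α β → Set α → LGraph α (Sym2 α))
            (Z : (ℕ → LGraph α β) → ℕ → Set α),
            IsTreeReduction R →
            (∀ B ∈ 𝓓.support, IsCenterChoice t B (Z B)) →
            (∀ B ∈ 𝓓.support,
              IsTree (buildTree R t B (Z B)).toGraph ∧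
              (∀ x ∈ G.vertexSet,
                Sum.inl x ∈ (buildTree R t B (Z B)).vertexSet) ∧
              Embeddable (buildTree R t B (Z B)) G) ∧
            ∀ e x y, G.IsLink e x y →
              expectation 𝓓
                  (fun B => treeStretch p G
                    (buildTree R t B (Z B)) e x y) ≤
                ENNReal.ofReal (C * (1 / (1 - p)) ^ 2 * Real.log G.order ^ p) := by
  -- `520 = 32 * 16 + 8` bounds the stretch of the decomposition, and `1560 = 3 * 520` that of the
  -- tree
  refine ⟨16, 1 / 4, 1, 1560, by norm_num, by norm_num, by norm_num, by norm_num, by norm_num, ?_⟩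
  intro α β _ _
  refine ⟨exists_isPartitionRoutine, exists_isTreeReduction, ?_⟩
  intro P hP G Δ p q t hloop hconn hn hlen hp hp1 hq hdt
  have hpq : p < q := by linarith
  have hq1 : q ≤ 1 := by linarith
  have hqp : q - p ≤ 1 := by linarith
  have hn' : (2 : ℝ) ≤ G.order := by exact_mod_cast hn
  have hlog : 0 < Real.log G.order := Real.log_pos (by linarith)
  have hlen1 : ∀ e ∈ G.edgeSet, 1 ≤ G.len e := fun e he => (hlen e he).1
  have hpos : G.PosLen := fun e he => zero_lt_one.trans_le (hlen1 e he)
  have hΔ : 1 ≤ Δ := by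
    obtain ⟨e, he⟩ := hconn.edgeSet_nonempty hn
    exact (hlen e he).1.trans (hlen e he).2
  refine ⟨?_, ?_⟩
  · obtain ⟨r, hr⟩ := hconn.1
    obtain ⟨T₀, -, hT₀⟩ := LGraph.exists_shortestPathTree (H := G.powLen (p / q)) (r := r)
      (fun e he => Real.rpow_pos_of_pos (hpos e he) _) hr fun v hv => hconn.2 v hv r hr
    exact ⟨T₀, r, hT₀⟩
  rintro T₀ r hT₀ d' d 𝓓 rfl rfl rfl
  have hd0 : 0 < bartalBounds G.order Δ 0 := by rw [bartalBounds]; positivity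
  have hd : ∀ i, bartalBounds G.order Δ i = bartalBounds G.order Δ 0 / 4 ^ i := fun i => by
    simp [bartalBounds]
  have hrun := fun ω => isBartalRun_of_mem_support (t := t) (ω := ω) hP hp hpq hloop hn hlen hΔ
    hdt hT₀
  have hsupp : ∀ B ∈ (embeddableDecompose 1 p q
      (decomposeSimple P T₀ t (bartalBounds G.order Δ)) (bartalBounds G.order Δ) G).support,
      ∃ L, B = switchedLevels p q G (bartalBounds G.order Δ) L ∧
        IsBartalRun (G.powLen (p / q)) t (bartalBounds G.order Δ) L := by
    intro B hB
    rw [embeddableDecompose_eq] at hB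
    obtain ⟨ω, hω, rfl⟩ := (PMF.mem_support_map_iff _ _ _).1 hB
    exact ⟨_, rfl, hrun ω hω⟩
  have hdecomp : ∀ e ∈ G.edgeSet, expectation (embeddableDecompose 1 p q
      (decomposeSimple P T₀ t (bartalBounds G.order Δ)) (bartalBounds G.order Δ) G)
        (fun B => ENNReal.ofReal
          (decompStretch p G (switchBounds 1 p q G.order (bartalBounds G.order Δ)) B e)) ≤
      ENNReal.ofReal (520 * (1 / (1 - p)) ^ 2 * Real.log G.order ^ p) := by
    intro e he
    have := expectation_decompStretch_le (by norm_num) hP hp hp1 hq hloop hlog hlen1 hd0 hd hrun he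
    norm_num at this ⊢
    exact this
  refine ⟨fun B hB => ?_, fun e he => (hdecomp e he).trans ?_,
    fun R Z hR hZ => ⟨fun B hB => ?_, ?_⟩⟩
  · obtain ⟨L, rfl, hL⟩ := hsupp B hB
    have hBart := isBartalDecomposition_switchedLevels hp hpq hqp hlog hd0 hd hlen1 hL
    exact ⟨⟨hBart, embeddable_levelUnion_switchedLevels hp hpq hlog hd0 hd hlen1 hL hq1 hloop⟩,
      boundsDiameter_switchedLevels hp hpq hqp hlog hd0 hd hlen1 hL, hBart.exists_isCenterChoice⟩
  · gcongr
    norm_num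
  · have hZB := hZ B hB
    obtain ⟨L, rfl, hL⟩ := hsupp B hB
    have hBart := isBartalDecomposition_switchedLevels hp hpq hqp hlog hd0 hd hlen1 hL
    have hdiam := boundsDiameter_switchedLevels hp hpq hqp hlog hd0 hd hlen1 hL
    have ht : 0 < t := by
      rw [pos_iff_ne_zero]
      rintro rfl
      have : bartalBounds G.order Δ 0 = 2 * G.order * Δ := by simp [bartalBounds]
      nlinarith
    refine ⟨⟨isConnected_buildTree hBart hZB hR hpos ht hdiam,
        isForest_buildTree hBart hZB hR hpos⟩,
      fun x hx => inl_mem_buildTree hBart hZB hR hpos ht hx,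
      embeddable_buildTree hBart hZB hR hpos fun e he => ?_⟩
    classical
    refine le_trans (le_of_eq (Finset.sum_congr rfl fun i _ => ?_))
      (sum_weight_switchedLevels_le hp hpq hq1 hlog hd0 hd (L := L) (t := t) (hlen1 e he)
        fun i hi heL => hL.len_le i hi e he heL)
    have : e ∈ (switchedLevels p q G (bartalBounds G.order Δ) L i).edgeSet ↔ e ∈ L i :=
      ⟨fun h => h.2, fun h => ⟨he, h⟩⟩
    simp only [this]
  · intro e x y hl
    have he := hl.edge_mem
    refine (expectation_le_mul fun B hB => ?_).trans ((mul_le_mul_right (hdecomp e he) 3).trans ?_)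
    · have hZB := hZ B hB
      obtain ⟨L, rfl, hL⟩ := hsupp B hB
      obtain ⟨hi, hcut⟩ := cutLevel_switchedLevels hloop hL hl
      exact treeStretch_le_decompStretch hp hp1.le
        (isBartalDecomposition_switchedLevels hp hpq hqp hlog hd0 hd hlen1 hL) hZB hR hpos
        (boundsDiameter_switchedLevels hp hpq hqp hlog hd0 hd hlen1 hL) he hi hcut.1
    · rw [← ENNReal.ofReal_ofNat 3, ← ENNReal.ofReal_mul (by norm_num)]
      refine ENNReal.ofReal_le_ofReal (le_of_eq ?_)
      ring
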